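/- **Setting.** Let $V=(X,Z)$ with $X\in\mathbf R^{d_x}$, $Z=(Z_1,\dots,Z_{\mathcal J})$, $Z_\jmath\in\mathbf R^{d_{z_\jmath}}$, and let $\mathbf P$ be a set of distributions of $V$. For each $n$ let $q_{k,n,\jmath}:\mathbf R^{d_{z_\jmath}}\to\mathbf R$, $1\le k\le k_{n,\jmath}$, $1\le\jmath\le\mathcal J$, be measurable, $k_n=\sum_{\jmath}k_{n,\jmath}$, and let $q_n^{k_n}(z)\in\mathbf R^{k_n}$ be the vector of all the $q_{k,n,\jmath}(z_\jmath)$. Let $\mathcal F_n$ be a class of measurable real functions of $V$ with measurable envelope $F_n$, i.e. $|f|\le F_n$ for all $f\in\mathcal F_n$. Let $r\in[2,\infty]$, let $\|\cdot\|_r$ be the $\ell^r$ norm on $\mathbf R^{k_n}$, and write $\log_+k=\max\{\log k,1\}$. For weights $\omega_1,\dots,\omega_n$ the multiplier bootstrap process is $$\hat{\mathbb W}_nf=\frac1{\sqrt n}\sum_{i=1}^n\omega_i\Big\{f(V_i)-\frac1n\sum_{l=1}^nf(V_l)\Big\},$$ and $\hat{\mathbb W}_nfq_n^{k_n}\in\mathbf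 R^{k_n}$ denotes the vector of the $\hat{\mathbb W}_n(fq_{k,n,\jmath})$. An isonormal process on $L^2_P$ is a centred Gaussian process $\mathbb W$ indexed by $L^2_P$ with $E[\mathbb Wf\,\mathbb Wg]=E_P[(f-E_Pf)(g-E_Pg)]$. **Assumptions.** 1. $\{V_i\}$ is i.i.d. with $V_i\sim P\in\mathbf P$. 2. $\sup_{P\in\mathbf P}\|q_{k,n,\jmath}\|_{L^\infty_P}\le B_n$ for all $k,\jmath,n$, where $B_n\ge1$. 3. $\sup_{P\in\mathbf P}E_P[F_n^2(V)]<\infty$ for each $n$. 4. For each $P\in\mathbf P$ and $n$ there is a sequence $\{p_{j,n,P}\}_{j\ge1}\subset L^2_P$ such that: (i) it is orthonormal in $L^2_P$, and $\|p_{j,n,P}\|_{L^\infty_P}$ is bounded uniformly in $j,n$ and $P\in\mathbf P$; (ii) for every nondecreasing integer sequence $j_n\to\infty$, with $p^{j_n}_{n,P}=(p_{1,n,P},\dots,p_{j_n,n,P})'$, the eigenvalues of $E_P[(q_n^{k_n}(Z)\otimes p_{n,P}^{j_n}(V))(q_n^{k_n}(Z)\otimes p_{n,P}^{j_n}(V))']$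 are bounded uniformly in $n$ and $P\in\mathbf P$; (iii) for some $M_n\uparrow\infty$ and $\gamma_\rho>3/2$ (not depending on $P$), every $f\in\mathcal F_n$ has the form $f(v)=\sum_{j\ge1}p_{j,n,P}(v)\beta_j$ with $|\beta_j|\le M_n/j^{\gamma_\rho}$ for all $j$, where the identity holds for all $v$ outside a single $P$-null set that may depend on $n$ and $P$ but not on $f$. 5. For each $n$, $\omega_1,\dots,\omega_n$ are i.i.d. $N(0,1)$ and independent of $V_1,\dots,V_n$. **Theorem.** Let $j_n\to\infty$ be a nondecreasing integer sequence with $j_nk_n\log(j_nk_n)B_n=o(n)$. Then, after enlarging the underlying probability space by an independent factor, there is for every $n$ and every $P\in\mathbf P$ an isonormal process $\mathbb W^\star_{n,P}$ on $L^2_P$, independent of $\{V_i\}_{i=1}^n$, such that, uniformly in $P\in\mathbf P$, $$\sup_{f\in\mathcal F_n}\|\hat{\mathbb W}_nfq_n^{k_n}-\mathbb W^\star_{n,P}fq_n^{k_n}\|_r=O_p(R_n),$$ $$R_n=\frac{\sup_{P\in\mathbf P}\|F_n\|_{L^2_P}\,B_n^{1/2}\,k_n^{1/4+1/r}\,(j_n\log_+k_n)^{3/4}(\log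 j_n)^{1/4}}{n^{1/4}}+\frac{k_n^{1/r}B_nM_n\sqrt{\log_+k_n}}{j_n^{\gamma_\rho-3/2}}.$$ That is, for every $\varepsilon>0$ there is $C>0$ such that for all sufficiently large $n$ and all $P\in\mathbf P$ the (outer) probability under $P$ that the supremum exceeds $C R_n$ is at most $\varepsilon$. -/

import Mathlib

open MeasureTheory ProbabilityTheory Filter Topology
open scoped ENNReal

namespace MultiplierBootstrap

noncomputable section

/-- The space in which one observation `V = (X, Z)`, `Z = (Z_1, …, Z_J)`, takes its values:
`X ∈ ℝ^{dx}` and `Z_j ∈ ℝ^{dz j}`. -/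
abbrev Obs (dx : ℕ) {J : ℕ} (dz : Fin J → ℕ) : Type :=
  (Fin dx → ℝ) × ((j : Fin J) → (Fin (dz j) → ℝ))

/-- The index set of the stacked vector of instrument transformations, of size `∑ j, k j`. -/
abbrev InstrIdx {J : ℕ} (k : Fin J → ℕ) : Type := (j : Fin J) × Fin (k j)

/-- The total number of instrument transformations. -/
def totalInstr {J : ℕ} (k : Fin J → ℕ) : ℕ := ∑ j, k j

/-- The coordinates of the stacked vector of instrument transformations, as functions of the whole
observation: the coordinate `(j, k)` only sees the `j`-th instrument. -/
def instr {dx J : ℕ} {dz : Fin J → ℕ} {k : Fin J → ℕ}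
    (q : (j : Fin J) → Fin (k j) → (Fin (dz j) → ℝ) → ℝ) (a : InstrIdx k) (v : Obs dx dz) : ℝ :=
  q a.1 a.2 (v.2 a.1)

/-- The norm `‖a‖_r` on `ℝ^ι` (the maximum norm if `r = ∞`). -/
def rNorm {ι : Type*} [Fintype ι] (r : ℝ≥0∞) (a : ι → ℝ) : ℝ := ‖WithLp.toLp r a‖

/-- The Gaussian multiplier bootstrap process
`n^{-1/2} ∑ i, ω_i (f(V_i) - n⁻¹ ∑ l, f(V_l))`, for weights `w` and data `v`. -/
def multiplier {𝒱 : Type*} {n : ℕ} (w : Fin n → ℝ) (v : Fin n → 𝒱) (f : 𝒱 → ℝ) : ℝ :=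
  (1 / √(n : ℝ)) * ∑ i, w i * (f (v i) - (1 / (n : ℝ)) * ∑ l, f (v l))

/-- `W` is an isonormal process on `L²_P`: a centred Gaussian process indexed by the square
integrable functions with `E[W f W g] = E_P[(f - E_P f)(g - E_P g)]`, which depends on a function
only through its class in `L²_P`. (Values of `W` at functions outside `L²_P` are irrelevant.) -/
structure IsIsonormal {𝒱 Ω : Type*} [MeasurableSpace 𝒱] [MeasurableSpace Ω] (P : Measure 𝒱)
    (W : (𝒱 → ℝ) → Ω → ℝ) (μ : Measure Ω) : Prop where
  measurable : ∀ f, MemLp f 2 P → Measurable (W f)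
  gaussian : IsGaussianProcess (fun f : {f : 𝒱 → ℝ // MemLp f 2 P} => W f) μ
  mean_zero : ∀ f, MemLp f 2 P → ∫ x, W f x ∂μ = 0
  cov : ∀ f g, MemLp f 2 P → MemLp g 2 P →
    ∫ x, W f x * W g x ∂μ = ∫ v, (f v - ∫ u, f u ∂P) * (g v - ∫ u, g u ∂P) ∂P
  congr : ∀ f g, MemLp f 2 P → MemLp g 2 P → f =ᵐ[P] g → W f = W g

/-- Under each `μ P`, `P ∈ Ps`, the `V i` are i.i.d. with law `P`. -/
def IsIIDSample {𝒱 Ω : Type*} [MeasurableSpace 𝒱] [MeasurableSpace Ω] (Ps : Set (Measure 𝒱))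
    (μ : Measure 𝒱 → Measure Ω) (V : ℕ → Ω → 𝒱) : Prop :=
  (∀ i, Measurable (V i)) ∧
    ∀ P ∈ Ps, iIndepFun V (μ P) ∧ ∀ i, HasLaw (V i) P (μ P)

/-- Under each `μ P`, `P ∈ Ps`, and for each `n`, the weights `ω_1, …, ω_n` are i.i.d. standard
normal and independent of the data `V_1, …, V_n`. -/
def IsGaussianMultiplier {𝒱 Ω : Type*} [MeasurableSpace 𝒱] [MeasurableSpace Ω]
    (Ps : Set (Measure 𝒱)) (μ : Measure 𝒱 → Measure Ω) (V : ℕ → Ω → 𝒱)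
    (w : (n : ℕ) → Fin n → Ω → ℝ) : Prop :=
  (∀ n i, Measurable (w n i)) ∧
    ∀ P ∈ Ps, ∀ n, iIndepFun (w n) (μ P) ∧ (∀ i, HasLaw (w n i) (gaussianReal 0 1) (μ P)) ∧
      IndepFun (fun x (i : Fin n) => w n i x) (fun x (i : Fin n) => V i x) (μ P)

/-- The instrument transformations are measurable and bounded by `B n ≥ 1` in every `L^∞_P`. -/
def InstrBounded {dx J : ℕ} {dz : Fin J → ℕ} (Ps : Set (Measure (Obs dx dz)))
    (k : ℕ → Fin J → ℕ)
    (q : (n : ℕ) → (j : Fin J) → Fin (k n j) → (Fin (dz j) → ℝ) → ℝ) (B : ℕ → ℝ) : Prop :=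
  (∀ n, 1 ≤ B n) ∧ (∀ n j l, Measurable (q n j l)) ∧
    ∀ n, ∀ a : InstrIdx (k n), ∀ P ∈ Ps,
      eLpNorm (instr (dx := dx) (q n) a) ∞ P ≤ ENNReal.ofReal (B n)

/-- `sup_{P ∈ Ps} ‖F‖_{L²_P}`, as an extended real. -/
def envSup {𝒱 : Type*} [MeasurableSpace 𝒱] (Ps : Set (Measure 𝒱)) (F : 𝒱 → ℝ) : ℝ≥0∞ :=
  ⨆ P ∈ Ps, eLpNorm F 2 P

/-- `F n` is a measurable envelope of the class `ℱ n` of measurable functions, and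
`sup_{P ∈ Ps} E_P[F_n²] < ∞` for each `n`. -/
def HasEnvelope {𝒱 : Type*} [MeasurableSpace 𝒱] (Ps : Set (Measure 𝒱)) (ℱ : ℕ → Set (𝒱 → ℝ))
    (F : ℕ → 𝒱 → ℝ) : Prop :=
  (∀ n, Measurable (F n)) ∧ (∀ n, ∀ f ∈ ℱ n, Measurable f ∧ ∀ v, |f v| ≤ F n v) ∧
    ∀ n, (⨆ P ∈ Ps, ∫⁻ v, ENNReal.ofReal (F n v ^ 2) ∂P) < ∞

/-- The matrix `E_P[(q(Z) ⊗ p^m(V)) (q(Z) ⊗ p^m(V))']`, where `p^m = (p 0, …, p (m - 1))`. -/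
def gram {dx J : ℕ} {dz : Fin J → ℕ} {k : Fin J → ℕ} (P : Measure (Obs dx dz))
    (q : (j : Fin J) → Fin (k j) → (Fin (dz j) → ℝ) → ℝ) (p : ℕ → Obs dx dz → ℝ) (m : ℕ) :
    Matrix (InstrIdx k × Fin m) (InstrIdx k × Fin m) ℝ :=
  Matrix.of fun s t =>
    ∫ v, (instr q s.1 v * p s.2 v) * (instr q t.1 v * p t.2 v) ∂P

/-- The arrays `p P n = (p P n 0, p P n 1, …)` approximate the classes `ℱ n`. The expansion of the
members of `ℱ n` is an identity between functions, outside a single `P`-null set. The usual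
index `j = 1, 2, …` is `j + 1` here. -/
structure SmoothClass {dx J : ℕ} {dz : Fin J → ℕ} (Ps : Set (Measure (Obs dx dz)))
    (k : ℕ → Fin J → ℕ)
    (q : (n : ℕ) → (j : Fin J) → Fin (k n j) → (Fin (dz j) → ℝ) → ℝ)
    (ℱ : ℕ → Set (Obs dx dz → ℝ)) (p : Measure (Obs dx dz) → ℕ → ℕ → Obs dx dz → ℝ)
    (M : ℕ → ℝ) (γ : ℝ) : Prop where
  memLp : ∀ P ∈ Ps, ∀ n j, MemLp (p P n j) 2 P
  orthonormal : ∀ P ∈ Ps, ∀ n i j, ∫ v, p P n i v * p P n j v ∂P = if i = j then 1 else 0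
  bounded : ∃ C : ℝ, ∀ P ∈ Ps, ∀ n j, eLpNorm (p P n j) ∞ P ≤ ENNReal.ofReal C
  eigenvalues : ∀ m : ℕ → ℕ, Monotone m → Tendsto m atTop atTop →
    ∃ C : ℝ, ∀ n, ∀ P ∈ Ps, ∀ t : ℝ,
      Module.End.HasEigenvalue (Matrix.toLin' (gram P (q n) (p P n) (m n))) t → t ≤ C
  M_monotone : Monotone M
  M_tendsto : Tendsto M atTop atTop
  gamma_gt : 3 / 2 < γ
  expansion : ∀ P ∈ Ps, ∀ n, ∃ N : Set (Obs dx dz), P N = 0 ∧ ∀ f ∈ ℱ n, ∃ β : ℕ → ℝ,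
    (∀ j : ℕ, |β j| ≤ M n / ((j : ℝ) + 1) ^ γ) ∧
      ∀ v, v ∉ N → HasSum (fun j => p P n j v * β j) (f v)

/-- `max (log k) 1`. -/
def logPlus (k : ℕ) : ℝ := max (Real.log k) 1

/-- The coupling rate, for sample size `n`, `m` approximating functions, `k` instrument
transformations bounded by `B`, envelope size `D`, and coefficient bounds `M / j ^ γ`. -/
def couplingRate (r : ℝ≥0∞) (γ : ℝ) (n m k : ℕ) (D B M : ℝ) : ℝ :=
  D * B ^ (1 / 2 : ℝ) * (k : ℝ) ^ (1 / 4 + (1 / r).toReal) * ((m : ℝ) * logPlus k) ^ (3 / 4 : ℝ) *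
      Real.log m ^ (1 / 4 : ℝ) / (n : ℝ) ^ (1 / 4 : ℝ) +
    (k : ℝ) ^ (1 / r).toReal * B * M * √(logPlus k) / (m : ℝ) ^ (γ - 3 / 2)

/-- `X P n = O_p(ρ n)` uniformly in `P ∈ Ps`, with outer probabilities where `X P n` is not
measurable. -/
def UniformBigOp {𝒱 Ω : Type*} [MeasurableSpace 𝒱] [MeasurableSpace Ω] (Ps : Set (Measure 𝒱))
    (μ : Measure 𝒱 → Measure Ω) (X : Measure 𝒱 → ℕ → Ω → ℝ≥0∞) (ρ : ℕ → ℝ) : Prop :=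
  ∀ ε : ℝ, 0 < ε → ∃ M : ℝ, 0 < M ∧ ∀ᶠ n in atTop, ∀ P ∈ Ps,
    μ P {x | ENNReal.ofReal (M * ρ n) < X P n x} ≤ ENNReal.ofReal ε

end

end MultiplierBootstrap

/-!
The weighted sums `n^{-1/2} ∑ ω_i (x(V_i) - x̄)` for the finite vector `x = q ⊗ (p_1, …, p_m)` are,
given the data, Gaussian with the empirical covariance matrix `Σ̂` of `x`. Let `Σ` be the true
covariance matrix, let `z` be a bound for the order of the operator norm of `Σ̂ - Σ`, and let `g` be a
further standard normal vector. The vector `A ω + √z g`, where `A` is `scoreMatrix` and `A Aᵀ = Σ̂`,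
has covariance `Σ̂ + z` given the data, so `N = (Σ̂ + z)^{-1/2} (A ω + √z g)` is standard normal given
*any* data: it is independent of the data (`map_standardize`). The Gaussian vector `Σ^{1/2} N` is then
a copy of the bootstrap vector that does not depend on the data, and

  `A ω - Σ^{1/2} N = ((Σ̂ + z)^{1/2} - Σ^{1/2}) N - √z g`.

The matrix square root is `1/2`-Hölder continuous (`sub_mulVec_dotProduct_le`), so that the operator
norm of the first coefficient matrix is `O(√z)`; the discrepancy is therefore of order `√z`, which is
the source of the exponent `1/4` of `n` in the rate (`measure_discrepancy_gt_le`).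

* The bound `z`. It has the form `b √(d log d / n)` with `d = k m`, `covRate`. It is obtained by the
  moment method: exchanging one observation with an independent copy gives a recursion for the
  expected traces of the even powers of the error of a second moment matrix
  (`integral_trace_momentError_pow_succ_le`), and the power of order `log d` controls the operator
  norm (`measure_momentError_gt_le`). If `z ≥ 1`, no comparison of covariance matrices is needed:
  both vectors have variances `O(z)`.
* From coordinates to functions. A function `f q_a` with `f = ∑ p_j β_j` is evaluated by summing the
  coordinates `(a, j)`, `j ≤ m`, of the discrepancy with weights `β_j`. By the inequalities of
  Cauchy–Schwarz and Bessel this costs `‖f‖_{L²}` times the Euclidean norm of the block `a` of the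
  discrepancy, and the largest of these `k` norms is controlled by the pointwise maximal inequality
  `sqrt_sum_sq_le_of_exp`. The terms `j > m` of the multiplier process and of its copy are treated
  separately, by the sum of their coefficient bounds (`lintegral_tailBound_le`).
* From the vector to an isonormal process. The vector `Σ^{1/2} N` extends to a Gaussian field on
  `L²_P` that is independent of the data (`exists_isGaussianField_extending`). The supremum over the
  class needs the expansion of the field along `∑ β_j p_j q_a` for all the coefficient sequences at
  once, outside one null set; a modification of the field has this property
  (`IsGaussianField.exists_modification`).

All the bounds hold for each `n` and each distribution, with constants that depend only on the bounds
in the assumptions (`exists_bootstrap_coupling`), whence the uniformity in the distribution. One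
auxiliary space serves all distributions: it carries independent standard normal variables indexed by
all the real functions on the observation space, and these contain a Hilbert basis of every `L²_P`.
-/

namespace MultiplierBootstrap

/-! ### Trace inequalities for symmetric matrices -/

section TraceInequalities

open Matrix

theorem pow_mul_pow_add_le (x y : ℝ) (i j : ℕ) :
    x ^ i * y ^ j + x ^ j * y ^ i ≤ |x| ^ (i + j) + |y| ^ (i + j) := by
  have h1 : x ^ i * y ^ j ≤ |x| ^ i * |y| ^ j := by
    rw [← abs_pow, ← abs_pow, ← abs_mul]; exact le_abs_self _
  have h2 : x ^ j * y ^ i ≤ |x| ^ j * |y| ^ i := by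
    rw [← abs_pow, ← abs_pow, ← abs_mul]; exact le_abs_self _
  have h3 : 0 ≤ (|x| ^ i - |y| ^ i) * (|x| ^ j - |y| ^ j) := by
    rcases le_total |x| |y| with h | h
    · exact mul_nonneg_of_nonpos_of_nonpos
        (sub_nonpos.2 (pow_le_pow_left₀ (abs_nonneg _) h i))
        (sub_nonpos.2 (pow_le_pow_left₀ (abs_nonneg _) h j))
    · exact mul_nonneg (sub_nonneg.2 (pow_le_pow_left₀ (abs_nonneg _) h i))
        (sub_nonneg.2 (pow_le_pow_left₀ (abs_nonneg _) h j))
  rw [pow_add, pow_add]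
  nlinarith

/-- A mean value inequality for the odd power `x ^ (2 q + 1)`: in `x ^ (2 q + 1) - y ^ (2 q + 1) =
(x - y) ∑ x ^ i y ^ (2 q - i)` the terms `i` and `2 q - i` are paired. -/
theorem sub_mul_pow_sub_pow_le (x y : ℝ) (q : ℕ) :
    (x - y) * (x ^ (2 * q + 1) - y ^ (2 * q + 1)) ≤
      ((2 * q + 1 : ℕ) / 2 : ℝ) * ((x - y) ^ 2 * (x ^ (2 * q) + y ^ (2 * q))) := by
  set s : ℝ := ∑ i ∈ Finset.range (2 * q + 1), x ^ i * y ^ (2 * q + 1 - 1 - i) with hs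
  have h1 : x ^ (2 * q + 1) - y ^ (2 * q + 1) = s * (x - y) := by
    rw [hs, (Commute.all x y).geom_sum₂_mul]
  have h2 : s = ∑ i ∈ Finset.range (2 * q + 1), x ^ (2 * q - i) * y ^ i := by
    rw [hs, ← Finset.sum_range_reflect]
    refine Finset.sum_congr rfl fun i hi => ?_
    have hi' := Finset.mem_range.1 hi
    congr 2; omega
  have h3 : s + s ≤ ((2 * q + 1 : ℕ) : ℝ) * (x ^ (2 * q) + y ^ (2 * q)) := by
    nth_rewrite 2 [h2]
    rw [hs, ← Finset.sum_add_distrib]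
    calc _ ≤ ∑ i ∈ Finset.range (2 * q + 1), (x ^ (2 * q) + y ^ (2 * q)) := by
          refine Finset.sum_le_sum fun i hi => ?_
          have hi' := Finset.mem_range.1 hi
          have := pow_mul_pow_add_le x y i (2 * q - i)
          rw [show i + (2 * q - i) = 2 * q by omega, pow_mul |x|, pow_mul |y|, sq_abs, sq_abs,
            ← pow_mul, ← pow_mul] at this
          rw [show 2 * q + 1 - 1 - i = 2 * q - i by omega]
          exact this
      _ = _ := by simp; ring
  rw [h1]
  nlinarith [mul_le_mul_of_nonneg_left h3 (sq_nonneg (x - y))]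

variable {S : Type*} [Fintype S] [DecidableEq S]

/-- The spectral theorem for the powers of a real symmetric matrix. -/
theorem isHermitian_pow_eq {X : Matrix S S ℝ} (hX : X.IsHermitian) (a : ℕ) :
    X ^ a = (hX.eigenvectorUnitary : Matrix S S ℝ) *
      diagonal (fun i => hX.eigenvalues i ^ a) * (hX.eigenvectorUnitary : Matrix S S ℝ)ᵀ := by
  have h := hX.spectral_theorem
  have hU : (hX.eigenvectorUnitary : Matrix S S ℝ)ᵀ * (hX.eigenvectorUnitary : Matrix S S ℝ) = 1 := by
    have := Unitary.coe_star_mul_self hX.eigenvectorUnitary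
    simpa [star_eq_conjTranspose] using this
  have hX' : X = (hX.eigenvectorUnitary : Matrix S S ℝ) * diagonal hX.eigenvalues *
      (hX.eigenvectorUnitary : Matrix S S ℝ)ᵀ := by
    conv_lhs => rw [h]
    simp [Unitary.conjStarAlgAut_apply, star_eq_conjTranspose]
  induction a with
  | zero =>
    have := Unitary.coe_mul_star_self hX.eigenvectorUnitary
    simp only [pow_zero, diagonal_one, Matrix.mul_one]
    simpa [star_eq_conjTranspose] using this.symm
  | succ a ih =>
    rw [pow_succ, ih]
    nth_rewrite 4 [hX']
    calc _ = (hX.eigenvectorUnitary : Matrix S S ℝ) * diagonal (fun i => hX.eigenvalues i ^ a) *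
          ((hX.eigenvectorUnitary : Matrix S S ℝ)ᵀ * (hX.eigenvectorUnitary : Matrix S S ℝ)) *
          diagonal hX.eigenvalues * (hX.eigenvectorUnitary : Matrix S S ℝ)ᵀ := by
            simp only [Matrix.mul_assoc]
      _ = _ := by
        rw [hU, Matrix.mul_one, Matrix.mul_assoc _ (diagonal _) (diagonal _), diagonal_mul_diagonal]
        simp only [pow_succ]

/-- Two symmetric matrices have a joint spectral expansion of the traces of their mixed
powers, with nonnegative weights. -/
theorem exists_trace_pow_mul_pow {X Y : Matrix S S ℝ} (hX : X.IsHermitian) (hY : Y.IsHermitian) :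
    ∃ (l m : S → ℝ) (w : S → S → ℝ), (∀ i j, 0 ≤ w i j) ∧
      ∀ a b : ℕ, (X ^ a * Y ^ b).trace = ∑ i, ∑ j, l i ^ a * m j ^ b * w i j := by
  set U := (hX.eigenvectorUnitary : Matrix S S ℝ)
  set V := (hY.eigenvectorUnitary : Matrix S S ℝ)
  refine ⟨hX.eigenvalues, hY.eigenvalues, fun i j => (Uᵀ * V) i j ^ 2, fun i j => sq_nonneg _,
    fun a b => ?_⟩
  have h : (X ^ a * Y ^ b).trace = (diagonal (fun i => hX.eigenvalues i ^ a) * (Uᵀ * V) *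
      diagonal (fun i => hY.eigenvalues i ^ b) * (Uᵀ * V)ᵀ).trace := by
    rw [isHermitian_pow_eq hX, isHermitian_pow_eq hY, transpose_mul, transpose_transpose]
    simp only [Matrix.mul_assoc]
    rw [trace_mul_comm]
    simp only [Matrix.mul_assoc]
    rfl
  rw [h]
  simp only [trace, diag_apply]
  refine Finset.sum_congr rfl fun i _ => ?_
  rw [Matrix.mul_apply]
  refine Finset.sum_congr rfl fun j _ => ?_
  rw [mul_diagonal, diagonal_mul, transpose_apply]
  ring

/-- The trace form of `sub_mul_pow_sub_pow_le`. It reduces to the scalar inequality by the joint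
spectral expansion, although `X` and `Y` need not commute. -/
theorem trace_sub_mul_pow_sub_pow_le {X Y : Matrix S S ℝ} (hX : X.IsHermitian)
    (hY : Y.IsHermitian) (q : ℕ) :
    ((X - Y) * (X ^ (2 * q + 1) - Y ^ (2 * q + 1))).trace ≤
      ((2 * q + 1 : ℕ) / 2 : ℝ) *
        (((X - Y) ^ 2 * X ^ (2 * q)).trace + ((X - Y) ^ 2 * Y ^ (2 * q)).trace) := by
  obtain ⟨l, m, w, hw, h⟩ := exists_trace_pow_mul_pow hX hY
  have e1 : ((X - Y) * (X ^ (2 * q + 1) - Y ^ (2 * q + 1))).trace =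
      ∑ i, ∑ j, (l i - m j) * (l i ^ (2 * q + 1) - m j ^ (2 * q + 1)) * w i j := by
    have : ((X - Y) * (X ^ (2 * q + 1) - Y ^ (2 * q + 1))).trace =
        (X ^ (2 * q + 2) * Y ^ 0).trace - (X ^ 1 * Y ^ (2 * q + 1)).trace
          - (X ^ (2 * q + 1) * Y ^ 1).trace + (X ^ 0 * Y ^ (2 * q + 2)).trace := by
      rw [Matrix.sub_mul, Matrix.mul_sub, Matrix.mul_sub, trace_sub, trace_sub, trace_sub,
        trace_mul_comm Y (X ^ _), ← pow_succ', ← pow_succ']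
      simp only [pow_zero, pow_one, Matrix.mul_one, Matrix.one_mul]
      ring
    rw [this, h, h, h, h]
    simp only [← Finset.sum_sub_distrib, ← Finset.sum_add_distrib]
    refine Finset.sum_congr rfl fun i _ => Finset.sum_congr rfl fun j _ => ?_
    ring
  have e2 : ((X - Y) ^ 2 * X ^ (2 * q)).trace =
      ∑ i, ∑ j, (l i - m j) ^ 2 * l i ^ (2 * q) * w i j := by
    have : ((X - Y) ^ 2 * X ^ (2 * q)).trace =
        (X ^ (2 * q + 2) * Y ^ 0).trace - 2 * (X ^ (2 * q + 1) * Y ^ 1).trace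
          + (X ^ (2 * q) * Y ^ 2).trace := by
      have h3 : (X * Y * X ^ (2 * q)).trace = (X ^ (2 * q + 1) * Y ^ 1).trace := by
        rw [trace_mul_comm, ← Matrix.mul_assoc, ← pow_succ, pow_one]
      have h4 : (Y * X * X ^ (2 * q)).trace = (X ^ (2 * q + 1) * Y ^ 1).trace := by
        rw [Matrix.mul_assoc, ← pow_succ', trace_mul_comm, pow_one]
      have h5 : (Y * Y * X ^ (2 * q)).trace = (X ^ (2 * q) * Y ^ 2).trace := by
        rw [trace_mul_comm, pow_two]
      have h6 : (X * X * X ^ (2 * q)).trace = (X ^ (2 * q + 2) * Y ^ 0).trace := by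
        rw [trace_mul_comm, ← pow_two, ← pow_add, pow_zero, Matrix.mul_one]
      rw [← h6, ← h5, pow_two, Matrix.sub_mul, Matrix.mul_sub, Matrix.mul_sub]
      simp only [Matrix.sub_mul, trace_sub]
      rw [h3, h4]
      ring
    rw [this, h, h, h]
    simp only [← Finset.sum_sub_distrib, ← Finset.sum_add_distrib, Finset.mul_sum]
    refine Finset.sum_congr rfl fun i _ => Finset.sum_congr rfl fun j _ => ?_
    ring
  have e3 : ((X - Y) ^ 2 * Y ^ (2 * q)).trace =
      ∑ i, ∑ j, (l i - m j) ^ 2 * m j ^ (2 * q) * w i j := by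
    have : ((X - Y) ^ 2 * Y ^ (2 * q)).trace =
        (X ^ 0 * Y ^ (2 * q + 2)).trace - 2 * (X ^ 1 * Y ^ (2 * q + 1)).trace
          + (X ^ 2 * Y ^ (2 * q)).trace := by
      have h3 : (X * Y * Y ^ (2 * q)).trace = (X ^ 1 * Y ^ (2 * q + 1)).trace := by
        rw [Matrix.mul_assoc, ← pow_succ', pow_one]
      have h4 : (Y * X * Y ^ (2 * q)).trace = (X ^ 1 * Y ^ (2 * q + 1)).trace := by
        rw [trace_mul_comm, ← Matrix.mul_assoc, ← pow_succ, trace_mul_comm, pow_one]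
      have h6 : (Y * Y * Y ^ (2 * q)).trace = (X ^ 0 * Y ^ (2 * q + 2)).trace := by
        rw [trace_mul_comm, ← pow_two, ← pow_add, pow_zero, Matrix.one_mul]
      rw [← h6, pow_two, Matrix.sub_mul, Matrix.mul_sub, Matrix.mul_sub]
      simp only [Matrix.sub_mul, trace_sub]
      rw [h3, h4, pow_two X]
      ring
    rw [this, h, h, h]
    simp only [← Finset.sum_sub_distrib, ← Finset.sum_add_distrib, Finset.mul_sum]
    refine Finset.sum_congr rfl fun i _ => Finset.sum_congr rfl fun j _ => ?_
    ring
  rw [e1, e2, e3, ← Finset.sum_add_distrib, Finset.mul_sum]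
  refine Finset.sum_le_sum fun i _ => ?_
  rw [← Finset.sum_add_distrib, Finset.mul_sum]
  refine Finset.sum_le_sum fun j _ => ?_
  nlinarith [mul_le_mul_of_nonneg_right (sub_mul_pow_sub_pow_le (l i) (m j) q) (hw i j)]

/-- Only the quadratic form of `M` enters: `tr (M X^{2q})` is the trace of `X^q M X^q`. -/
theorem trace_mul_even_pow_nonneg {M X : Matrix S S ℝ} (hX : X.IsHermitian)
    (hM : ∀ u, 0 ≤ u ⬝ᵥ M *ᵥ u) (q : ℕ) : 0 ≤ (M * X ^ (2 * q)).trace := by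
  have hq : (X ^ q)ᵀ = X ^ q := by
    have := (hX.pow q).eq
    rwa [conjTranspose_eq_transpose_of_trivial] at this
  rw [two_mul, pow_add, ← Matrix.mul_assoc, trace_mul_comm, ← Matrix.mul_assoc]
  simp only [trace, diag_apply]
  refine Finset.sum_nonneg fun i _ => ?_
  have := hM ((X ^ q) *ᵥ Pi.single i 1)
  rw [mulVec_mulVec] at this
  rw [dotProduct_comm, dotProduct_mulVec, ← mulVec_transpose, dotProduct_comm] at this
  have h2 : Pi.single i (1 : ℝ) ⬝ᵥ (X ^ q)ᵀ *ᵥ (M * X ^ q) *ᵥ Pi.single i 1 =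
      (X ^ q * M * X ^ q) i i := by
    rw [hq, mulVec_mulVec, single_one_dotProduct, mulVec_single_one, Matrix.mul_assoc]
    rfl
  exact h2 ▸ this

theorem trace_mul_even_pow_le {M M' X : Matrix S S ℝ} (hX : X.IsHermitian)
    (hM : ∀ u, u ⬝ᵥ M *ᵥ u ≤ u ⬝ᵥ M' *ᵥ u) (q : ℕ) :
    (M * X ^ (2 * q)).trace ≤ (M' * X ^ (2 * q)).trace := by
  have := trace_mul_even_pow_nonneg (M := M' - M) hX (fun u => by
    rw [sub_mulVec, dotProduct_sub]; linarith [hM u]) q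
  rw [Matrix.sub_mul, trace_sub] at this
  linarith

theorem dotProduct_pow_mulVec_eq {X : Matrix S S ℝ} (hX : X.IsHermitian) (a : ℕ) (u : S → ℝ) :
    u ⬝ᵥ (X ^ a) *ᵥ u = ∑ i, hX.eigenvalues i ^ a *
      ((hX.eigenvectorUnitary : Matrix S S ℝ)ᵀ *ᵥ u) i ^ 2 := by
  rw [isHermitian_pow_eq hX, ← mulVec_mulVec, ← mulVec_mulVec, dotProduct_mulVec,
    ← mulVec_transpose]
  simp only [dotProduct, mulVec_diagonal]
  exact Finset.sum_congr rfl fun i _ => by ring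

theorem dotProduct_self_eq_sum_sq {X : Matrix S S ℝ} (hX : X.IsHermitian) (u : S → ℝ) :
    u ⬝ᵥ u = ∑ i, ((hX.eigenvectorUnitary : Matrix S S ℝ)ᵀ *ᵥ u) i ^ 2 := by
  have := dotProduct_pow_mulVec_eq hX 0 u
  simpa using this

theorem trace_pow_eq_sum {X : Matrix S S ℝ} (hX : X.IsHermitian) (a : ℕ) :
    (X ^ a).trace = ∑ i, hX.eigenvalues i ^ a := by
  rw [isHermitian_pow_eq hX, trace_mul_comm, ← Matrix.mul_assoc]
  have := Unitary.coe_star_mul_self hX.eigenvectorUnitary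
  rw [star_eq_conjTranspose, conjTranspose_eq_transpose_of_trivial] at this
  rw [this, Matrix.one_mul, trace_diagonal]

/-- A quadratic form is bounded by the trace of an even power, since the latter is the sum of the
even powers of the eigenvalues. -/
theorem abs_dotProduct_mulVec_le_of_trace_pow_le {X : Matrix S S ℝ} (hX : X.IsHermitian) {t : ℝ}
    (ht : 0 ≤ t) {p : ℕ} (hp : p ≠ 0) (h : (X ^ (2 * p)).trace ≤ t ^ (2 * p)) (u : S → ℝ) :
    |u ⬝ᵥ X *ᵥ u| ≤ t * (u ⬝ᵥ u) := by
  have htr := trace_pow_eq_sum hX (2 * p)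
  have hev : ∀ i, |hX.eigenvalues i| ≤ t := fun i => by
    have h1 : hX.eigenvalues i ^ (2 * p) ≤ t ^ (2 * p) := by
      refine le_trans ?_ (htr ▸ h)
      exact Finset.single_le_sum (f := fun i => hX.eigenvalues i ^ (2 * p))
        (fun j _ => by rw [pow_mul]; positivity) (Finset.mem_univ i)
    have h2 : |hX.eigenvalues i| ^ (2 * p) ≤ t ^ (2 * p) := by
      rwa [pow_mul |_|, sq_abs, ← pow_mul]
    exact le_of_pow_le_pow_left₀ (by omega) ht h2
  have hz := dotProduct_pow_mulVec_eq hX 1 u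
  simp only [pow_one] at hz
  rw [hz, dotProduct_self_eq_sum_sq hX, Finset.mul_sum]
  refine (Finset.abs_sum_le_sum_abs _ _).trans (Finset.sum_le_sum fun i _ => ?_)
  rw [abs_mul, abs_sq]
  exact mul_le_mul_of_nonneg_right (hev i) (sq_nonneg _)

/-- The square root is `1/2`-Hölder continuous in operator norm: if `P ^ 2` and `Q ^ 2` differ by
at most `t`, then `P` and `Q` differ by at most `√t`. An extreme eigenvector `u` of `P - Q`, with
eigenvalue `l`, satisfies `⟨u, (P ^ 2 - Q ^ 2) u⟩ = l ⟨u, (P + Q) u⟩`, and `⟨u, (P + Q) u⟩ ≥ |l|`. -/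
theorem sub_mulVec_dotProduct_le {P Q : Matrix S S ℝ} (hP : P.PosSemidef) (hQ : Q.PosSemidef)
    {t : ℝ} (h : ∀ u, |u ⬝ᵥ (P * P - Q * Q) *ᵥ u| ≤ t * (u ⬝ᵥ u)) (u : S → ℝ) :
    ((P - Q) *ᵥ u) ⬝ᵥ ((P - Q) *ᵥ u) ≤ t * (u ⬝ᵥ u) := by
  have hR : (P - Q).IsHermitian := hP.isHermitian.sub hQ.isHermitian
  have hRt : (P - Q)ᵀ = P - Q := by
    have := hR.eq
    rwa [conjTranspose_eq_transpose_of_trivial] at this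
  have hev : ∀ i, hR.eigenvalues i ^ 2 ≤ t := fun i => by
    set l := hR.eigenvalues i
    set e : S → ℝ := (hR.eigenvectorBasis i).ofLp
    have he : (P - Q) *ᵥ e = l • e := hR.mulVec_eigenvectorBasis i
    have hee : e ⬝ᵥ e = 1 := by
      have h1 := hR.eigenvectorBasis.orthonormal.1 i
      have h2 : ‖hR.eigenvectorBasis i‖ ^ 2 = 1 := by rw [h1]; norm_num
      rw [EuclideanSpace.real_norm_sq_eq] at h2
      simpa [dotProduct, pow_two, e] using h2
    have h1 : e ⬝ᵥ (P * P - Q * Q) *ᵥ e = l * (e ⬝ᵥ P *ᵥ e + e ⬝ᵥ Q *ᵥ e) := by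
      have e1 : P * P - Q * Q = P * (P - Q) + (P - Q) * Q := by noncomm_ring
      rw [e1, add_mulVec, ← mulVec_mulVec, ← mulVec_mulVec, he, dotProduct_add, mulVec_smul,
        dotProduct_smul, dotProduct_mulVec e (P - Q), ← mulVec_transpose, hRt, he, smul_dotProduct]
      simp only [smul_eq_mul]
      ring
    have h2 : e ⬝ᵥ P *ᵥ e - e ⬝ᵥ Q *ᵥ e = l := by
      rw [← dotProduct_sub, ← sub_mulVec, he, dotProduct_smul, hee]
      simp
    have hP0 : 0 ≤ e ⬝ᵥ P *ᵥ e := by simpa using hP.dotProduct_mulVec_nonneg e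
    have hQ0 : 0 ≤ e ⬝ᵥ Q *ᵥ e := by simpa using hQ.dotProduct_mulVec_nonneg e
    have h3 := h e
    rw [h1, hee, mul_one] at h3
    have h4 := (abs_le.1 h3)
    rcases le_total 0 l with hl | hl <;> nlinarith
  have hz := dotProduct_pow_mulVec_eq hR 2 u
  have : ((P - Q) *ᵥ u) ⬝ᵥ ((P - Q) *ᵥ u) = u ⬝ᵥ ((P - Q) ^ 2) *ᵥ u := by
    rw [pow_two, ← mulVec_mulVec, dotProduct_mulVec u, ← mulVec_transpose, hRt]
  rw [this, hz, dotProduct_self_eq_sum_sq hR, Finset.mul_sum]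
  exact Finset.sum_le_sum fun i _ => mul_le_mul_of_nonneg_right (hev i) (sq_nonneg _)

end TraceInequalities

/-! ### Concentration of empirical second moment matrices -/

section Concentration

open Matrix

theorem integrable_of_continuous_of_ae_mem_compact {X : Type*} [TopologicalSpace X]
    [MeasurableSpace X] [OpensMeasurableSpace X] {μ : Measure X}
    [IsFiniteMeasure μ] {K : Set X} (hK : IsCompact K) (hμ : ∀ᵐ x ∂μ, x ∈ K) {f : X → ℝ}
    (hf : Continuous f) : Integrable f μ := by
  obtain ⟨C, hC⟩ := hK.exists_bound_of_continuousOn hf.continuousOn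
  exact Integrable.of_bound hf.measurable.aestronglyMeasurable C (hμ.mono fun x hx => hC x hx)

/-- Exchanging the `i`-th observation with an independent copy preserves the joint law. -/
theorem measurePreserving_update_swap {α : Type*} [MeasurableSpace α] (Q : Measure α)
    [IsProbabilityMeasure Q] {n : ℕ} (i : Fin n) :
    MeasurePreserving (fun p : (Fin n → α) × α => (Function.update p.1 i p.2, p.1 i))
      ((Measure.pi fun _ => Q).prod Q) ((Measure.pi fun _ => Q).prod Q) := by
  obtain ⟨n, rfl⟩ : ∃ k, n = k + 1 := ⟨n - 1, by have := i.2; omega⟩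
  have h1 := measurePreserving_piFinSuccAbove (fun _ : Fin (n + 1) => Q) i
  have h2 := h1.symm
  have h3 : MeasurePreserving (fun p : (α × (Fin n → α)) × α => ((p.2, p.1.2), p.1.1))
      ((Q.prod (Measure.pi fun _ => Q)).prod Q) ((Q.prod (Measure.pi fun _ => Q)).prod Q) := by
    have e1 := measurePreserving_prodAssoc Q (Measure.pi fun _ : Fin n => Q) Q
    have e2 := ((MeasurePreserving.id Q).prod
      (Measure.measurePreserving_swap (μ := Measure.pi fun _ : Fin n => Q) (ν := Q)))
    have e3 := (measurePreserving_prodAssoc Q Q (Measure.pi fun _ : Fin n => Q)).symm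
    have e4 := (Measure.measurePreserving_swap (μ := Q) (ν := Q)).prod
      (MeasurePreserving.id (Measure.pi fun _ : Fin n => Q))
    have e5 := measurePreserving_prodAssoc Q Q (Measure.pi fun _ : Fin n => Q)
    have e6 := ((MeasurePreserving.id Q).prod
      (Measure.measurePreserving_swap (μ := Q) (ν := Measure.pi fun _ : Fin n => Q)))
    have e7 := (measurePreserving_prodAssoc Q (Measure.pi fun _ : Fin n => Q) Q).symm
    exact e7.comp (e6.comp (e5.comp (e4.comp (e3.comp (e2.comp e1)))))
  have h4 := (h2.prod (MeasurePreserving.id Q)).comp (h3.comp (h1.prod (MeasurePreserving.id Q)))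
  convert h4 using 1
  funext p
  simp only [Function.comp_apply, Prod.map_apply, id]
  refine Prod.ext ?_ rfl
  change _ = i.insertNth (α := fun _ => α) p.2 fun j => p.1 (i.succAbove j)
  funext j
  rcases Fin.eq_self_or_eq_succAbove i j with rfl | ⟨j, rfl⟩
  · simp
  · simp

variable {S : Type*}

/-- If `|x|² ≤ L` and `|z|² ≤ L`, then `(x xᵀ - z zᵀ)² ≤ 2 L (x xᵀ + z zᵀ)` as quadratic forms. -/
theorem dotProduct_vecMulVec_sub_sq_le [Fintype S] [DecidableEq S] {x z : S → ℝ} {L : ℝ}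
    (hx : x ⬝ᵥ x ≤ L) (hz : z ⬝ᵥ z ≤ L) (u : S → ℝ) :
    u ⬝ᵥ ((vecMulVec x x - vecMulVec z z) ^ 2) *ᵥ u ≤
      u ⬝ᵥ ((2 * L) • (vecMulVec x x + vecMulVec z z)) *ᵥ u := by
  have h0 : 0 ≤ ((x ⬝ᵥ u) • x + (z ⬝ᵥ u) • z) ⬝ᵥ ((x ⬝ᵥ u) • x + (z ⬝ᵥ u) • z) :=
    Finset.sum_nonneg fun i _ => mul_self_nonneg _
  have hux : u ⬝ᵥ x = x ⬝ᵥ u := dotProduct_comm _ _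
  have huz : u ⬝ᵥ z = z ⬝ᵥ u := dotProduct_comm _ _
  have hzx : z ⬝ᵥ x = x ⬝ᵥ z := dotProduct_comm _ _
  simp only [pow_two, ← mulVec_mulVec, sub_mulVec, add_mulVec, smul_mulVec, vecMulVec_mulVec,
    op_smul_eq_smul, dotProduct_sub, dotProduct_add, dotProduct_smul, smul_eq_mul,
    add_dotProduct, smul_dotProduct, hux, huz, hzx] at h0 ⊢
  nlinarith [mul_le_mul_of_nonneg_left hx (sq_nonneg (x ⬝ᵥ u)),
    mul_le_mul_of_nonneg_left hz (sq_nonneg (z ⬝ᵥ u))]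

/-- The matrix of second moments of a measure on `ℝ^S`. -/
noncomputable def secondMoment (Q : Measure (S → ℝ)) : Matrix S S ℝ :=
  of fun s t => ∫ z, z s * z t ∂Q

/-- The error of the empirical second moment matrix of a sample `v`. -/
noncomputable def momentError (Q : Measure (S → ℝ)) {n : ℕ} (v : Fin n → S → ℝ) : Matrix S S ℝ :=
  (1 / (n : ℝ)) • ∑ i, vecMulVec (v i) (v i) - secondMoment Q

theorem secondMoment_isHermitian (Q : Measure (S → ℝ)) : (secondMoment Q).IsHermitian := by
  ext s t
  simp only [secondMoment, conjTranspose_apply, of_apply, star_trivial]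
  exact integral_congr_ae (ae_of_all _ fun z => mul_comm _ _)

theorem momentError_isHermitian (Q : Measure (S → ℝ)) {n : ℕ} (v : Fin n → S → ℝ) :
    (momentError Q v).IsHermitian := by
  refine IsHermitian.sub ?_ (secondMoment_isHermitian Q)
  ext s t
  simp [Matrix.sum_apply, vecMulVec_apply, mul_comm]

theorem continuous_momentError (Q : Measure (S → ℝ)) {n : ℕ} :
    Continuous fun v : Fin n → S → ℝ => momentError Q v := by
  unfold momentError
  have h : Continuous fun v : Fin n → S → ℝ => ∑ i, vecMulVec (v i) (v i) :=
    continuous_finsetSum _ fun i _ =>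
      (continuous_apply i).matrix_vecMulVec (continuous_apply i)
  exact (h.const_smul (1 / (n : ℝ))).sub continuous_const

theorem ae_pi_mem_box [Fintype S] {Q : Measure (S → ℝ)} [IsProbabilityMeasure Q] {b : ℝ} {n : ℕ}
    (hb : ∀ᵐ z ∂Q, ∀ s, |z s| ≤ b) :
    ∀ᵐ v : Fin n → S → ℝ ∂(Measure.pi fun _ => Q), v ∈ Set.pi Set.univ fun _ =>
      Set.pi Set.univ fun _ => Set.Icc (-b) b := by
  have : ∀ i, ∀ᵐ v : Fin n → S → ℝ ∂(Measure.pi fun _ => Q), ∀ s, |v i s| ≤ b := fun i =>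
    (Measure.quasiMeasurePreserving_eval (μ := fun _ : Fin n => Q) i).ae hb
  filter_upwards [eventually_all.2 this] with v hv i _ s _
  exact abs_le.1 (hv i s)

theorem integrable_pi_of_continuous [Fintype S] {Q : Measure (S → ℝ)} [IsProbabilityMeasure Q]
    {b : ℝ} {n : ℕ} (hb : ∀ᵐ z ∂Q, ∀ s, |z s| ≤ b) {f : (Fin n → S → ℝ) → ℝ} (hf : Continuous f) :
    Integrable f (Measure.pi fun _ => Q) :=
  integrable_of_continuous_of_ae_mem_compact
    (isCompact_univ_pi fun _ => isCompact_univ_pi fun _ => isCompact_Icc) (ae_pi_mem_box hb) hf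

theorem integrable_pi_prod_of_continuous [Fintype S] {Q : Measure (S → ℝ)}
    [IsProbabilityMeasure Q] {b : ℝ} {n : ℕ} (hb : ∀ᵐ z ∂Q, ∀ s, |z s| ≤ b) {f : (Fin n → S → ℝ) × (S → ℝ) → ℝ}
    (hf : Continuous f) : Integrable f ((Measure.pi fun _ => Q).prod Q) := by
  refine integrable_of_continuous_of_ae_mem_compact (K :=
    (Set.pi Set.univ fun _ => Set.pi Set.univ fun _ => Set.Icc (-b) b) ×ˢ
      (Set.pi Set.univ fun _ => Set.Icc (-b) b))
    ((isCompact_univ_pi fun _ => isCompact_univ_pi fun _ => isCompact_Icc).prod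
      (isCompact_univ_pi fun _ => isCompact_Icc)) ?_ hf
  have h1 := (Measure.quasiMeasurePreserving_fst (μ := Measure.pi fun _ : Fin n => Q)
    (ν := Q)).ae (ae_pi_mem_box (n := n) hb)
  have h2 := (Measure.quasiMeasurePreserving_snd (μ := Measure.pi fun _ : Fin n => Q) (ν := Q)).ae hb
  filter_upwards [h1, h2] with p hp1 hp2
  exact ⟨hp1, fun s _ => abs_le.1 (hp2 s)⟩

theorem integral_trace_vecMulVec_mul [Fintype S] {Q : Measure (S → ℝ)} [IsProbabilityMeasure Q]
    {b : ℝ} (hb : ∀ᵐ z ∂Q, ∀ s, |z s| ≤ b) (M : Matrix S S ℝ) :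
    ∫ z, (vecMulVec z z * M).trace ∂Q = (secondMoment Q * M).trace := by
  have hint : ∀ s t : S, Integrable (fun z : S → ℝ => z s * z t) Q := fun s t =>
    integrable_of_continuous_of_ae_mem_compact
      (isCompact_univ_pi fun _ => isCompact_Icc (a := -b) (b := b))
      (hb.mono fun z hz s _ => abs_le.1 (hz s)) (by fun_prop)
  simp only [trace, diag_apply, Matrix.mul_apply, vecMulVec_apply, secondMoment, of_apply]
  rw [integral_finsetSum _ fun s _ => integrable_finsetSum _ fun t _ => (hint s t).mul_const _]
  refine Finset.sum_congr rfl fun s _ => ?_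
  rw [integral_finsetSum _ fun t _ => (hint s t).mul_const _]
  exact Finset.sum_congr rfl fun t _ => integral_mul_const _ _

/-- Exchanging one observation with an independent copy bounds its contribution to the expected
trace of an even power of the moment error. -/
theorem integral_trace_sub_mul_pow_le [Fintype S] [DecidableEq S] {Q : Measure (S → ℝ)}
    [IsProbabilityMeasure Q] {b L : ℝ} {n : ℕ}
    (hb : ∀ᵐ z ∂Q, ∀ s, |z s| ≤ b) (hL : ∀ᵐ z ∂Q, z ⬝ᵥ z ≤ L) (i : Fin n) (q : ℕ) :
    ∫ v : Fin n → S → ℝ, ((vecMulVec (v i) (v i) - secondMoment Q) *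
        momentError Q v ^ (2 * q + 1)).trace ∂(Measure.pi fun _ => Q) ≤
      (2 * q + 1 : ℕ) * L / n * ∫ v : Fin n → S → ℝ, ((vecMulVec (v i) (v i) + secondMoment Q) *
        momentError Q v ^ (2 * q)).trace ∂(Measure.pi fun _ => Q) := by
  set π : Measure (Fin n → S → ℝ) := Measure.pi fun _ => Q with hπ
  have hn : (0 : ℝ) < n := by exact_mod_cast (Nat.zero_le _).trans_lt i.2
  set T : (Fin n → S → ℝ) × (S → ℝ) → (Fin n → S → ℝ) × (S → ℝ) :=
    fun p => (Function.update p.1 i p.2, p.1 i) with hT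
  have hTm : MeasurePreserving T (π.prod Q) (π.prod Q) := measurePreserving_update_swap Q i
  have hTc : Continuous T :=
    (continuous_fst.update i continuous_snd).prodMk ((continuous_apply i).comp continuous_fst)
  have hTswap : ∀ f : (Fin n → S → ℝ) × (S → ℝ) → ℝ, Continuous f →
      ∫ p, f (T p) ∂(π.prod Q) = ∫ p, f p ∂(π.prod Q) := fun f hf => by
    conv_rhs => rw [← hTm.map_eq]
    exact (integral_map hTm.measurable.aemeasurable
      hf.measurable.aestronglyMeasurable).symm
  have hXc := continuous_momentError Q (n := n)
  have hvi : Continuous fun p : (Fin n → S → ℝ) × (S → ℝ) => vecMulVec (p.1 i) (p.1 i) :=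
    ((continuous_apply i).comp continuous_fst).matrix_vecMulVec
      ((continuous_apply i).comp continuous_fst)
  have hzz : Continuous fun p : (Fin n → S → ℝ) × (S → ℝ) => vecMulVec p.2 p.2 :=
    continuous_snd.matrix_vecMulVec continuous_snd
  have hX1 : Continuous fun p : (Fin n → S → ℝ) × (S → ℝ) => momentError Q p.1 :=
    hXc.comp continuous_fst
  have hX2 : Continuous fun p : (Fin n → S → ℝ) × (S → ℝ) => momentError Q (T p).1 :=
    hX1.comp hTc
  have hdiff : ∀ p, vecMulVec (p.1 i) (p.1 i) - vecMulVec p.2 p.2 =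
      (n : ℝ) • (momentError Q p.1 - momentError Q (T p).1) := fun p => by
    have h1 : ∑ j, vecMulVec (p.1 j) (p.1 j) - ∑ j, vecMulVec ((T p).1 j) ((T p).1 j) =
        vecMulVec (p.1 i) (p.1 i) - vecMulVec p.2 p.2 := by
      rw [← Finset.sum_sub_distrib, Finset.sum_eq_single i]
      · simp [hT]
      · intro j _ hj
        simp [hT, Function.update_of_ne hj]
      · simp
    rw [momentError, momentError, sub_sub_sub_cancel_right, ← smul_sub, h1, smul_smul,
      mul_one_div_cancel hn.ne', one_smul]
  -- Average out the independent copy.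
  have hprod : ∀ (M : (Fin n → S → ℝ) → Matrix S S ℝ), Continuous M →
      ∫ p, (vecMulVec p.2 p.2 * M p.1).trace ∂(π.prod Q) =
        ∫ v, (secondMoment Q * M v).trace ∂π := fun M hM => by
    have hM1 : Continuous fun p : (Fin n → S → ℝ) × (S → ℝ) => M p.1 := hM.comp continuous_fst
    rw [integral_prod _ (integrable_pi_prod_of_continuous hb (hzz.matrix_mul hM1).matrix_trace)]
    exact integral_congr_ae (ae_of_all _ fun v => integral_trace_vecMulVec_mul hb (M v))
  have hfst : ∀ f : (Fin n → S → ℝ) → ℝ, Continuous f →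
      ∫ p, f p.1 ∂(π.prod Q) = ∫ v, f v ∂π := fun f hf => by
    rw [integral_fun_fst]; simp
  have hi : ∀ f : (Fin n → S → ℝ) × (S → ℝ) → ℝ, Continuous f → Integrable f (π.prod Q) :=
    fun f hf => integrable_pi_prod_of_continuous hb hf
  have hi1 : ∀ f : (Fin n → S → ℝ) → ℝ, Continuous f → Integrable f π :=
    fun f hf => integrable_pi_of_continuous hb hf
  have hvi1 : Continuous fun v : Fin n → S → ℝ => vecMulVec (v i) (v i) :=
    (continuous_apply i).matrix_vecMulVec (continuous_apply i)
  have key1 : ∫ v, ((vecMulVec (v i) (v i) - secondMoment Q) *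
        momentError Q v ^ (2 * q + 1)).trace ∂π =
      ∫ p, ((vecMulVec (p.1 i) (p.1 i) - vecMulVec p.2 p.2) *
        momentError Q p.1 ^ (2 * q + 1)).trace ∂(π.prod Q) := by
    simp only [Matrix.sub_mul, trace_sub]
    rw [integral_sub (hi1 _ ((hvi1.matrix_mul (hXc.fun_pow _)).matrix_trace))
      (hi1 _ ((continuous_const.matrix_mul (hXc.fun_pow _)).matrix_trace)),
      integral_sub (hi _ ((hvi.matrix_mul (hX1.fun_pow _)).matrix_trace))
      (hi _ ((hzz.matrix_mul (hX1.fun_pow _)).matrix_trace)),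
      hprod (fun v => momentError Q v ^ (2 * q + 1)) (hXc.fun_pow _),
      hfst (fun v => (vecMulVec (v i) (v i) * momentError Q v ^ (2 * q + 1)).trace)
        ((hvi1.matrix_mul (hXc.fun_pow _)).matrix_trace)]
  have key2 : ∫ v, ((vecMulVec (v i) (v i) + secondMoment Q) *
        momentError Q v ^ (2 * q)).trace ∂π =
      ∫ p, ((vecMulVec (p.1 i) (p.1 i) + vecMulVec p.2 p.2) *
        momentError Q p.1 ^ (2 * q)).trace ∂(π.prod Q) := by
    simp only [Matrix.add_mul, trace_add]
    rw [integral_add (hi1 _ ((hvi1.matrix_mul (hXc.fun_pow _)).matrix_trace))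
      (hi1 _ ((continuous_const.matrix_mul (hXc.fun_pow _)).matrix_trace)),
      integral_add (hi _ ((hvi.matrix_mul (hX1.fun_pow _)).matrix_trace))
      (hi _ ((hzz.matrix_mul (hX1.fun_pow _)).matrix_trace)),
      hprod (fun v => momentError Q v ^ (2 * q)) (hXc.fun_pow _),
      hfst (fun v => (vecMulVec (v i) (v i) * momentError Q v ^ (2 * q)).trace)
        ((hvi1.matrix_mul (hXc.fun_pow _)).matrix_trace)]
  -- `D` is the effect of the exchange on the moment error.
  have hTT : ∀ p, T (T p) = p := fun p => by simp [hT]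
  set D : (Fin n → S → ℝ) × (S → ℝ) → Matrix S S ℝ :=
    fun p => momentError Q p.1 - momentError Q (T p).1 with hD
  have hDc : Continuous D := hX1.sub hX2
  have hDT : ∀ p, D (T p) = - D p := fun p => by simp only [hD, hTT]; abel
  -- The exchange changes the sign of `D`, so that only the difference of the two powers counts.
  have key3 : ∫ p, (D p * momentError Q p.1 ^ (2 * q + 1)).trace ∂(π.prod Q) =
      (1 / 2) * ∫ p, (D p * (momentError Q p.1 ^ (2 * q + 1) -
        momentError Q (T p).1 ^ (2 * q + 1))).trace ∂(π.prod Q) := by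
    have h1 : ∫ p, (D p * momentError Q (T p).1 ^ (2 * q + 1)).trace ∂(π.prod Q) =
        - ∫ p, (D p * momentError Q p.1 ^ (2 * q + 1)).trace ∂(π.prod Q) := by
      rw [← hTswap _ ((hDc.matrix_mul (hX2.fun_pow _)).matrix_trace), ← integral_neg]
      refine integral_congr_ae (ae_of_all _ fun p => ?_)
      simp only [hDT, hTT, Matrix.neg_mul, trace_neg]
    simp only [Matrix.mul_sub, trace_sub]
    rw [integral_sub (hi _ ((hDc.matrix_mul (hX1.fun_pow _)).matrix_trace))
      (hi _ ((hDc.matrix_mul (hX2.fun_pow _)).matrix_trace)), h1]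
    ring
  have key4 : ∫ p, (D p * (momentError Q p.1 ^ (2 * q + 1) -
        momentError Q (T p).1 ^ (2 * q + 1))).trace ∂(π.prod Q) ≤
      (2 * q + 1 : ℕ) * ∫ p, (D p ^ 2 * momentError Q p.1 ^ (2 * q)).trace ∂(π.prod Q) := by
    have h1 : ∫ p, (D p ^ 2 * momentError Q (T p).1 ^ (2 * q)).trace ∂(π.prod Q) =
        ∫ p, (D p ^ 2 * momentError Q p.1 ^ (2 * q)).trace ∂(π.prod Q) := by
      rw [← hTswap _ (((hDc.fun_pow 2).matrix_mul (hX2.fun_pow _)).matrix_trace)]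
      refine integral_congr_ae (ae_of_all _ fun p => ?_)
      simp only [hDT, hTT, neg_sq]
    calc _ ≤ ∫ p, ((2 * q + 1 : ℕ) / 2 : ℝ) * ((D p ^ 2 * momentError Q p.1 ^ (2 * q)).trace +
          (D p ^ 2 * momentError Q (T p).1 ^ (2 * q)).trace) ∂(π.prod Q) := by
          refine integral_mono
            (hi _ ((hDc.matrix_mul ((hX1.fun_pow _).sub (hX2.fun_pow _))).matrix_trace))
            (hi _ (continuous_const.mul
              ((((hDc.fun_pow 2).matrix_mul (hX1.fun_pow _)).matrix_trace).add
              (((hDc.fun_pow 2).matrix_mul (hX2.fun_pow _)).matrix_trace)))) fun p => ?_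
          exact trace_sub_mul_pow_sub_pow_le (momentError_isHermitian Q _)
            (momentError_isHermitian Q _) q
      _ = _ := by
          rw [integral_const_mul, integral_add (hi _ (((hDc.fun_pow 2).matrix_mul
            (hX1.fun_pow _)).matrix_trace))
            (hi _ (((hDc.fun_pow 2).matrix_mul (hX2.fun_pow _)).matrix_trace)), h1]
          ring
  have hae : ∀ᵐ p ∂(π.prod Q), p.1 i ⬝ᵥ p.1 i ≤ L ∧ p.2 ⬝ᵥ p.2 ≤ L := by
    have h1 := (Measure.quasiMeasurePreserving_fst (μ := π) (ν := Q)).ae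
      ((Measure.quasiMeasurePreserving_eval (μ := fun _ : Fin n => Q) i).ae hL)
    have h2 := (Measure.quasiMeasurePreserving_snd (μ := π) (ν := Q)).ae hL
    filter_upwards [h1, h2] with p hp1 hp2 using ⟨hp1, hp2⟩
  have key5 : ∫ p, (D p ^ 2 * momentError Q p.1 ^ (2 * q)).trace ∂(π.prod Q) ≤
      2 * L / n ^ 2 * ∫ p, ((vecMulVec (p.1 i) (p.1 i) + vecMulVec p.2 p.2) *
        momentError Q p.1 ^ (2 * q)).trace ∂(π.prod Q) := by
    rw [← integral_const_mul]
    refine integral_mono_ae (hi _ (((hDc.fun_pow 2).matrix_mul (hX1.fun_pow _)).matrix_trace))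
      (hi _ (continuous_const.mul (((hvi.add hzz).matrix_mul (hX1.fun_pow _)).matrix_trace))) ?_
    filter_upwards [hae] with p hp
    have h1 : D p = (1 / (n : ℝ)) • (vecMulVec (p.1 i) (p.1 i) - vecMulVec p.2 p.2) := by
      rw [hdiff p, smul_smul, one_div_mul_cancel hn.ne', one_smul]
    have h2 := trace_mul_even_pow_le (momentError_isHermitian Q p.1)
      (dotProduct_vecMulVec_sub_sq_le hp.1 hp.2) q
    rw [h1, smul_pow, Matrix.smul_mul, trace_smul, smul_eq_mul]
    rw [Matrix.smul_mul, trace_smul, smul_eq_mul] at h2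
    calc _ ≤ (1 / (n : ℝ)) ^ 2 * (2 * L * ((vecMulVec (p.1 i) (p.1 i) + vecMulVec p.2 p.2) *
          momentError Q p.1 ^ (2 * q)).trace) := mul_le_mul_of_nonneg_left h2 (by positivity)
      _ = _ := by ring
  rw [key1, key2]
  have key0 : ∫ p, ((vecMulVec (p.1 i) (p.1 i) - vecMulVec p.2 p.2) *
        momentError Q p.1 ^ (2 * q + 1)).trace ∂(π.prod Q) =
      n * ∫ p, (D p * momentError Q p.1 ^ (2 * q + 1)).trace ∂(π.prod Q) := by
    rw [← integral_const_mul]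
    refine integral_congr_ae (ae_of_all _ fun p => ?_)
    simp only [hdiff p, Matrix.smul_mul, trace_smul, smul_eq_mul, hD]
  rw [key0, key3]
  calc _ ≤ (n : ℝ) * ((1 / 2) * ((2 * q + 1 : ℕ) * (2 * L / n ^ 2 *
        ∫ p, ((vecMulVec (p.1 i) (p.1 i) + vecMulVec p.2 p.2) *
        momentError Q p.1 ^ (2 * q)).trace ∂(π.prod Q)))) := by
        gcongr
        exact key4.trans (mul_le_mul_of_nonneg_left key5 (by positivity))
    _ = _ := by field_simp

/-- The recursion between consecutive even moments of the moment error `X`. Summing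
`integral_trace_sub_mul_pow_le` over the observations gives `E tr X^{2q+2} ≤ a E tr ((X + 2 Σ)
X^{2q})` with `Σ` the second moment matrix and `a = (2q+1) L / n`; the term `a X^{2q+1}` is absorbed
by the inequality of arithmetic and geometric means, and `Σ` is bounded by `c`. -/
theorem integral_trace_momentError_pow_succ_le [Fintype S] [DecidableEq S] {Q : Measure (S → ℝ)}
    [IsProbabilityMeasure Q] {b L c : ℝ} {n : ℕ} (hn : 0 < n)
    (hb : ∀ᵐ z ∂Q, ∀ s, |z s| ≤ b) (hL : ∀ᵐ z ∂Q, z ⬝ᵥ z ≤ L) (hL0 : 0 ≤ L)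
    (hc : ∀ u, u ⬝ᵥ secondMoment Q *ᵥ u ≤ c * (u ⬝ᵥ u)) (q : ℕ) :
    ∫ v : Fin n → S → ℝ, (momentError Q v ^ (2 * (q + 1))).trace ∂(Measure.pi fun _ => Q) ≤
      (((2 * q + 1 : ℕ) * L / n) ^ 2 + 4 * ((2 * q + 1 : ℕ) * L / n) * c) *
        ∫ v : Fin n → S → ℝ, (momentError Q v ^ (2 * q)).trace ∂(Measure.pi fun _ => Q) := by
  set π : Measure (Fin n → S → ℝ) := Measure.pi fun _ => Q with hπ
  set a : ℝ := (2 * q + 1 : ℕ) * L / n with ha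
  have ha0 : 0 ≤ a := by positivity
  have hn' : (0 : ℝ) < n := by exact_mod_cast hn
  have hXc := continuous_momentError Q (n := n)
  have hi1 : ∀ f : (Fin n → S → ℝ) → ℝ, Continuous f → Integrable f π :=
    fun f hf => integrable_pi_of_continuous hb hf
  have hvi1 : ∀ i, Continuous fun v : Fin n → S → ℝ => vecMulVec (v i) (v i) := fun i =>
    (continuous_apply i).matrix_vecMulVec (continuous_apply i)
  have hsum : ∀ v : Fin n → S → ℝ, ∑ i, vecMulVec (v i) (v i) =
      (n : ℝ) • (momentError Q v + secondMoment Q) := fun v => by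
    rw [momentError, sub_add_cancel, smul_smul, mul_one_div_cancel hn'.ne', one_smul]
  have h1 : ∑ i : Fin n, ∫ v, ((vecMulVec (v i) (v i) - secondMoment Q) *
        momentError Q v ^ (2 * q + 1)).trace ∂π =
      n * ∫ v, (momentError Q v ^ (2 * (q + 1))).trace ∂π := by
    rw [← integral_finsetSum _ fun i _ =>
      hi1 _ ((((hvi1 i).fun_sub continuous_const).matrix_mul (hXc.fun_pow _)).matrix_trace),
      ← integral_const_mul]
    refine integral_congr_ae (ae_of_all _ fun v => ?_)
    simp only
    rw [← trace_sum, ← Finset.sum_mul, Finset.sum_sub_distrib, hsum]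
    simp only [Finset.sum_const, Finset.card_univ, Fintype.card_fin]
    rw [← Nat.cast_smul_eq_nsmul ℝ, ← smul_sub, add_sub_cancel_right, Matrix.smul_mul, trace_smul,
      smul_eq_mul, ← pow_succ']
    rfl
  have h2 : ∑ i : Fin n, ∫ v, ((vecMulVec (v i) (v i) + secondMoment Q) *
        momentError Q v ^ (2 * q)).trace ∂π =
      n * ∫ v, ((momentError Q v + (2 : ℝ) • secondMoment Q) *
        momentError Q v ^ (2 * q)).trace ∂π := by
    rw [← integral_finsetSum _ fun i _ =>
      hi1 _ ((((hvi1 i).fun_add continuous_const).matrix_mul (hXc.fun_pow _)).matrix_trace),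
      ← integral_const_mul]
    refine integral_congr_ae (ae_of_all _ fun v => ?_)
    simp only
    rw [← trace_sum, ← Finset.sum_mul, Finset.sum_add_distrib, hsum]
    simp only [Finset.sum_const, Finset.card_univ, Fintype.card_fin]
    rw [← Nat.cast_smul_eq_nsmul ℝ, ← smul_add, add_assoc, ← two_smul ℝ (secondMoment Q),
      Matrix.smul_mul, trace_smul, smul_eq_mul]
  have h3 : ∫ v, (momentError Q v ^ (2 * (q + 1))).trace ∂π ≤
      a * ∫ v, ((momentError Q v + (2 : ℝ) • secondMoment Q) *
        momentError Q v ^ (2 * q)).trace ∂π := by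
    have := Finset.sum_le_sum fun (i : Fin n) (_ : i ∈ Finset.univ) =>
      integral_trace_sub_mul_pow_le hb hL i q
    rw [h1, ← Finset.mul_sum, h2] at this
    refine le_of_mul_le_mul_left (this.trans_eq ?_) hn'
    ring
  refine h3.trans ?_
  have h4 : a * ∫ v, ((momentError Q v + (2 : ℝ) • secondMoment Q) *
        momentError Q v ^ (2 * q)).trace ∂π ≤
      ∫ v, ((1 / 2) * (momentError Q v ^ (2 * (q + 1))).trace +
        (a ^ 2 / 2 + 2 * a * c) * (momentError Q v ^ (2 * q)).trace) ∂π := by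
    rw [← integral_const_mul]
    refine integral_mono (hi1 _ (continuous_const.mul
      ((hXc.fun_add continuous_const).matrix_mul (hXc.fun_pow _)).matrix_trace))
      (hi1 _ ((continuous_const.fun_mul (hXc.fun_pow _).matrix_trace).add
        (continuous_const.fun_mul (hXc.fun_pow _).matrix_trace))) fun v => ?_
    have hX := momentError_isHermitian Q v
    have e1 : (secondMoment Q * momentError Q v ^ (2 * q)).trace ≤
        c * (momentError Q v ^ (2 * q)).trace := by
      have := trace_mul_even_pow_le (M := secondMoment Q) (M' := c • 1) hX (fun u => by
        rw [smul_mulVec, one_mulVec, dotProduct_smul]; exact hc u) q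
      rwa [Matrix.smul_mul, Matrix.one_mul, trace_smul, smul_eq_mul] at this
    have e2 : a * (momentError Q v ^ (2 * q + 1)).trace ≤
        (1 / 2) * (momentError Q v ^ (2 * (q + 1))).trace +
          a ^ 2 / 2 * (momentError Q v ^ (2 * q)).trace := by
      rw [trace_pow_eq_sum hX, trace_pow_eq_sum hX, trace_pow_eq_sum hX, Finset.mul_sum,
        Finset.mul_sum, Finset.mul_sum, ← Finset.sum_add_distrib]
      refine Finset.sum_le_sum fun i _ => ?_
      set l := hX.eigenvalues i
      have : 0 ≤ l ^ (2 * q) * (l - a) ^ 2 := by rw [pow_mul]; positivity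
      rw [show 2 * (q + 1) = 2 * q + 2 by ring, pow_add, pow_add]
      nlinarith
    simp only [Matrix.add_mul, trace_add, Matrix.smul_mul, trace_smul, smul_eq_mul, ← pow_succ']
    nlinarith [mul_le_mul_of_nonneg_left e1 ha0]
  rw [integral_add (hi1 _ (continuous_const.fun_mul (hXc.fun_pow _).matrix_trace))
    (hi1 _ (continuous_const.fun_mul (hXc.fun_pow _).matrix_trace)), integral_const_mul,
    integral_const_mul] at h4
  linarith

theorem integral_trace_momentError_pow_nonneg [Fintype S] [DecidableEq S] (Q : Measure (S → ℝ))
    (n q : ℕ) :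
    0 ≤ ∫ v : Fin n → S → ℝ, (momentError Q v ^ (2 * q)).trace ∂(Measure.pi fun _ => Q) := by
  refine integral_nonneg fun v => ?_
  simp only [Pi.zero_apply]
  rw [trace_pow_eq_sum (momentError_isHermitian Q v)]
  exact Finset.sum_nonneg fun i _ => by rw [pow_mul]; positivity

theorem integral_trace_momentError_pow_le [Fintype S] [DecidableEq S] {Q : Measure (S → ℝ)}
    [IsProbabilityMeasure Q] {b L c : ℝ} {n : ℕ} (hn : 0 < n)
    (hb : ∀ᵐ z ∂Q, ∀ s, |z s| ≤ b) (hL : ∀ᵐ z ∂Q, z ⬝ᵥ z ≤ L) (hL0 : 0 ≤ L)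
    (hc : ∀ u, u ⬝ᵥ secondMoment Q *ᵥ u ≤ c * (u ⬝ᵥ u)) (hc0 : 0 ≤ c) (p : ℕ) (q : ℕ)
    (hq : q ≤ p) :
    ∫ v : Fin n → S → ℝ, (momentError Q v ^ (2 * q)).trace ∂(Measure.pi fun _ => Q) ≤
      ((2 * p * L / n) ^ 2 + 4 * (2 * p * L / n) * c) ^ q * Fintype.card S := by
  induction q with
  | zero => simp
  | succ q ih =>
    have h1 := integral_trace_momentError_pow_succ_le hn hb hL hL0 hc q
    have h2 := ih (by omega)
    have h3 : ((2 * q + 1 : ℕ) : ℝ) * L / n ≤ 2 * p * L / n := by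
      have : ((2 * q + 1 : ℕ) : ℝ) ≤ 2 * p := by exact_mod_cast (by omega : 2 * q + 1 ≤ 2 * p)
      gcongr
    have h0 : 0 ≤ ((2 * q + 1 : ℕ) : ℝ) * L / n := by positivity
    refine h1.trans ?_
    calc _ ≤ ((2 * p * L / n) ^ 2 + 4 * (2 * p * L / n) * c) *
          ∫ v : Fin n → S → ℝ, (momentError Q v ^ (2 * q)).trace ∂(Measure.pi fun _ => Q) := by
          refine mul_le_mul_of_nonneg_right ?_ (integral_trace_momentError_pow_nonneg Q n q)
          gcongr
      _ ≤ ((2 * p * L / n) ^ 2 + 4 * (2 * p * L / n) * c) *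
          (((2 * p * L / n) ^ 2 + 4 * (2 * p * L / n) * c) ^ q * Fintype.card S) := by
          gcongr
      _ = _ := by rw [pow_succ]; ring

/-- A matrix Bernstein type inequality, obtained from the moment of order `2 p` with `p` at least
the logarithm of the dimension: the factor `e` in the last hypothesis absorbs the dimension, which
enters the bound for the moment as `d ≤ e ^ p`. -/
theorem measure_momentError_gt_le [Fintype S] [DecidableEq S] {Q : Measure (S → ℝ)}
    [IsProbabilityMeasure Q] {b L c : ℝ} {n : ℕ} (hn : 0 < n)
    (hb : ∀ᵐ z ∂Q, ∀ s, |z s| ≤ b) (hL : ∀ᵐ z ∂Q, z ⬝ᵥ z ≤ L) (hL0 : 0 ≤ L)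
    (hc : ∀ u, u ⬝ᵥ secondMoment Q *ᵥ u ≤ c * (u ⬝ᵥ u)) (hc0 : 0 ≤ c) {p : ℕ} (hp : p ≠ 0)
    (hd : (Fintype.card S : ℝ) ≤ Real.exp p) {K t : ℝ} (hK : 1 ≤ K) (ht : 0 < t)
    (htt : Real.exp 1 * K ^ 2 * ((2 * p * L / n) ^ 2 + 4 * (2 * p * L / n) * c) ≤ t ^ 2) :
    (Measure.pi fun _ => Q) {v : Fin n → S → ℝ | ∃ u, t * (u ⬝ᵥ u) < |u ⬝ᵥ momentError Q v *ᵥ u|} ≤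
      ENNReal.ofReal (1 / K ^ 2) := by
  set π : Measure (Fin n → S → ℝ) := Measure.pi fun _ => Q with hπ
  set A : ℝ := (2 * p * L / n) ^ 2 + 4 * (2 * p * L / n) * c with hA
  have hA0 : 0 ≤ A := by positivity
  have hXc := continuous_momentError Q (n := n)
  have hsub : {v : Fin n → S → ℝ | ∃ u, t * (u ⬝ᵥ u) < |u ⬝ᵥ momentError Q v *ᵥ u|} ⊆
      {v | t ^ (2 * p) ≤ (momentError Q v ^ (2 * p)).trace} := by
    rintro v ⟨u, hu⟩
    by_contra hcon
    exact absurd (abs_dotProduct_mulVec_le_of_trace_pow_le (momentError_isHermitian Q v) ht.le hp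
      (not_le.1 hcon).le u) (not_le.2 hu)
  refine (measure_mono hsub).trans ?_
  have h1 := mul_meas_ge_le_integral_of_nonneg (μ := π)
    (f := fun v => (momentError Q v ^ (2 * p)).trace) (ae_of_all _ fun v => by
      simp only [Pi.zero_apply]
      rw [trace_pow_eq_sum (momentError_isHermitian Q v)]
      exact Finset.sum_nonneg fun i _ => by rw [pow_mul]; positivity)
    (integrable_pi_of_continuous hb (hXc.fun_pow _).matrix_trace) (t ^ (2 * p))
  have h2 := h1.trans (integral_trace_momentError_pow_le hn hb hL hL0 hc hc0 p p le_rfl)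
  rw [← ofReal_measureReal (by finiteness)]
  refine ENNReal.ofReal_le_ofReal ?_
  have h3 : Real.exp 1 ^ p * (K ^ 2) ^ p * A ^ p ≤ t ^ (2 * p) := by
    rw [← mul_pow, ← mul_pow, pow_mul]
    exact pow_le_pow_left₀ (by positivity) htt p
  have h4 : K ^ 2 ≤ (K ^ 2) ^ p := le_self_pow₀ (by nlinarith) hp
  have h5 : Real.exp 1 ^ p = Real.exp p := by rw [← Real.exp_nat_mul, mul_one]
  rw [h5] at h3
  rw [le_div_iff₀ (by positivity)]
  have ht2 : 0 < t ^ (2 * p) := by positivity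
  set x := π.real {v | t ^ (2 * p) ≤ (momentError Q v ^ (2 * p)).trace}
  have hx0 : 0 ≤ x := measureReal_nonneg
  have h6 : A ^ p * Fintype.card S * K ^ 2 ≤ t ^ (2 * p) := by
    calc A ^ p * Fintype.card S * K ^ 2 ≤ A ^ p * Real.exp p * (K ^ 2) ^ p := by gcongr
      _ = Real.exp p * (K ^ 2) ^ p * A ^ p := by ring
      _ ≤ _ := h3
  have h7 : t ^ (2 * p) * (x * K ^ 2) ≤ t ^ (2 * p) * 1 := by
    calc t ^ (2 * p) * (x * K ^ 2) = t ^ (2 * p) * x * K ^ 2 := by ring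
      _ ≤ A ^ p * Fintype.card S * K ^ 2 := by gcongr
      _ ≤ _ := by linarith
  exact le_of_mul_le_mul_left h7 ht2

end Concentration

/-! ### Gaussian vectors and maximal inequalities -/

section GaussianVectors

open Matrix

theorem charFun_pi_gaussianReal {T : Type*} [Fintype T] (t : T → ℝ) :
    ∫ x : T → ℝ, Complex.exp ((t ⬝ᵥ x : ℝ) * Complex.I) ∂(Measure.pi fun _ => gaussianReal 0 1) =
      Complex.exp (-((t ⬝ᵥ t : ℝ) : ℂ) / 2) := by
  have h := charFun_pi (μ := fun _ : T => gaussianReal 0 1) (WithLp.toLp 2 t)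
  rw [charFun_apply, integral_map (by fun_prop) (by fun_prop)] at h
  simp only [charFun_gaussianReal, ← Complex.exp_sum] at h
  convert h using 1
  · refine integral_congr_ae (ae_of_all _ fun x => ?_)
    simp only [dotProduct, PiLp.inner_apply, RCLike.inner_apply, conj_trivial]
  · congr 1
    simp only [dotProduct, Complex.ofReal_sum, Complex.ofReal_mul, Complex.ofReal_zero, mul_zero,
      zero_mul, NNReal.coe_one, Complex.ofReal_one, one_mul, zero_sub, Finset.sum_neg_distrib,
      ← Finset.sum_div, pow_two, neg_div]

/-- A linear functional of a standard Gaussian vector. -/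
theorem map_dotProduct_pi_gaussianReal {T : Type*} [Fintype T] (c : T → ℝ) :
    (Measure.pi fun _ : T => gaussianReal 0 1).map (fun x => c ⬝ᵥ x) =
      gaussianReal 0 (c ⬝ᵥ c).toNNReal := by
  have hm : Measurable fun x : T → ℝ => c ⬝ᵥ x := by
    simp only [dotProduct]; fun_prop
  have := Measure.isProbabilityMeasure_map (μ := Measure.pi fun _ : T => gaussianReal 0 1)
    hm.aemeasurable
  refine Measure.ext_of_charFun ?_
  funext t
  have hc : 0 ≤ c ⬝ᵥ c := Finset.sum_nonneg fun i _ => mul_self_nonneg _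
  rw [charFun_apply_real, integral_map hm.aemeasurable (by fun_prop), charFun_gaussianReal]
  have h := charFun_pi_gaussianReal (t • c)
  simp only [smul_dotProduct, dotProduct_smul, smul_eq_mul] at h
  convert h using 1
  · refine integral_congr_ae (ae_of_all _ fun x => ?_)
    simp
  · rw [Real.coe_toNNReal _ hc]
    congr 1
    push_cast
    ring

/-- A matrix with orthonormal rows maps a standard Gaussian vector to a standard Gaussian vector. -/
theorem map_mulVec_pi_gaussianReal {S T : Type*} [Fintype S] [Fintype T] [DecidableEq S]
    (L : Matrix S T ℝ) (hL : L * Lᵀ = 1) :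
    (Measure.pi fun _ : T => gaussianReal 0 1).map (fun x => L *ᵥ x) =
      Measure.pi fun _ : S => gaussianReal 0 1 := by
  have hm : Measurable fun x : T → ℝ => L *ᵥ x :=
    (continuous_const.matrix_mulVec continuous_id).measurable
  have := Measure.isProbabilityMeasure_map (μ := Measure.pi fun _ : T => gaussianReal 0 1)
    hm.aemeasurable
  have hmt : Measurable (WithLp.toLp 2 : (S → ℝ) → EuclideanSpace ℝ S) := by fun_prop
  have key : ((Measure.pi fun _ : T => gaussianReal 0 1).map (fun x => L *ᵥ x)).map
      (WithLp.toLp 2 : (S → ℝ) → EuclideanSpace ℝ S) =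
      (Measure.pi fun _ : S => gaussianReal 0 1).map (WithLp.toLp 2) := by
    have := Measure.isProbabilityMeasure_map (μ :=
      (Measure.pi fun _ : T => gaussianReal 0 1).map (fun x => L *ᵥ x)) hmt.aemeasurable
    have := Measure.isProbabilityMeasure_map (μ :=
      (Measure.pi fun _ : S => gaussianReal 0 1)) hmt.aemeasurable
    refine Measure.ext_of_charFun ?_
    funext t
    rw [charFun_apply, charFun_apply, integral_map (by fun_prop) (by fun_prop),
      integral_map hm.aemeasurable (by fun_prop), integral_map hmt.aemeasurable (by fun_prop)]
    have h1 := charFun_pi_gaussianReal t.ofLp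
    have h2 := charFun_pi_gaussianReal (Lᵀ *ᵥ t.ofLp)
    have h3 : (Lᵀ *ᵥ t.ofLp) ⬝ᵥ (Lᵀ *ᵥ t.ofLp) = t.ofLp ⬝ᵥ t.ofLp := by
      rw [dotProduct_mulVec, ← mulVec_transpose, transpose_transpose, mulVec_mulVec, hL, one_mulVec]
    rw [h3, ← h1] at h2
    convert h2 using 1
    · refine integral_congr_ae (ae_of_all _ fun x => ?_)
      simp only
      congr 3
      rw [mulVec_transpose, ← dotProduct_mulVec]
      simp only [dotProduct, PiLp.inner_apply, RCLike.inner_apply, conj_trivial]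
    · refine integral_congr_ae (ae_of_all _ fun x => ?_)
      simp only
      congr 3
  have := congrArg (fun ρ => ρ.map (WithLp.ofLp : EuclideanSpace ℝ S → S → ℝ)) key
  simp only at this
  rw [Measure.map_map (by fun_prop) hmt, Measure.map_map (by fun_prop) hmt] at this
  simpa [Function.comp_def] using this

/-- The exact value of the integral is `√2`. -/
theorem lintegral_exp_sq_div_four_le :
    ∫⁻ x, ENNReal.ofReal (Real.exp (x ^ 2 / 4)) ∂(gaussianReal 0 1) ≤ 2 := by
  have h1 : ∀ x : ℝ, gaussianPDF 0 1 x * ENNReal.ofReal (Real.exp (x ^ 2 / 4)) =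
      ENNReal.ofReal ((√(2 * Real.pi))⁻¹ * Real.exp (-(1 / 4) * x ^ 2)) := fun x => by
    rw [gaussianPDF, ← ENNReal.ofReal_mul (gaussianPDFReal_nonneg _ _ _), gaussianPDFReal]
    congr 1
    rw [mul_assoc, ← Real.exp_add]
    simp only [NNReal.coe_one, mul_one, sub_zero]
    congr 2
    ring
  rw [gaussianReal_of_var_ne_zero _ one_ne_zero, lintegral_withDensity_eq_lintegral_mul _
    (measurable_gaussianPDF _ _) (by fun_prop)]
  simp only [Pi.mul_apply, h1]
  rw [← ofReal_integral_eq_lintegral_ofReal, integral_const_mul, integral_gaussian]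
  · rw [show (2 : ℝ≥0∞) = ENNReal.ofReal 2 by simp]
    refine ENNReal.ofReal_le_ofReal ?_
    rw [← Real.sqrt_inv, ← Real.sqrt_mul (by positivity)]
    refine Real.sqrt_le_iff.2 ⟨by norm_num, ?_⟩
    have := Real.pi_pos
    field_simp
    norm_num
  · exact (integrable_exp_neg_mul_sq (by norm_num)).const_mul _
  · exact ae_of_all _ fun x => by positivity

/-- The exponential square moment of a Gaussian variable of variance at most `τ ^ 2`. -/
theorem lintegral_exp_sq_le_of_hasLaw {Γ : Type*} [MeasurableSpace Γ] {ρ : Measure Γ} {Z : Γ → ℝ}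
    {σ τ : ℝ} (hZ : ρ.map Z = gaussianReal 0 σ.toNNReal) (hZm : Measurable Z)
    (hτ : 0 < τ) (hσ : σ ≤ τ ^ 2) :
    ∫⁻ x, ENNReal.ofReal (Real.exp (Z x ^ 2 / (4 * τ ^ 2))) ∂ρ ≤ 2 := by
  have h1 : gaussianReal 0 σ.toNNReal = (gaussianReal 0 1).map (fun x => √σ * x) := by
    rw [gaussianReal_map_const_mul, mul_zero]
    congr 1
    rw [mul_one]
    ext
    rcases le_total 0 σ with h | h
    · simp [h, Real.sq_sqrt]
    · simp [h, Real.sqrt_eq_zero_of_nonpos]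
  have h2 : ∫⁻ x, ENNReal.ofReal (Real.exp (Z x ^ 2 / (4 * τ ^ 2))) ∂ρ =
      ∫⁻ y, ENNReal.ofReal (Real.exp (y ^ 2 / (4 * τ ^ 2))) ∂(ρ.map Z) := by
    rw [lintegral_map (by fun_prop) hZm]
  rw [h2, hZ, h1, lintegral_map (by fun_prop) (by fun_prop)]
  refine (lintegral_mono fun x => ENNReal.ofReal_le_ofReal (Real.exp_le_exp.2 ?_)).trans
    lintegral_exp_sq_div_four_le
  rw [mul_pow, div_le_div_iff₀ (by positivity) (by norm_num)]
  have h3 : √σ ^ 2 ≤ τ ^ 2 := by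
    rcases le_total 0 σ with h | h
    · rwa [Real.sq_sqrt h]
    · rw [Real.sqrt_eq_zero_of_nonpos h, zero_pow two_ne_zero]; positivity
  nlinarith [mul_le_mul_of_nonneg_right h3 (sq_nonneg x)]

/-- A pointwise maximal inequality: the norm of one block of a family is controlled by the average
of the exponential square over the whole family, at the cost of the logarithm of the number of
blocks. -/
theorem sqrt_sum_sq_le_of_exp {A T : Type*} [Fintype A] [Fintype T] [Nonempty T]
    {τ : ℝ} (hτ : 0 < τ) (Z : A → T → ℝ) (a : A) :
    √(∑ j, Z a j ^ 2) ≤ τ * √(Fintype.card T * logPlus (Fintype.card A)) *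
      (2 + (∑ a, ∑ j, Real.exp (Z a j ^ 2 / (4 * τ ^ 2))) / (Fintype.card A * Fintype.card T)) := by
  have hk : (0 : ℝ) < Fintype.card A := by
    have : Nonempty A := ⟨a⟩
    exact_mod_cast Fintype.card_pos
  have hm : (0 : ℝ) < Fintype.card T := by exact_mod_cast Fintype.card_pos
  set k : ℝ := (Fintype.card A : ℝ)
  set m : ℝ := (Fintype.card T : ℝ)
  set L := logPlus (Fintype.card A)
  have hL1 : 1 ≤ L := le_max_right _ _
  have hLk : Real.log k ≤ L := le_max_left _ _
  set E := (∑ a, ∑ j, Real.exp (Z a j ^ 2 / (4 * τ ^ 2))) / (k * m) with hE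
  have hE0 : 0 ≤ E := by positivity
  set y2 := ∑ j, Z a j ^ 2 with hy2
  -- Jensen's inequality for the block `a`, whose exponentials are at most the total `k m E`.
  have hjensen : Real.exp (y2 / (4 * m * τ ^ 2)) ≤ k * E := by
    have h1 := convexOn_exp.map_sum_le (t := Finset.univ) (w := fun _ : T => 1 / m)
      (p := fun j => Z a j ^ 2 / (4 * τ ^ 2)) (fun _ _ => by positivity)
      (by simp [m]) (fun _ _ => Set.mem_univ _)
    simp only [smul_eq_mul, ← Finset.mul_sum, ← Finset.sum_div] at h1
    have h2 : y2 / (4 * m * τ ^ 2) = 1 / m * (y2 / (4 * τ ^ 2)) := by field_simp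
    rw [h2]
    refine h1.trans ?_
    have h3 : ∑ j, Real.exp (Z a j ^ 2 / (4 * τ ^ 2)) ≤
        ∑ a, ∑ j, Real.exp (Z a j ^ 2 / (4 * τ ^ 2)) :=
      Finset.single_le_sum (f := fun a => ∑ j, Real.exp (Z a j ^ 2 / (4 * τ ^ 2)))
        (fun a _ => by positivity) (Finset.mem_univ a)
    calc 1 / m * ∑ j, Real.exp (Z a j ^ 2 / (4 * τ ^ 2)) ≤
          1 / m * ∑ a, ∑ j, Real.exp (Z a j ^ 2 / (4 * τ ^ 2)) := by gcongr
      _ = k * E := by rw [hE]; field_simp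
  have hkE : 0 < k * E := (Real.exp_pos _).trans_le hjensen
  have hEpos : 0 < E := by
    rcases hE0.lt_or_eq with h | h
    · exact h
    · rw [← h, mul_zero] at hkE; exact absurd hkE (lt_irrefl _)
  have h4 : y2 / (4 * m * τ ^ 2) ≤ L + E := by
    have h5 := (Real.le_log_iff_exp_le hkE).2 hjensen
    rw [Real.log_mul hk.ne' hEpos.ne'] at h5
    linarith [Real.log_le_sub_one_of_pos hEpos]
  have h6 : y2 ≤ (2 * τ) ^ 2 * (m * L) * (1 + E) := by
    rw [div_le_iff₀ (by positivity)] at h4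
    have : L + E ≤ L * (1 + E) := by nlinarith
    calc y2 ≤ (L + E) * (4 * m * τ ^ 2) := h4
      _ ≤ (L * (1 + E)) * (4 * m * τ ^ 2) := by gcongr
      _ = _ := by ring
  refine Real.sqrt_le_iff.2 ⟨by positivity, h6.trans ?_⟩
  have hs : √(m * L) ^ 2 = m * L := Real.sq_sqrt (by positivity)
  have : (2 * τ) ^ 2 * (m * L) * (1 + E) = τ ^ 2 * (m * L) * (4 * (1 + E)) := by ring
  rw [this, mul_pow, mul_pow τ, hs]
  gcongr
  nlinarith

/-- The upper bound in `sqrt_sum_sq_le_of_exp`. -/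
noncomputable def expBound {A T : Type*} [Fintype A] [Fintype T] (τ : ℝ) (Z : A → T → ℝ) : ℝ :=
  τ * √(Fintype.card T * logPlus (Fintype.card A)) *
    (2 + (∑ a, ∑ j, Real.exp (Z a j ^ 2 / (4 * τ ^ 2))) / (Fintype.card A * Fintype.card T))

theorem expBound_nonneg {A T : Type*} [Fintype A] [Fintype T] {τ : ℝ} (hτ : 0 ≤ τ)
    (Z : A → T → ℝ) : 0 ≤ expBound τ Z := by
  unfold expBound; positivity

/-- The bound of the pointwise maximal inequality has the expected order, since the average of the
exponential squares has bounded expectation. -/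
theorem lintegral_expBound_le {A T Γ : Type*} [Fintype A] [Fintype T] [MeasurableSpace Γ]
    {ρ : Measure Γ} [IsProbabilityMeasure ρ] {τ : ℝ} (hτ : 0 ≤ τ) {Z : Γ → A → T → ℝ}
    (hZm : ∀ a j, Measurable fun x => Z x a j)
    (hZ : ∀ a j, ∫⁻ x, ENNReal.ofReal (Real.exp (Z x a j ^ 2 / (4 * τ ^ 2))) ∂ρ ≤ 2) :
    ∫⁻ x, ENNReal.ofReal (expBound τ (Z x)) ∂ρ ≤
      ENNReal.ofReal (4 * (τ * √(Fintype.card T * logPlus (Fintype.card A)))) := by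
  set k : ℝ := (Fintype.card A : ℝ)
  set m : ℝ := (Fintype.card T : ℝ)
  set s := τ * √(m * logPlus (Fintype.card A))
  have hs : 0 ≤ s := by positivity
  have h1 : ∀ x, ENNReal.ofReal (expBound τ (Z x)) = ENNReal.ofReal s *
      (2 + ENNReal.ofReal (1 / (k * m)) *
        ∑ a, ∑ j, ENNReal.ofReal (Real.exp (Z x a j ^ 2 / (4 * τ ^ 2)))) := fun x => by
    unfold expBound
    have e1 : ENNReal.ofReal (∑ a, ∑ j, Real.exp (Z x a j ^ 2 / (4 * τ ^ 2))) =
        ∑ a, ∑ j, ENNReal.ofReal (Real.exp (Z x a j ^ 2 / (4 * τ ^ 2))) := by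
      rw [ENNReal.ofReal_sum_of_nonneg fun a _ => by positivity]
      exact Finset.sum_congr rfl fun a _ => ENNReal.ofReal_sum_of_nonneg fun j _ => by positivity
    rw [← e1, ← ENNReal.ofReal_mul (by positivity), show (2 : ℝ≥0∞) = ENNReal.ofReal 2 by simp,
      ← ENNReal.ofReal_add (by norm_num) (by positivity), ← ENNReal.ofReal_mul hs,
      div_eq_mul_one_div, mul_comm (∑ a, ∑ j, _)]
  simp only [h1]
  have hmeas : ∀ a j, Measurable fun x =>
      ENNReal.ofReal (Real.exp (Z x a j ^ 2 / (4 * τ ^ 2))) := fun a j => by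
    have := hZm a j
    fun_prop
  have hmeas2 : ∀ a, Measurable fun x =>
      ∑ j, ENNReal.ofReal (Real.exp (Z x a j ^ 2 / (4 * τ ^ 2))) := fun a =>
    Finset.measurable_sum _ fun j _ => hmeas a j
  rw [lintegral_const_mul' _ _ ENNReal.ofReal_ne_top, lintegral_add_left measurable_const,
    lintegral_const_mul' _ _ ENNReal.ofReal_ne_top, lintegral_finsetSum _ fun a _ => hmeas2 a]
  simp_rw [lintegral_finsetSum _ fun j _ => hmeas _ j]
  have h2 : ∑ a, ∑ j, ∫⁻ x, ENNReal.ofReal (Real.exp (Z x a j ^ 2 / (4 * τ ^ 2))) ∂ρ ≤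
      ENNReal.ofReal (k * m * 2) := by
    calc _ ≤ ∑ a : A, ∑ j : T, (2 : ℝ≥0∞) :=
          Finset.sum_le_sum fun a _ => Finset.sum_le_sum fun j _ => hZ a j
      _ = _ := by
        rw [ENNReal.ofReal_mul (by positivity), ENNReal.ofReal_mul (by positivity)]
        simp [k, m, mul_assoc]
  calc _ ≤ ENNReal.ofReal s * (2 + ENNReal.ofReal (1 / (k * m)) * ENNReal.ofReal (k * m * 2)) := by
        rw [lintegral_const, measure_univ, mul_one]
        gcongr
    _ ≤ ENNReal.ofReal s * ENNReal.ofReal 4 := by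
        gcongr
        rw [← ENNReal.ofReal_mul (by positivity), show (2 : ℝ≥0∞) = ENNReal.ofReal 2 by simp,
          ← ENNReal.ofReal_add (by norm_num) (by positivity)]
        refine ENNReal.ofReal_le_ofReal ?_
        have : 1 / (k * m) * (k * m * 2) ≤ 2 := by
          rw [← mul_assoc, one_div]
          have : (k * m)⁻¹ * (k * m) ≤ 1 := inv_mul_le_one
          linarith
        linarith
    _ = _ := by rw [← ENNReal.ofReal_mul hs, mul_comm s]

end GaussianVectors

/-! ### Gaussian fields indexed by a Hilbert space -/

section GaussianFields

open Matrix

/-- `Z` is an isonormal Gaussian field on the Hilbert space `H`: it is almost surely linear, and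
`Z h` is centred normal with variance `‖h‖ ^ 2`. -/
structure IsGaussianField {H Ξ : Type*} [NormedAddCommGroup H] [InnerProductSpace ℝ H]
    [MeasurableSpace Ξ] (Z : H → Ξ → ℝ) (κ : Measure Ξ) : Prop where
  measurable : ∀ h, Measurable (Z h)
  linear : ∀ (a b : ℝ) (h h' : H), Z (a • h + b • h') =ᵐ[κ] fun x => a * Z h x + b * Z h' x
  law : ∀ h, κ.map (Z h) = gaussianReal 0 (‖h‖ ^ 2).toNNReal

theorem map_sum_mul_of_iIndepFun {I Ξ : Type*} [MeasurableSpace Ξ] {κ : Measure Ξ}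
    [IsProbabilityMeasure κ] {g : I → Ξ → ℝ} (hg : ∀ i, Measurable (g i)) (hind : iIndepFun g κ)
    (hlaw : ∀ i, κ.map (g i) = gaussianReal 0 1) (s : Finset I) (c : I → ℝ) :
    κ.map (fun x => ∑ i ∈ s, c i * g i x) = gaussianReal 0 (∑ i ∈ s, c i ^ 2).toNNReal := by
  have h1 : iIndepFun (fun i : s => g i) κ := hind.precomp Subtype.val_injective
  have h2 := (iIndepFun_iff_map_fun_eq_pi_map (fun i : s => (hg i).aemeasurable)).1 h1
  simp only [hlaw] at h2
  have h3 := map_dotProduct_pi_gaussianReal (fun i : s => c i)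
  have hm : Measurable fun x (i : s) => g i x := measurable_pi_lambda _ fun i => hg i
  rw [← h2, Measure.map_map (by simp only [dotProduct]; fun_prop) hm] at h3
  convert h3 using 2
  · funext x
    simp only [Function.comp_apply, dotProduct]
    exact (Finset.sum_coe_sort s fun i => c i * g i x).symm
  · simp only [dotProduct, ← pow_two]
    rw [Finset.sum_coe_sort s fun i => c i ^ 2]

theorem integral_exp_eq_of_map_eq {Ξ : Type*} [MeasurableSpace Ξ] {κ : Measure Ξ} {X : Ξ → ℝ}
    (hX : AEMeasurable X κ) {σ : ℝ} (hσ : 0 ≤ σ) (h : κ.map X = gaussianReal 0 σ.toNNReal) (t : ℝ) :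
    ∫ x, Complex.exp (t * X x * Complex.I) ∂κ = Complex.exp (-((σ * t ^ 2 : ℝ) : ℂ) / 2) := by
  have h1 := charFun_apply_real (μ := κ.map X) (t := t)
  rw [integral_map hX (by fun_prop), h, charFun_gaussianReal] at h1
  rw [← h1, Real.coe_toNNReal _ hσ]
  push_cast
  congr 1
  ring

theorem map_eq_of_integral_exp_eq {Ξ : Type*} [MeasurableSpace Ξ] {κ : Measure Ξ}
    [IsProbabilityMeasure κ] {X : Ξ → ℝ} (hX : AEMeasurable X κ) {σ : ℝ} (hσ : 0 ≤ σ)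
    (h : ∀ t : ℝ, ∫ x, Complex.exp (t * X x * Complex.I) ∂κ =
      Complex.exp (-((σ * t ^ 2 : ℝ) : ℂ) / 2)) :
    κ.map X = gaussianReal 0 σ.toNNReal := by
  have := Measure.isProbabilityMeasure_map hX
  refine Measure.ext_of_charFun ?_
  funext t
  rw [charFun_apply_real, integral_map hX (by fun_prop), charFun_gaussianReal, h,
    Real.coe_toNNReal _ hσ]
  push_cast
  congr 1
  ring

/-- The characteristic function at `t` is Lipschitz continuous on `L²`. -/
theorem norm_integral_exp_sub_le {Ξ : Type*} [MeasurableSpace Ξ] {κ : Measure Ξ}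
    [IsProbabilityMeasure κ] (f g : Lp ℝ 2 κ) (t : ℝ) :
    ‖∫ x, Complex.exp (t * f x * Complex.I) ∂κ - ∫ x, Complex.exp (t * g x * Complex.I) ∂κ‖ ≤
      |t| * ‖f - g‖ := by
  have hi : ∀ f : Lp ℝ 2 κ, Integrable (fun x => Complex.exp (t * f x * Complex.I)) κ := fun f => by
    refine Integrable.of_bound (C := 1) ?_ (ae_of_all _ fun x => ?_)
    · have := (Lp.stronglyMeasurable f).measurable
      exact (by fun_prop : Measurable fun x => Complex.exp (t * f x * Complex.I)).aestronglyMeasurable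
    · rw [← Complex.ofReal_mul, Complex.norm_exp_ofReal_mul_I]
  rw [← integral_sub (hi f) (hi g)]
  have hfg : MemLp (fun x => (f - g : Lp ℝ 2 κ) x) 2 κ := Lp.memLp _
  have hint : Integrable (fun x => |(f - g : Lp ℝ 2 κ) x|) κ :=
    (hfg.integrable one_le_two).abs
  calc _ ≤ ∫ x, |t| * |(f - g : Lp ℝ 2 κ) x| ∂κ := by
        refine norm_integral_le_of_norm_le (hint.const_mul _) ?_
        filter_upwards [Lp.coeFn_sub f g] with x hx
        have h1 := Real.norm_exp_I_mul_ofReal_sub_one_le (x := t * f x - t * g x)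
        have h2 : Complex.exp (t * f x * Complex.I) - Complex.exp (t * g x * Complex.I) =
            Complex.exp (t * g x * Complex.I) *
              (Complex.exp (Complex.I * ((t * f x - t * g x : ℝ) : ℂ)) - 1) := by
          rw [mul_sub, ← Complex.exp_add, mul_one]
          congr 2
          push_cast
          ring
        rw [h2, norm_mul, ← Complex.ofReal_mul, Complex.norm_exp_ofReal_mul_I, one_mul, hx,
          Pi.sub_apply]
        rwa [Real.norm_eq_abs, ← mul_sub, abs_mul, mul_sub] at h1
    _ = |t| * ∫ x, |(f - g : Lp ℝ 2 κ) x| ∂κ := integral_const_mul _ _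
    _ ≤ |t| * ‖f - g‖ := by
        refine mul_le_mul_of_nonneg_left ?_ (abs_nonneg _)
        have h1 : eLpNorm (fun x => (f - g : Lp ℝ 2 κ) x) 1 κ ≤
            eLpNorm (fun x => (f - g : Lp ℝ 2 κ) x) 2 κ :=
          eLpNorm_le_eLpNorm_of_exponent_le one_le_two hfg.1
        have h2 : ∫ x, |(f - g : Lp ℝ 2 κ) x| ∂κ =
            (eLpNorm (fun x => (f - g : Lp ℝ 2 κ) x) 1 κ).toReal := by
          rw [eLpNorm_one_eq_lintegral_enorm, ← integral_norm_eq_lintegral_enorm hfg.1]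
          rfl
        rw [h2, Lp.norm_def]
        exact ENNReal.toReal_mono hfg.2.ne h1

/-- Independent standard normal variables indexed by a Hilbert basis generate an isonormal Gaussian
field: they extend to a linear isometry of `H` into `L²`. The law of its values is known on finite
linear combinations of the basis, and passes to the limit by continuity of the characteristic
function. -/
theorem exists_isGaussianField {H I Ξ : Type*} [NormedAddCommGroup H] [InnerProductSpace ℝ H]
    [CompleteSpace H] [MeasurableSpace Ξ] {κ : Measure Ξ} [IsProbabilityMeasure κ]
    (b : HilbertBasis I ℝ H) {g : I → Ξ → ℝ} (hg : ∀ i, Measurable (g i)) (hind : iIndepFun g κ)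
    (hlaw : ∀ i, κ.map (g i) = gaussianReal 0 1) :
    ∃ Z : H → Ξ → ℝ, IsGaussianField Z κ := by
  have hmem : ∀ i, MemLp (g i) 2 κ := fun i => by
    have h1 : MemLp id 2 (κ.map (g i)) := by
      rw [hlaw]; exact IsGaussian.memLp_two_id
    exact h1.comp_of_map (hg i).aemeasurable
  have hnorm : ∀ i, ∫ x, g i x * g i x ∂κ = 1 := fun i => by
    have h1 : ∫ x, g i x * g i x ∂κ = ∫ y, y ^ 2 ∂(κ.map (g i)) := by
      rw [integral_map (hg i).aemeasurable (by fun_prop)]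
      simp only [pow_two]
    have h2 := variance_id_gaussianReal (μ := 0) (v := 1)
    rw [variance_of_integral_eq_zero (by fun_prop) (by simp)] at h2
    rw [h1, hlaw]
    simpa using h2
  have hmean : ∀ i, ∫ x, g i x ∂κ = 0 := fun i => by
    have h1 : ∫ x, g i x ∂κ = ∫ y, y ∂(κ.map (g i)) := by
      rw [integral_map (hg i).aemeasurable (by fun_prop)]
    rw [h1, hlaw]
    simp
  have horth : Orthonormal ℝ (fun i => (hmem i).toLp (g i)) := by
    have hin : ∀ i j, inner ℝ ((hmem i).toLp (g i)) ((hmem j).toLp (g j)) =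
        ∫ x, g i x * g j x ∂κ := fun i j => by
      rw [L2.inner_def]
      refine integral_congr_ae ?_
      filter_upwards [(hmem i).coeFn_toLp, (hmem j).coeFn_toLp] with x hx hy
      rw [hx, hy]
      simp [mul_comm]
    refine ⟨fun i => ?_, fun i j hij => ?_⟩
    · rw [norm_eq_sqrt_real_inner, hin, hnorm, Real.sqrt_one]
    · change inner ℝ ((hmem i).toLp (g i)) ((hmem j).toLp (g j)) = 0
      rw [hin, (hind.indepFun hij).integral_fun_mul_eq_mul_integral (hg i).aestronglyMeasurable
        (hg j).aestronglyMeasurable, hmean, zero_mul]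
  have hO := horth.orthogonalFamily
  set θ : H →ₗᵢ[ℝ] Lp ℝ 2 κ := hO.linearIsometry.comp b.repr.toLinearIsometry
  have hθb : ∀ i, θ (b i) = (hmem i).toLp (g i) := fun i => by
    classical
    change hO.linearIsometry (b.repr (b i)) = _
    rw [b.repr_self, OrthogonalFamily.linearIsometry_apply_single]
    simp
  refine ⟨fun h x => θ h x, fun h => (Lp.stronglyMeasurable (θ h)).measurable,
    fun a c h h' => ?_, fun h => ?_⟩
  · rw [map_add, map_smul, map_smul]
    filter_upwards [Lp.coeFn_add (a • θ h) (c • θ h'), Lp.coeFn_smul a (θ h),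
      Lp.coeFn_smul c (θ h')] with x h1 h2 h3
    rw [h1, Pi.add_apply, h2, h3]
    rfl
  · refine map_eq_of_integral_exp_eq (Lp.stronglyMeasurable (θ h)).measurable.aemeasurable
      (by positivity) fun t => ?_
    have hsum : Tendsto (fun s : Finset I => ∑ i ∈ s, b.repr h i • b i) atTop (𝓝 h) :=
      b.hasSum_repr h
    have hc1 : Continuous fun h => ∫ x, Complex.exp (t * θ h x * Complex.I) ∂κ := by
      have hL : LipschitzWith (Real.toNNReal |t|)
          fun h => ∫ x, Complex.exp (t * θ h x * Complex.I) ∂κ :=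
        LipschitzWith.of_dist_le_mul fun h h' => by
          rw [dist_eq_norm, dist_eq_norm, Real.coe_toNNReal _ (abs_nonneg _)]
          refine (norm_integral_exp_sub_le _ _ _).trans ?_
          rw [← map_sub, θ.norm_map]
      exact hL.continuous
    have hc2 : Continuous fun h : H => Complex.exp (-((‖h‖ ^ 2 * t ^ 2 : ℝ) : ℂ) / 2) := by
      fun_prop
    refine tendsto_nhds_unique ((hc1.tendsto h).comp hsum) ?_
    refine ((hc2.tendsto h).comp hsum).congr fun s => ?_
    simp only [Function.comp_apply]
    have hae : (θ (∑ i ∈ s, b.repr h i • b i) : Ξ → ℝ) =ᵐ[κ]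
        fun x => ∑ i ∈ s, b.repr h i * g i x := by
      rw [map_sum]
      have h1 : ∀ᵐ x ∂κ, ∀ i ∈ s, (θ (b.repr h i • b i) : Ξ → ℝ) x = b.repr h i * g i x := by
        rw [s.eventually_all]
        intro i _
        rw [map_smul, hθb]
        filter_upwards [Lp.coeFn_smul (b.repr h i) ((hmem i).toLp (g i)), (hmem i).coeFn_toLp]
          with x h1 h2
        rw [h1, Pi.smul_apply, h2, smul_eq_mul]
      filter_upwards [Lp.coeFn_finsetSum s (fun i => θ (b.repr h i • b i)), h1] with x h2 h3
      rw [h2, Finset.sum_apply]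
      exact Finset.sum_congr rfl h3
    have hnorm2 : ‖∑ i ∈ s, b.repr h i • b i‖ ^ 2 = ∑ i ∈ s, b.repr h i ^ 2 := by
      rw [← real_inner_self_eq_norm_sq, b.orthonormal.inner_sum]
      simp [pow_two]
    have hg2 := integral_exp_eq_of_map_eq (X := fun x => ∑ i ∈ s, b.repr h i * g i x)
      (by fun_prop) (Finset.sum_nonneg fun i _ => sq_nonneg _)
      (map_sum_mul_of_iIndepFun hg hind hlaw s (fun i => b.repr h i)) t
    rw [hnorm2, ← hg2]
    refine integral_congr_ae ?_
    filter_upwards [hae] with x hx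
    rw [hx]

end GaussianFields

section GaussianFieldProperties

open Matrix

variable {H Ξ : Type*} [NormedAddCommGroup H] [InnerProductSpace ℝ H] [MeasurableSpace Ξ]
  {κ : Measure Ξ} {Z : H → Ξ → ℝ}

theorem IsGaussianField.congr {Z' : H → Ξ → ℝ} (hZ : IsGaussianField Z κ)
    (hm : ∀ h, Measurable (Z' h)) (h : ∀ h, Z' h =ᵐ[κ] Z h) : IsGaussianField Z' κ where
  measurable := hm
  linear a b u v := by
    filter_upwards [h (a • u + b • v), h u, h v, hZ.linear a b u v] with x h1 h2 h3 h4
    rw [h1, h2, h3, h4]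
  law u := by rw [Measure.map_congr (h u), hZ.law]

theorem IsGaussianField.memLp (hZ : IsGaussianField Z κ) (h : H) : MemLp (Z h) 2 κ := by
  have h1 : MemLp id 2 (κ.map (Z h)) := by
    rw [hZ.law]; exact IsGaussian.memLp_two_id
  exact h1.comp_of_map (hZ.measurable h).aemeasurable

theorem IsGaussianField.integral_eq_zero (hZ : IsGaussianField Z κ) (h : H) :
    ∫ x, Z h x ∂κ = 0 := by
  have h1 : ∫ x, Z h x ∂κ = ∫ y, y ∂(κ.map (Z h)) := by
    rw [integral_map (hZ.measurable h).aemeasurable (by fun_prop)]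
  rw [h1, hZ.law]
  simp

theorem IsGaussianField.integral_sq (hZ : IsGaussianField Z κ) (h : H) :
    ∫ x, Z h x ^ 2 ∂κ = ‖h‖ ^ 2 := by
  have h1 : ∫ x, Z h x ^ 2 ∂κ = ∫ y, y ^ 2 ∂(κ.map (Z h)) := by
    rw [integral_map (hZ.measurable h).aemeasurable (by fun_prop)]
  have h2 := variance_id_gaussianReal (μ := 0) (v := (‖h‖ ^ 2).toNNReal)
  rw [variance_of_integral_eq_zero (by fun_prop) (by simp), Real.coe_toNNReal _ (by positivity)] at h2
  rw [h1, hZ.law]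
  simpa using h2

theorem IsGaussianField.eLpNorm_eq (hZ : IsGaussianField Z κ) (h : H) :
    eLpNorm (Z h) 2 κ = ENNReal.ofReal ‖h‖ := by
  have h1 := (hZ.memLp h).eLpNorm_eq_integral_rpow_norm two_ne_zero ENNReal.ofNat_ne_top
  rw [h1]
  congr 1
  have h2 : ∫ x, ‖Z h x‖ ^ (2 : ℝ≥0∞).toReal ∂κ = ‖h‖ ^ 2 := by
    rw [← hZ.integral_sq h]
    refine integral_congr_ae (ae_of_all _ fun x => ?_)
    simp
  rw [h2]
  simp only [ENNReal.toReal_ofNat]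
  rw [← one_div, ← Real.sqrt_eq_rpow, Real.sqrt_sq (norm_nonneg _)]

theorem IsGaussianField.integral_mul (hZ : IsGaussianField Z κ) (h h' : H) :
    ∫ x, Z h x * Z h' x ∂κ = inner ℝ h h' := by
  have h1 := hZ.integral_sq (h + h')
  have hi1 := (hZ.memLp h).integrable_sq
  have hi2 := (hZ.memLp h').integrable_sq
  have hi3 : Integrable (fun x => Z h x * Z h' x) κ := (hZ.memLp h).integrable_mul (hZ.memLp h')
  have h2 : ∫ x, Z (h + h') x ^ 2 ∂κ =
      ∫ x, (Z h x ^ 2 + 2 * (Z h x * Z h' x) + Z h' x ^ 2) ∂κ := by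
    refine integral_congr_ae ?_
    have := hZ.linear 1 1 h h'
    rw [one_smul, one_smul] at this
    filter_upwards [this] with x hx
    rw [hx]; ring
  have hi4 : Integrable (fun x => Z h x ^ 2 + 2 * (Z h x * Z h' x)) κ := hi1.add (hi3.const_mul 2)
  rw [h2, integral_add hi4 hi2, integral_add hi1 (hi3.const_mul 2),
    integral_const_mul, hZ.integral_sq, hZ.integral_sq, norm_add_sq_real] at h1
  linarith

theorem IsGaussianField.map_sum (hZ : IsGaussianField Z κ) {I : Type*} (s : Finset I) (c : I → ℝ)
    (η : I → H) : Z (∑ i ∈ s, c i • η i) =ᵐ[κ] fun x => ∑ i ∈ s, c i * Z (η i) x := by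
  classical
  have h0 : Z 0 =ᵐ[κ] fun _ => 0 := by
    have := hZ.linear 0 0 0 0
    simp only [zero_smul, add_zero, zero_mul] at this
    exact this
  induction s using Finset.induction_on with
  | empty => simpa using h0
  | insert i s hi ih =>
    have h1 := hZ.linear (c i) 1 (η i) (∑ i ∈ s, c i • η i)
    simp only [Finset.sum_insert hi]
    rw [one_smul] at h1
    filter_upwards [h1, ih] with x h2 h3
    rw [h2, h3, one_mul]

/-- A Gaussian field can be built with a prescribed finite part: `Z (η s)` is the `s`-th coordinate
of `C` times a given standard Gaussian vector, as soon as the covariances agree. The rest of the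
field is completed with an independent field. -/
theorem exists_isGaussianField_extending {S Ξ₁ : Type*} [Fintype S]
    [MeasurableSpace Ξ₁] {κ₁ : Measure Ξ₁} [IsProbabilityMeasure κ₁] {Z₁ : H → Ξ₁ → ℝ}
    (hZ₁ : IsGaussianField Z₁ κ₁) (η : S → H) (C : Matrix S S ℝ)
    (hC : ∀ s t, (C * Cᵀ) s t = inner ℝ (η s) (η t)) :
    ∃ Z : H → (S → ℝ) × Ξ₁ → ℝ,
      IsGaussianField Z ((Measure.pi fun _ : S => gaussianReal 0 1).prod κ₁) ∧
      ∀ s, Z (η s) =ᵐ[(Measure.pi fun _ : S => gaussianReal 0 1).prod κ₁]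
        fun x => (C *ᵥ x.1) s := by
  classical
  set U : Submodule ℝ H := Submodule.span ℝ (Set.range η) with hU
  have : FiniteDimensional ℝ U := FiniteDimensional.span_of_finite ℝ (Set.finite_range η)
  set π : H → H := fun h => U.starProjection h with hπ
  have hex : ∀ h, ∃ b : S → ℝ, ∑ s, b s • η s = π h := fun h =>
    (Submodule.mem_span_range_iff_exists_fun ℝ).1 (Submodule.starProjection_apply_mem U h)
  choose b hb using hex
  have hnorm : ∀ c : S → ℝ, (Cᵀ *ᵥ c) ⬝ᵥ (Cᵀ *ᵥ c) = ‖∑ s, c s • η s‖ ^ 2 := fun c => by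
    rw [← real_inner_self_eq_norm_sq, sum_inner, dotProduct_mulVec, ← mulVec_transpose,
      transpose_transpose, mulVec_mulVec, dotProduct_comm]
    simp only [dotProduct, mulVec, hC]
    refine Finset.sum_congr rfl fun s _ => ?_
    rw [inner_sum, Finset.mul_sum]
    refine Finset.sum_congr rfl fun t _ => ?_
    rw [real_inner_smul_left, real_inner_smul_right]
    ring
  -- `Cᵀ c` depends on `c` only through the vector `∑ c s • η s` that it represents.
  have hker : ∀ c c' : S → ℝ, ∑ s, c s • η s = ∑ s, c' s • η s → Cᵀ *ᵥ c = Cᵀ *ᵥ c' :=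
    fun c c' h => by
      have h1 := hnorm (c - c')
      have h2 : ∑ s, (c - c') s • η s = 0 := by
        simp only [Pi.sub_apply, sub_smul, Finset.sum_sub_distrib, h, sub_self]
      rw [h2, norm_zero, zero_pow two_ne_zero] at h1
      have h3 := dotProduct_self_eq_zero.1 h1
      rw [mulVec_sub] at h3
      exact sub_eq_zero.1 h3
  -- `e h` is the vector of the given Gaussian coordinates that represents the projection `π h`; it is
  -- linear in `h` although the choice of the coefficients `b h` need not be.
  set e : H → S → ℝ := fun h => Cᵀ *ᵥ b h with he
  have helin : ∀ (a c : ℝ) (h h' : H), e (a • h + c • h') = a • e h + c • e h' :=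
    fun a c h h' => by
      simp only [he]
      rw [← mulVec_smul, ← mulVec_smul, ← mulVec_add]
      refine hker _ _ ?_
      simp only [Pi.add_apply, Pi.smul_apply, smul_eq_mul, add_smul, mul_smul,
        Finset.sum_add_distrib, ← Finset.smul_sum, hb, hπ, map_add, map_smul]
  have hee : ∀ h, e h ⬝ᵥ e h = ‖π h‖ ^ 2 := fun h => by rw [hnorm, hb]
  refine ⟨fun h x => e h ⬝ᵥ x.1 + Z₁ (h - π h) x.2, ⟨fun h => ?_, fun a c h h' => ?_, fun h => ?_⟩,
    fun s => ?_⟩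
  · have h1 : Measurable fun x : (S → ℝ) × Ξ₁ => e h ⬝ᵥ x.1 := by
      simp only [dotProduct]; fun_prop
    exact h1.add ((hZ₁.measurable _).comp measurable_snd)
  · have h1 := hZ₁.linear a c (h - π h) (h' - π h')
    have h2 : a • (h - π h) + c • (h' - π h') = a • h + c • h' - π (a • h + c • h') := by
      simp only [hπ, map_add, map_smul, smul_sub]
      abel
    rw [h2] at h1
    filter_upwards [(Measure.quasiMeasurePreserving_snd
      (μ := Measure.pi fun _ : S => gaussianReal 0 1) (ν := κ₁)).ae h1] with x hx
    rw [hx, helin, add_dotProduct, smul_dotProduct, smul_dotProduct]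
    simp only [smul_eq_mul]
    ring
  · have hme : Measurable fun x : S → ℝ => e h ⬝ᵥ x := by simp only [dotProduct]; fun_prop
    have hm : Measurable fun x : (S → ℝ) × Ξ₁ => e h ⬝ᵥ x.1 + Z₁ (h - π h) x.2 :=
      (hme.comp measurable_fst).add ((hZ₁.measurable _).comp measurable_snd)
    refine map_eq_of_integral_exp_eq hm.aemeasurable (by positivity) fun t => ?_
    have h1 := integral_exp_eq_of_map_eq hme.aemeasurable
      (hee h ▸ by positivity) (map_dotProduct_pi_gaussianReal (e h)) t
    have h2 := integral_exp_eq_of_map_eq (hZ₁.measurable (h - π h)).aemeasurable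
      (by positivity) (hZ₁.law (h - π h)) t
    have h3 := integral_prod_mul (μ := Measure.pi fun _ : S => gaussianReal 0 1) (ν := κ₁)
      (fun x => Complex.exp (t * (e h ⬝ᵥ x : ℝ) * Complex.I))
      (fun y => Complex.exp (t * Z₁ (h - π h) y * Complex.I))
    rw [h1, h2, ← Complex.exp_add, hee] at h3
    have hpy : ‖h‖ ^ 2 = ‖π h‖ ^ 2 + ‖h - π h‖ ^ 2 := by
      rw [U.norm_sq_eq_add_norm_sq_starProjection h, Submodule.starProjection_orthogonal_val]
    rw [hpy]
    convert h3 using 1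
    · refine integral_congr_ae (ae_of_all _ fun x => ?_)
      simp only
      rw [← Complex.exp_add]
      congr 1
      push_cast
      ring
    · congr 1
      push_cast
      ring
  · have hπη : π (η s) = η s :=
      Submodule.starProjection_eq_self_iff.2 (Submodule.subset_span ⟨s, rfl⟩)
    have hes : e (η s) = Cᵀ *ᵥ Pi.single s 1 := by
      refine hker _ _ ?_
      rw [hb, hπη, Finset.sum_eq_single s]
      · simp
      · intro t _ hts
        simp [Pi.single_eq_of_ne hts]
      · simp
    have h0 : Z₁ 0 =ᵐ[κ₁] fun _ => 0 := by
      have := hZ₁.linear 0 0 0 0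
      simp only [zero_smul, add_zero, zero_mul] at this
      exact this
    filter_upwards [(Measure.quasiMeasurePreserving_snd
      (μ := Measure.pi fun _ : S => gaussianReal 0 1) (ν := κ₁)).ae h0] with x hx
    rw [hπη, sub_self, hx, hes, add_zero, mulVec_transpose, ← dotProduct_mulVec,
      single_one_dotProduct]

end GaussianFieldProperties

/-! ### A modification that is linear along all small coefficient sequences -/

section Coherence

variable {H Ξ : Type*} [NormedAddCommGroup H] [InnerProductSpace ℝ H] [CompleteSpace H]
  [MeasurableSpace Ξ] {κ : Measure Ξ} [IsProbabilityMeasure κ] {Z : H → Ξ → ℝ}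

omit [CompleteSpace H] in
/-- The `L¹` norm is at most the `L²` norm, which is `‖h‖`. -/
theorem IsGaussianField.lintegral_abs_le (hZ : IsGaussianField Z κ) (h : H) :
    ∫⁻ x, ENNReal.ofReal |Z h x| ∂κ ≤ ENNReal.ofReal ‖h‖ := by
  rw [← hZ.eLpNorm_eq h]
  refine le_trans (le_of_eq ?_) (eLpNorm_le_eLpNorm_of_exponent_le one_le_two (hZ.memLp h).1)
  rw [eLpNorm_one_eq_lintegral_enorm]
  exact lintegral_congr fun x => by rw [← Real.norm_eq_abs, ofReal_norm]

omit [CompleteSpace H] in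
theorem IsGaussianField.ae_summable (hZ : IsGaussianField Z κ) {η : ℕ → H} {b : ℕ → ℝ}
    (hb0 : ∀ j, 0 ≤ b j) (hb : Summable fun j => b j * ‖η j‖) :
    ∀ᵐ x ∂κ, Summable fun j => b j * |Z (η j) x| := by
  have hm : ∀ j, Measurable fun x => ENNReal.ofReal (b j * |Z (η j) x|) := fun j =>
    (((hZ.measurable (η j)).norm).const_mul (b j)).ennreal_ofReal
  have h1 : ∫⁻ x, ∑' j, ENNReal.ofReal (b j * |Z (η j) x|) ∂κ ≠ ∞ := by
    rw [lintegral_tsum fun j => (hm j).aemeasurable]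
    refine ne_top_of_le_ne_top hb.tsum_ofReal_ne_top (ENNReal.tsum_le_tsum fun j => ?_)
    simp_rw [ENNReal.ofReal_mul (hb0 j)]
    have h2 : Measurable fun x => ENNReal.ofReal |Z (η j) x| :=
      (hZ.measurable (η j)).norm.ennreal_ofReal
    rw [lintegral_const_mul _ h2]
    gcongr
    exact hZ.lintegral_abs_le _
  filter_upwards [ae_lt_top (Measurable.tsum hm) h1] with x hx
  refine (ENNReal.summable_toReal hx.ne).congr fun j => ?_
  rw [ENNReal.toReal_ofReal (mul_nonneg (hb0 j) (abs_nonneg _))]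

theorem summable_smul_of_abs_le {η : ℕ → H} {b β : ℕ → ℝ} (hb : Summable fun j => b j * ‖η j‖)
    (hβ : ∀ j, |β j| ≤ b j) : Summable fun j => β j • η j := by
  refine Summable.of_norm_bounded hb fun j => ?_
  rw [norm_smul, Real.norm_eq_abs]
  exact mul_le_mul_of_nonneg_right (hβ j) (norm_nonneg _)

theorem summable_mul_of_abs_le {z : ℕ → ℝ} {b β : ℕ → ℝ} (hb : Summable fun j => b j * |z j|)
    (hβ : ∀ j, |β j| ≤ b j) : Summable fun j => β j * z j := by
  refine Summable.of_norm_bounded hb fun j => ?_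
  rw [norm_mul, Real.norm_eq_abs, Real.norm_eq_abs]
  exact mul_le_mul_of_nonneg_right (hβ j) (abs_nonneg _)

/-- A Gaussian field is almost surely linear along one absolutely convergent series. The exceptional
null set depends on the coefficients. -/
theorem IsGaussianField.map_tsum (hZ : IsGaussianField Z κ) {η : ℕ → H} {b β : ℕ → ℝ}
    (hb0 : ∀ j, 0 ≤ b j) (hb : Summable fun j => b j * ‖η j‖) (hβ : ∀ j, |β j| ≤ b j) :
    Z (∑' j, β j • η j) =ᵐ[κ] fun x => ∑' j, β j * Z (η j) x := by
  set h := ∑' j, β j • η j with hh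
  have hs : Tendsto (fun N => ∑ j ∈ Finset.range N, β j • η j) atTop (𝓝 h) :=
    (summable_smul_of_abs_le hb hβ).hasSum.tendsto_sum_nat
  refine tendstoInMeasure_ae_unique
    (f := fun N => Z (∑ j ∈ Finset.range N, β j • η j)) (u := atTop) ?_ ?_
  · refine tendstoInMeasure_of_tendsto_eLpNorm two_ne_zero
      (fun N => (hZ.measurable _).aestronglyMeasurable) (hZ.measurable _).aestronglyMeasurable ?_
    have h1 : ∀ N, eLpNorm (Z (∑ j ∈ Finset.range N, β j • η j) - Z h) 2 κ =
        ENNReal.ofReal ‖∑ j ∈ Finset.range N, β j • η j - h‖ := fun N => by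
      rw [← hZ.eLpNorm_eq]
      refine eLpNorm_congr_ae ?_
      have h2 := hZ.linear 1 (-1) (∑ j ∈ Finset.range N, β j • η j) h
      rw [one_smul, neg_one_smul, ← sub_eq_add_neg] at h2
      filter_upwards [h2] with x hx
      rw [hx, Pi.sub_apply]
      ring
    simp_rw [h1]
    rw [← ENNReal.ofReal_zero]
    refine (ENNReal.continuous_ofReal.tendsto 0).comp ?_
    exact (tendsto_iff_norm_sub_tendsto_zero).1 hs
  · refine tendstoInMeasure_of_tendsto_ae (fun N => (hZ.measurable _).aestronglyMeasurable) ?_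
    have h1 : ∀ᵐ x ∂κ, ∀ N, Z (∑ j ∈ Finset.range N, β j • η j) x =
        ∑ j ∈ Finset.range N, β j * Z (η j) x :=
      ae_all_iff.2 fun N => hZ.map_sum _ _ _
    filter_upwards [h1, hZ.ae_summable hb0 hb] with x hx hx'
    simp_rw [hx]
    exact (summable_mul_of_abs_le hx' hβ).hasSum.tendsto_sum_nat

/-- A Gaussian field has a modification that is, with probability one, linear along *all* series
`∑ β j • η a j` with `|β j| ≤ b j` at once. Two coefficient sequences that represent the same vector
almost surely give the same value; this extends from a countable dense set of such pairs to all of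
them, because the values depend continuously on the coefficients. -/
theorem IsGaussianField.exists_modification (hZ : IsGaussianField Z κ) {A : Type*} [Countable A]
    (η : A → ℕ → H) {b : ℕ → ℝ} (hb0 : ∀ j, 0 ≤ b j) (hb : ∀ a, Summable fun j => b j * ‖η a j‖) :
    ∃ Z' : H → Ξ → ℝ, IsGaussianField Z' κ ∧ (∀ h, Z' h =ᵐ[κ] Z h) ∧
      ∀ᵐ x ∂κ, (∀ a, Summable fun j => b j * |Z (η a j) x|) ∧
        ∀ a (β : ℕ → ℝ), (∀ j, |β j| ≤ b j) →
          Z' (∑' j, β j • η a j) x = ∑' j, β j * Z (η a j) x := by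
  classical
  -- The pairs of coefficient sequences that represent the same vector.
  set K : A → A → Set ((ℕ → ℝ) × (ℕ → ℝ)) := fun a a' =>
    {c | (∀ j, |c.1 j| ≤ b j) ∧ (∀ j, |c.2 j| ≤ b j) ∧
      ∑' j, c.1 j • η a j = ∑' j, c.2 j • η a' j} with hK
  have hsum : ∀ᵐ x ∂κ, ∀ a, Summable fun j => b j * |Z (η a j) x| :=
    ae_all_iff.2 fun a => hZ.ae_summable hb0 (hb a)
  have hcoh : ∀ᵐ x ∂κ, ∀ a a', ∀ c : K a a',
      ∑' j, c.1.1 j * Z (η a j) x = ∑' j, c.1.2 j * Z (η a' j) x := by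
    refine ae_all_iff.2 fun a => ae_all_iff.2 fun a' => ?_
    obtain ⟨D, hDc, hDd⟩ := TopologicalSpace.exists_countable_dense (K a a')
    have hD : ∀ᵐ x ∂κ, ∀ c ∈ D, ∑' j, c.1.1 j * Z (η a j) x = ∑' j, c.1.2 j * Z (η a' j) x := by
      refine (ae_ball_iff hDc).2 fun c _ => ?_
      have h1 := hZ.map_tsum hb0 (hb a) c.2.1
      have h2 := hZ.map_tsum hb0 (hb a') c.2.2.1
      rw [c.2.2.2] at h1
      exact h1.symm.trans h2
    filter_upwards [hsum, hD] with x hx hxD c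
    have hc1 : Continuous fun c : K a a' => ∑' j, c.1.1 j * Z (η a j) x := by
      refine continuous_tsum (fun j => by fun_prop) (hx a) fun j c => ?_
      rw [norm_mul, Real.norm_eq_abs, Real.norm_eq_abs]
      exact mul_le_mul_of_nonneg_right (c.2.1 j) (abs_nonneg _)
    have hc2 : Continuous fun c : K a a' => ∑' j, c.1.2 j * Z (η a' j) x := by
      refine continuous_tsum (fun j => by fun_prop) (hx a') fun j c => ?_
      rw [norm_mul, Real.norm_eq_abs, Real.norm_eq_abs]
      exact mul_le_mul_of_nonneg_right (c.2.2.1 j) (abs_nonneg _)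
    exact congrFun (Continuous.ext_on hDd hc1 hc2 hxD) c
  obtain ⟨G, hGsub, hGm, hG⟩ : ∃ G : Set Ξ, (∀ x ∈ G, (∀ a, Summable fun j => b j * |Z (η a j) x|) ∧
      ∀ a a', ∀ c : K a a', ∑' j, c.1.1 j * Z (η a j) x = ∑' j, c.1.2 j * Z (η a' j) x) ∧
      MeasurableSet G ∧ ∀ᵐ x ∂κ, x ∈ G := by
    obtain ⟨N, hN, hNm, hN0⟩ := exists_measurable_superset_of_null (hsum.and hcoh)
    refine ⟨Nᶜ, fun x hx => ?_, hNm.compl, compl_mem_ae_iff.2 hN0⟩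
    by_contra hx'
    exact hx (hN hx')
  -- On the good event `G`, a representable vector takes the value of the series of any one of its
  -- representations.
  set rep : H → Prop := fun h => ∃ c : A × (ℕ → ℝ), (∀ j, |c.2 j| ≤ b j) ∧
    ∑' j, c.2 j • η c.1 j = h with hrep
  set Z' : H → Ξ → ℝ := fun h => if hh : rep h then
    G.indicator fun x => ∑' j, (Classical.choose hh).2 j * Z (η (Classical.choose hh).1 j) x
    else Z h with hZ'
  have hmod : ∀ h, Z' h =ᵐ[κ] Z h := fun h => by
    by_cases hh : rep h
    · have h1 := Classical.choose_spec hh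
      have h2 := hZ.map_tsum hb0 (hb (Classical.choose hh).1) h1.1
      rw [h1.2] at h2
      filter_upwards [hG, h2] with x hx hx2
      simp only [hZ', dif_pos hh]
      rw [Set.indicator_of_mem hx, hx2]
    · simp only [hZ', dif_neg hh]
      exact EventuallyEq.rfl
  refine ⟨Z', hZ.congr (fun h => ?_) hmod, hmod, ?_⟩
  · by_cases hh : rep h
    · simp only [hZ', dif_pos hh]
      refine measurable_of_tendsto_metrizable (f := fun N => G.indicator fun x =>
        ∑ j ∈ Finset.range N, (Classical.choose hh).2 j * Z (η (Classical.choose hh).1 j) x)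
        (fun N => ?_) (tendsto_pi_nhds.2 fun x => ?_)
      · refine Measurable.indicator ?_ hGm
        exact Finset.measurable_sum _ fun j _ => (hZ.measurable _).const_mul _
      · by_cases hx : x ∈ G
        · simp only [Set.indicator_of_mem hx]
          exact (summable_mul_of_abs_le ((hGsub x hx).1 _)
            (Classical.choose_spec hh).1).hasSum.tendsto_sum_nat
        · simp only [Set.indicator_of_notMem hx]
          exact tendsto_const_nhds
    · simp only [hZ', dif_neg hh]
      exact hZ.measurable h
  · filter_upwards [hG] with x hx
    refine ⟨(hGsub x hx).1, fun a β hβ => ?_⟩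
    have hh : rep (∑' j, β j • η a j) := ⟨(a, β), hβ, rfl⟩
    have h1 := Classical.choose_spec hh
    simp only [hZ', dif_pos hh]
    rw [Set.indicator_of_mem hx]
    exact (hGsub x hx).2 _ _ ⟨(_, _), h1.1, hβ, h1.2⟩

end Coherence

/-! ### Isonormal processes from Gaussian fields -/

section Isonormal

variable {𝒱 : Type*} [MeasurableSpace 𝒱] {P : Measure 𝒱} [IsProbabilityMeasure P]

open Classical in
/-- The class in `L²_P` of the centred function `f - E_P f`; zero if `f` is not square
integrable. -/
noncomputable def centredClass (P : Measure 𝒱) [IsProbabilityMeasure P] (f : 𝒱 → ℝ) : Lp ℝ 2 P :=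
  if hf : MemLp f 2 P then (hf.sub (memLp_const (∫ u, f u ∂P))).toLp else 0

theorem coeFn_centredClass {f : 𝒱 → ℝ} (hf : MemLp f 2 P) :
    centredClass P f =ᵐ[P] fun v => f v - ∫ u, f u ∂P := by
  rw [centredClass, dif_pos hf]
  exact MemLp.coeFn_toLp _

theorem inner_centredClass {f g : 𝒱 → ℝ} (hf : MemLp f 2 P) (hg : MemLp g 2 P) :
    inner ℝ (centredClass P f) (centredClass P g) =
      ∫ v, (f v - ∫ u, f u ∂P) * (g v - ∫ u, g u ∂P) ∂P := by
  rw [L2.inner_def]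
  refine integral_congr_ae ?_
  filter_upwards [coeFn_centredClass hf, coeFn_centredClass hg] with v h1 h2
  rw [h1, h2]
  simp [mul_comm]

theorem norm_sq_centredClass_le {f : 𝒱 → ℝ} (hf : MemLp f 2 P) :
    ‖centredClass P f‖ ^ 2 ≤ ∫ v, f v ^ 2 ∂P := by
  rw [← real_inner_self_eq_norm_sq, inner_centredClass hf hf]
  have h1 := variance_eq_integral hf.1.aemeasurable
  have h2 := variance_le_expectation_sq hf.1
  simp only [pow_two, Pi.pow_apply] at h1 h2 ⊢
  rw [← h1]
  exact h2

theorem norm_centredClass_le_of_bounded {b : ℝ} {f : 𝒱 → ℝ} (hf : Measurable f) (hb0 : 0 ≤ b)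
    (hb : ∀ v, |f v| ≤ b) : ‖centredClass P f‖ ≤ b := by
  have hmem : MemLp f 2 P := MemLp.of_bound hf.aestronglyMeasurable b (ae_of_all _ hb)
  refine abs_le_of_sq_le_sq' ?_ hb0 |>.2
  refine (norm_sq_centredClass_le hmem).trans ?_
  have h1 := integral_mono (μ := P) hmem.integrable_sq (integrable_const (b ^ 2)) fun v =>
    sq_le_sq.2 ((hb v).trans (le_abs_self b))
  simpa using h1

theorem centredClass_congr {f g : 𝒱 → ℝ} (h : f =ᵐ[P] g) : centredClass P f = centredClass P g := by
  by_cases hf : MemLp f 2 P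
  · have hg : MemLp g 2 P := hf.ae_eq h
    refine Lp.ext ?_
    filter_upwards [coeFn_centredClass hf, coeFn_centredClass hg, h] with v h1 h2 h3
    rw [h1, h2, h3, integral_congr_ae h]
  · have hg : ¬ MemLp g 2 P := fun hg => hf (hg.ae_eq h.symm)
    rw [centredClass, centredClass, dif_neg hf, dif_neg hg]

theorem IsGaussianField.isGaussianProcess {H T Ξ : Type*} [NormedAddCommGroup H]
    [InnerProductSpace ℝ H] [MeasurableSpace Ξ] {κ : Measure Ξ} {Z : H → Ξ → ℝ}
    (hZ : IsGaussianField Z κ) (h : T → H) : IsGaussianProcess (fun t => Z (h t)) κ := by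
  classical
  refine ⟨fun I => ⟨isGaussian_of_map_eq_gaussianReal fun L => ?_⟩⟩
  have hm : Measurable fun ω => I.restrict fun x => Z (h x) ω :=
    measurable_pi_lambda _ fun i => hZ.measurable _
  set c : I → ℝ := fun i => L (Pi.single i 1) with hc
  refine ⟨0, (‖∑ i, c i • h i‖ ^ 2).toNNReal, ?_⟩
  rw [← hZ.law, Measure.map_map L.continuous.measurable hm]
  refine Measure.map_congr ?_
  filter_upwards [hZ.map_sum Finset.univ c fun i => h i] with x hx
  rw [hx, Function.comp_apply]
  have h1 : (I.restrict fun t => Z (h t) x) =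
      ∑ i : I, Z (h i) x • (Pi.single i 1 : I → ℝ) := by
    funext i
    simp [Finset.sum_apply, Pi.single_apply]
  rw [h1, _root_.map_sum]
  refine Finset.sum_congr rfl fun i _ => ?_
  rw [map_smul, smul_eq_mul, mul_comm]

/-- A Gaussian field on `L²_P`, evaluated at centred classes, is an isonormal process. -/
theorem IsGaussianField.isIsonormal {Ξ Ω : Type*} [MeasurableSpace Ξ] [MeasurableSpace Ω]
    {κ : Measure Ξ} {ρ : Measure Ω} {Z : Lp ℝ 2 P → Ξ → ℝ} (hZ : IsGaussianField Z κ) {Λ : Ω → Ξ}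
    (hΛ : MeasurePreserving Λ ρ κ) : IsIsonormal P (fun f x => Z (centredClass P f) (Λ x)) ρ := by
  refine ⟨fun f _ => (hZ.measurable _).comp hΛ.measurable, ⟨fun I => ⟨?_⟩⟩, fun f _ => ?_,
    fun f g hf hg => ?_, fun f g _ _ h => ?_⟩
  · have h1 := ((hZ.isGaussianProcess
      (fun f : {f : 𝒱 → ℝ // MemLp f 2 P} => centredClass P f)).hasGaussianLaw I).isGaussian_map
    have hm : Measurable fun ω => I.restrict fun f => Z (centredClass P f) ω :=
      measurable_pi_lambda _ fun i => hZ.measurable _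
    rw [← hΛ.map_eq, Measure.map_map hm hΛ.measurable] at h1
    exact h1
  · rw [← hZ.integral_eq_zero (centredClass P f), ← hΛ.map_eq,
      integral_map hΛ.measurable.aemeasurable (hZ.measurable _).aestronglyMeasurable]
  · rw [← inner_centredClass hf hg, ← hZ.integral_mul, ← hΛ.map_eq,
      integral_map hΛ.measurable.aemeasurable
        ((hZ.measurable _).fun_mul (hZ.measurable _)).aestronglyMeasurable]
  · rw [centredClass_congr h]

end Isonormal

/-! ### Standardizing a Gaussian vector with a regularized covariance matrix -/

section Standardization

open Matrix
open scoped MatrixOrder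

variable {S T : Type*} [Fintype S] [DecidableEq S] [Fintype T]

theorem sqrt_mul_sqrt_of_posSemidef {M : Matrix S S ℝ} (hM : M.PosSemidef) :
    CFC.sqrt M * CFC.sqrt M = M :=
  CFC.sqrt_mul_sqrt_self M hM.nonneg

theorem posSemidef_sqrt (M : Matrix S S ℝ) : (CFC.sqrt M).PosSemidef :=
  nonneg_iff_posSemidef.1 (CFC.sqrt_nonneg M)

theorem transpose_sqrt (M : Matrix S S ℝ) : (CFC.sqrt M)ᵀ = CFC.sqrt M := by
  have := (posSemidef_sqrt M).isHermitian.eq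
  rwa [conjTranspose_eq_transpose_of_trivial] at this

omit [DecidableEq S] in
theorem abs_dotProduct_mulVec_le_sum (D : Matrix S S ℝ) (u : S → ℝ) :
    |u ⬝ᵥ D *ᵥ u| ≤ (∑ a, ∑ b, |D a b|) * (u ⬝ᵥ u) := by
  have hu : ∀ a, u a * u a ≤ u ⬝ᵥ u := fun a =>
    Finset.single_le_sum (f := fun a => u a * u a) (fun _ _ => mul_self_nonneg _)
      (Finset.mem_univ a)
  have he : u ⬝ᵥ D *ᵥ u = ∑ a, ∑ b, u a * (D a b * u b) := by
    simp only [dotProduct, mulVec, Finset.mul_sum]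
  rw [he]
  generalize u ⬝ᵥ u = U at hu
  refine (Finset.abs_sum_le_sum_abs _ _).trans ?_
  rw [Finset.sum_mul]
  refine Finset.sum_le_sum fun a _ => (Finset.abs_sum_le_sum_abs _ _).trans ?_
  rw [Finset.sum_mul]
  refine Finset.sum_le_sum fun b _ => ?_
  rw [abs_mul, abs_mul, mul_left_comm]
  refine mul_le_mul_of_nonneg_left ?_ (abs_nonneg _)
  nlinarith [sq_nonneg (|u a| - |u b|), abs_mul_abs_self (u a), abs_mul_abs_self (u b), hu a, hu b]

/-- A crude modulus of continuity of the entries of the square root, used only for measurability. -/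
theorem sqrt_apply_sub_sq_le {M M' : Matrix S S ℝ} (hM : M.PosSemidef) (hM' : M'.PosSemidef)
    (s s' : S) : (CFC.sqrt M s s' - CFC.sqrt M' s s') ^ 2 ≤ ∑ a, ∑ b, |M a b - M' a b| := by
  have h := sub_mulVec_dotProduct_le (posSemidef_sqrt M) (posSemidef_sqrt M')
    (t := ∑ a, ∑ b, |M a b - M' a b|) (fun u => by
      rw [sqrt_mul_sqrt_of_posSemidef hM, sqrt_mul_sqrt_of_posSemidef hM']
      exact abs_dotProduct_mulVec_le_sum (M - M') u) (Pi.single s' 1)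
  rw [mulVec_single_one, single_one_dotProduct, Pi.single_eq_same, mul_one] at h
  refine le_trans ?_ h
  refine le_trans (le_of_eq ?_) (Finset.single_le_sum
    (f := fun a => (CFC.sqrt M - CFC.sqrt M') a s' * (CFC.sqrt M - CFC.sqrt M') a s')
    (fun _ _ => mul_self_nonneg _) (Finset.mem_univ s))
  simp [pow_two]

theorem continuous_sqrt_apply {X : Type*} [TopologicalSpace X] {M : X → Matrix S S ℝ}
    (hM : Continuous M) (hpos : ∀ x, (M x).PosSemidef) (s s' : S) :
    Continuous fun x => CFC.sqrt (M x) s s' := by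
  refine continuous_iff_continuousAt.2 fun x₀ => ?_
  have h1 : Tendsto (fun x => √(∑ a, ∑ b, |M x a b - M x₀ a b|)) (𝓝 x₀) (𝓝 0) := by
    have hc : Continuous fun x => √(∑ a, ∑ b, |M x a b - M x₀ a b|) := by
      have : ∀ a b, Continuous fun x => M x a b := fun a b => hM.matrix_elem a b
      fun_prop
    have := hc.tendsto x₀
    simpa using this
  refine tendsto_iff_norm_sub_tendsto_zero.2 (squeeze_zero (fun _ => norm_nonneg _) (fun x => ?_) h1)
  rw [Real.norm_eq_abs]
  exact Real.abs_le_sqrt (sqrt_apply_sub_sq_le (hpos x) (hpos x₀) s s')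

/-- The square root of the regularized covariance matrix `A Aᵀ + δ`. -/
noncomputable def regSqrt (δ : ℝ) (A : Matrix S T ℝ) : Matrix S S ℝ := CFC.sqrt (A * Aᵀ + δ • 1)

/-- If `w` and `g` are independent standard Gaussian vectors, then `A w + √δ g` is Gaussian with
covariance `A Aᵀ + δ`; this is its standardization. -/
noncomputable def standardize (δ : ℝ) (A : Matrix S T ℝ) (w : T → ℝ) (g : S → ℝ) : S → ℝ :=
  (regSqrt δ A)⁻¹ *ᵥ (A *ᵥ w + √δ • g)

theorem posSemidef_regularized {δ : ℝ} (hδ : 0 ≤ δ) (A : Matrix S T ℝ) :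
    (A * Aᵀ + δ • 1).PosSemidef := by
  have h1 := posSemidef_self_mul_conjTranspose A
  rw [conjTranspose_eq_transpose_of_trivial] at h1
  exact h1.add (PosSemidef.one.smul hδ)

theorem regSqrt_mul_self {δ : ℝ} (hδ : 0 ≤ δ) (A : Matrix S T ℝ) :
    regSqrt δ A * regSqrt δ A = A * Aᵀ + δ • 1 :=
  sqrt_mul_sqrt_of_posSemidef (posSemidef_regularized hδ A)

theorem isUnit_det_regSqrt {δ : ℝ} (hδ : 0 < δ) (A : Matrix S T ℝ) :
    IsUnit (regSqrt δ A).det := by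
  have h1 := posSemidef_self_mul_conjTranspose A
  rw [conjTranspose_eq_transpose_of_trivial] at h1
  have h2 : (A * Aᵀ + δ • 1).PosDef := PosDef.posSemidef_add h1 (PosDef.one.smul hδ)
  have h3 := h2.det_pos
  rw [← regSqrt_mul_self hδ.le, det_mul] at h3
  exact isUnit_iff_ne_zero.2 fun h => by simp [h] at h3

theorem regSqrt_mulVec_standardize {δ : ℝ} (hδ : 0 < δ) (A : Matrix S T ℝ) (w : T → ℝ)
    (g : S → ℝ) : regSqrt δ A *ᵥ standardize δ A w g = A *ᵥ w + √δ • g := by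
  rw [standardize, mulVec_mulVec, mul_nonsing_inv _ (isUnit_det_regSqrt hδ A), one_mulVec]

theorem measurable_regSqrt {X : Type*} [MeasurableSpace X] {A : X → Matrix S T ℝ}
    (hA : ∀ s t, Measurable fun x => A x s t) {δ : ℝ} (hδ : 0 ≤ δ) (s s' : S) :
    Measurable fun x => regSqrt δ (A x) s s' := by
  have h1 : Continuous fun B : S → T → ℝ => regSqrt δ (of B) s s' := by
    refine continuous_sqrt_apply ?_ (fun B => posSemidef_regularized hδ _) s s'
    have : Continuous fun B : S → T → ℝ => of B := continuous_id
    exact (this.matrix_mul this.matrix_transpose).add continuous_const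
  exact h1.measurable.comp (measurable_pi_lambda _ fun s => measurable_pi_lambda _ fun t => hA s t)

theorem measurable_standardize {X : Type*} [MeasurableSpace X] {A : X → Matrix S T ℝ}
    (hA : ∀ s t, Measurable fun x => A x s t) {δ : ℝ} (hδ : 0 ≤ δ) {w : X → T → ℝ} {g : X → S → ℝ}
    (hw : Measurable w) (hg : Measurable g) :
    Measurable fun x => standardize δ (A x) (w x) (g x) := by
  have h1 : Continuous fun B : (S → S → ℝ) × (S → ℝ) => (of B.1).det := by
    have : Continuous fun B : (S → S → ℝ) × (S → ℝ) => of B.1 := continuous_fst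
    exact this.matrix_det
  have h2 : Continuous fun B : (S → S → ℝ) × (S → ℝ) => (of B.1).adjugate *ᵥ B.2 := by
    have : Continuous fun B : (S → S → ℝ) × (S → ℝ) => of B.1 := continuous_fst
    exact this.matrix_adjugate.matrix_mulVec continuous_snd
  have h3 : Measurable fun B : (S → S → ℝ) × (S → ℝ) =>
      ((of B.1).det)⁻¹ • ((of B.1).adjugate *ᵥ B.2) := h1.measurable.inv.smul h2.measurable
  have hR : Measurable fun x s s' => regSqrt δ (A x) s s' :=
    measurable_pi_lambda _ fun s => measurable_pi_lambda _ fun s' => measurable_regSqrt hA hδ s s'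
  have hv : Measurable fun x => A x *ᵥ w x + √δ • g x := by
    refine measurable_pi_lambda _ fun s => ?_
    simp only [Pi.add_apply, Pi.smul_apply, mulVec, dotProduct, smul_eq_mul]
    exact (Finset.measurable_sum _ fun t _ => (hA s t).mul ((measurable_pi_apply t).comp hw)).add
      (((measurable_pi_apply s).comp hg).const_mul _)
  convert h3.comp (hR.prodMk hv) using 1
  funext x
  simp only [standardize, inv_def, Ring.inverse_eq_inv', Function.comp_apply, smul_mulVec]
  rfl

/-- The standardized vector is standard normal for every matrix `A`, whence its independence of a
random `A` that is independent of `w` and `g`. -/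
theorem map_standardize {δ : ℝ} (hδ : 0 < δ) (A : Matrix S T ℝ) :
    ((Measure.pi fun _ : T => gaussianReal 0 1).prod
      (Measure.pi fun _ : S => gaussianReal 0 1)).map (fun x => standardize δ A x.1 x.2) =
      Measure.pi fun _ : S => gaussianReal 0 1 := by
  set L : Matrix S (T ⊕ S) ℝ := (regSqrt δ A)⁻¹ * fromCols A (√δ • 1) with hLdef
  have hRt : (regSqrt δ A)ᵀ = regSqrt δ A := transpose_sqrt _
  have hdet := isUnit_det_regSqrt hδ A
  have hL : L * Lᵀ = 1 := by
    have h1 : fromCols A (√δ • (1 : Matrix S S ℝ)) * (fromCols A (√δ • (1 : Matrix S S ℝ)))ᵀ =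
        regSqrt δ A * regSqrt δ A := by
      rw [regSqrt_mul_self hδ.le, transpose_fromCols, fromCols_mul_fromRows]
      simp only [transpose_smul, transpose_one, smul_mul_smul_comm, mul_one,
        Real.mul_self_sqrt hδ.le]
    calc L * Lᵀ = (regSqrt δ A)⁻¹ * (fromCols A (√δ • (1 : Matrix S S ℝ)) *
          (fromCols A (√δ • (1 : Matrix S S ℝ)))ᵀ) * (regSqrt δ A)⁻¹ᵀ := by
          rw [hLdef, transpose_mul]; simp only [Matrix.mul_assoc]
      _ = 1 := by
          rw [h1, transpose_nonsing_inv, hRt, ← Matrix.mul_assoc, nonsing_inv_mul _ hdet,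
            Matrix.one_mul, mul_nonsing_inv _ hdet]
  have h2 := map_mulVec_pi_gaussianReal L hL
  have h3 := measurePreserving_sumPiEquivProdPi_symm (X := fun _ : T ⊕ S => ℝ)
    (fun _ => gaussianReal 0 1)
  have hm : Measurable fun x : T ⊕ S → ℝ => L *ᵥ x :=
    (continuous_const.matrix_mulVec continuous_id).measurable
  rw [← h3.map_eq, Measure.map_map hm h3.measurable] at h2
  refine Eq.trans (congrArg (fun F => Measure.map F _) ?_) h2
  funext x
  simp only [Function.comp_apply, standardize, hLdef, ← mulVec_mulVec]
  congr 1
  have : ((MeasurableEquiv.sumPiEquivProdPi fun _ : T ⊕ S => ℝ).symm x) = Sum.elim x.1 x.2 := by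
    funext i
    cases i <;> rfl
  rw [this, fromCols_mulVec_sumElim, smul_mulVec, one_mulVec]

end Standardization

/-! ### The empirical covariance matrix of a bounded sample -/

section EmpiricalCovariance

open Matrix

variable {𝒱 : Type*} [MeasurableSpace 𝒱] {P : Measure 𝒱} [IsProbabilityMeasure P]

theorem integral_sq_empirical_sub {g : 𝒱 → ℝ} (hg : MemLp g 2 P) {n : ℕ} (hn : 0 < n) :
    ∫ v : Fin n → 𝒱, ((1 / (n : ℝ)) * ∑ i, g (v i) - ∫ u, g u ∂P) ^ 2 ∂(Measure.pi fun _ => P) =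
      variance g P / n := by
  have hn' : (n : ℝ) ≠ 0 := by positivity
  have h1 := variance_sum_pi (μ := fun _ : Fin n => P) (X := fun _ => g) fun _ => hg
  have hmp : ∀ i : Fin n, MeasurePreserving (fun v : Fin n → 𝒱 => v i) (Measure.pi fun _ => P) P :=
    fun i => measurePreserving_eval (fun _ => P) i
  have hm : ∀ i : Fin n, MemLp (fun v : Fin n → 𝒱 => g (v i)) 2 (Measure.pi fun _ => P) := fun i =>
    hg.comp_measurePreserving (hmp i)
  have hsum : AEMeasurable (∑ i : Fin n, fun v : Fin n → 𝒱 => g (v i)) (Measure.pi fun _ => P) :=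
    (memLp_finsetSum' _ fun i _ => hm i).1.aemeasurable
  have hint : ∫ v : Fin n → 𝒱, (∑ i, fun v : Fin n → 𝒱 => g (v i)) v ∂(Measure.pi fun _ => P) =
      n * ∫ u, g u ∂P := by
    simp only [Finset.sum_apply]
    rw [integral_finsetSum _ fun i _ => (hm i).integrable one_le_two]
    have : ∀ i : Fin n, ∫ v : Fin n → 𝒱, g (v i) ∂(Measure.pi fun _ => P) = ∫ u, g u ∂P :=
      fun i => by
        have := (hmp i).map_eq
        conv_rhs => rw [← this]
        rw [integral_map (hmp i).measurable.aemeasurable (by rw [this]; exact hg.1)]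
    simp [this]
  rw [variance_eq_integral hsum, hint] at h1
  simp only [Finset.sum_apply, Finset.sum_const, Finset.card_univ, Fintype.card_fin,
    nsmul_eq_mul] at h1
  have h2 : ∀ v : Fin n → 𝒱, ((1 / (n : ℝ)) * ∑ i, g (v i) - ∫ u, g u ∂P) ^ 2 =
      (1 / (n : ℝ) ^ 2) * (∑ i, g (v i) - n * ∫ u, g u ∂P) ^ 2 := fun v => by
    field_simp
  simp_rw [h2]
  rw [integral_const_mul, h1]
  field_simp

/-- Chebyshev's inequality for the sum of squared errors of finitely many sample means. -/
theorem measure_sum_sq_empirical_gt_le {I : Type*} [Fintype I] {g : I → 𝒱 → ℝ}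
    (hg : ∀ s, MemLp (g s) 2 P) {C t : ℝ} (hC : ∀ s, ∫ u, g s u ^ 2 ∂P ≤ C) {n : ℕ} (hn : 0 < n)
    (ht : 0 < t) :
    (Measure.pi fun _ => P) {v : Fin n → 𝒱 |
        t < ∑ s, ((1 / (n : ℝ)) * ∑ i, g s (v i) - ∫ u, g s u ∂P) ^ 2} ≤
      ENNReal.ofReal (Fintype.card I * C / (n * t)) := by
  set X : (Fin n → 𝒱) → ℝ := fun v =>
    ∑ s, ((1 / (n : ℝ)) * ∑ i, g s (v i) - ∫ u, g s u ∂P) ^ 2 with hX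
  have hm : ∀ s (i : Fin n), MemLp (fun v : Fin n → 𝒱 => g s (v i)) 2 (Measure.pi fun _ => P) :=
    fun s i => (hg s).comp_measurePreserving (measurePreserving_eval (fun _ => P) i)
  have hm2 : ∀ s, MemLp (fun v : Fin n → 𝒱 => (1 / (n : ℝ)) * ∑ i, g s (v i) - ∫ u, g s u ∂P) 2
      (Measure.pi fun _ => P) := fun s => by
    have h1 : MemLp (fun v : Fin n → 𝒱 => ∑ i, g s (v i)) 2 (Measure.pi fun _ => P) :=
      memLp_finsetSum _ fun i _ => hm s i
    exact (h1.const_mul _).sub (memLp_const _)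
  have hXi : Integrable X (Measure.pi fun _ => P) :=
    integrable_finsetSum _ fun s _ => (hm2 s).integrable_sq
  have hX0 : ∀ v, 0 ≤ X v := fun v => Finset.sum_nonneg fun s _ => sq_nonneg _
  have hEX : ∫ v, X v ∂(Measure.pi fun _ => P) ≤ Fintype.card I * C / n := by
    rw [hX, integral_finsetSum _ fun s _ => (hm2 s).integrable_sq]
    simp_rw [integral_sq_empirical_sub (hg _) hn]
    calc _ ≤ ∑ s : I, C / n := Finset.sum_le_sum fun s _ => by
          have h1 := variance_le_expectation_sq (hg s).1
          simp only [Pi.pow_apply] at h1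
          have := h1.trans (hC s)
          gcongr
      _ = _ := by simp [mul_div_assoc]
  have h1 := mul_meas_ge_le_integral_of_nonneg (ae_of_all _ hX0) hXi t
  have h2 : (Measure.pi fun _ => P).real {v | t ≤ X v} ≤ Fintype.card I * C / (n * t) := by
    rw [div_mul_eq_div_div, le_div_iff₀ ht, mul_comm]
    exact h1.trans hEX
  calc _ ≤ (Measure.pi fun _ => P) {v | t ≤ X v} := measure_mono fun v (hv : t < X v) => hv.le
    _ = ENNReal.ofReal ((Measure.pi fun _ => P).real {v | t ≤ X v}) :=
        (ENNReal.ofReal_toReal (measure_ne_top _ _)).symm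
    _ ≤ _ := ENNReal.ofReal_le_ofReal h2

variable {S : Type*}

/-- The vector `x` centred at its mean. -/
noncomputable def centred (P : Measure 𝒱) (x : 𝒱 → S → ℝ) (v : 𝒱) (s : S) : ℝ :=
  x v s - ∫ u, x u s ∂P

/-- The covariance matrix of the vector `x`. -/
noncomputable def covMatrix (P : Measure 𝒱) (x : 𝒱 → S → ℝ) : Matrix S S ℝ :=
  of fun s t => ∫ v, centred P x v s * centred P x v t ∂P

/-- The matrix with columns `n^{-1/2} (x (v i) - x̄)`, where `x̄` is the sample mean. It maps the
weights to the multiplier process evaluated at the coordinates of `x`. -/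
noncomputable def scoreMatrix {n : ℕ} (x : 𝒱 → S → ℝ) (v : Fin n → 𝒱) : Matrix S (Fin n) ℝ :=
  of fun s i => (1 / √(n : ℝ)) * (x (v i) s - (1 / (n : ℝ)) * ∑ l, x (v l) s)

omit [MeasurableSpace 𝒱] in
theorem scoreMatrix_mulVec {n : ℕ} (x : 𝒱 → S → ℝ) (v : Fin n → 𝒱) (w : Fin n → ℝ) (s : S) :
    (scoreMatrix x v *ᵥ w) s = multiplier w v fun u => x u s := by
  simp only [scoreMatrix, mulVec, dotProduct, of_apply, multiplier, Finset.mul_sum]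
  refine Finset.sum_congr rfl fun i _ => ?_
  ring

omit [IsProbabilityMeasure P] in
/-- The empirical covariance matrix is the empirical second moment matrix of the centred vectors
minus the rank one matrix of the error of the sample mean. -/
theorem scoreMatrix_mul_transpose {n : ℕ} (hn : 0 < n) (x : 𝒱 → S → ℝ) (v : Fin n → 𝒱) (s t : S) :
    (scoreMatrix x v * (scoreMatrix x v)ᵀ) s t =
      (1 / (n : ℝ)) * ∑ i, centred P x (v i) s * centred P x (v i) t -
        ((1 / (n : ℝ)) * ∑ i, x (v i) s - ∫ u, x u s ∂P) *
          ((1 / (n : ℝ)) * ∑ i, x (v i) t - ∫ u, x u t ∂P) := by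
  have hn' : (n : ℝ) ≠ 0 := by positivity
  have hsq : (1 / √(n : ℝ)) * (1 / √(n : ℝ)) = 1 / n := by
    rw [div_mul_div_comm, one_mul, Real.mul_self_sqrt (Nat.cast_nonneg n)]
  simp only [mul_apply, scoreMatrix, of_apply, transpose_apply, centred]
  set a := ∑ i, x (v i) s
  set b := ∑ i, x (v i) t
  have h1 : ∀ c e : ℝ, ∑ i, (x (v i) s - c) * (x (v i) t - e) =
      ∑ i, x (v i) s * x (v i) t - e * a - c * b + n * (c * e) := fun c e => by
    have : ∀ i, (x (v i) s - c) * (x (v i) t - e) =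
        x (v i) s * x (v i) t - e * x (v i) s - c * x (v i) t + c * e := fun i => by ring
    simp_rw [this]
    simp [Finset.sum_add_distrib, Finset.sum_sub_distrib, ← Finset.mul_sum, a, b]
  have h2 : ∀ i, 1 / √(n : ℝ) * (x (v i) s - 1 / n * a) * (1 / √(n : ℝ) * (x (v i) t - 1 / n * b)) =
      1 / n * ((x (v i) s - 1 / n * a) * (x (v i) t - 1 / n * b)) := fun i => by
    rw [← hsq]; ring
  simp_rw [h2]
  rw [← Finset.mul_sum, h1, h1]
  field_simp
  ring

omit [IsProbabilityMeasure P] in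
theorem integral_sq_sum_eq_dotProduct [Fintype S] {x : S → 𝒱 → ℝ} (hx : ∀ s, MemLp (x s) 2 P) (u : S → ℝ) :
    ∫ v, (∑ s, u s * x s v) ^ 2 ∂P =
      u ⬝ᵥ (of fun s t => ∫ v, x s v * x t v ∂P : Matrix S S ℝ) *ᵥ u := by
  have h2 : ∀ v, (∑ s, u s * x s v) ^ 2 = ∑ s, ∑ t, u s * u t * (x s v * x t v) := fun v => by
    rw [pow_two, Finset.sum_mul_sum]
    refine Finset.sum_congr rfl fun s _ => Finset.sum_congr rfl fun t _ => ?_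
    ring
  have hi : ∀ s t, Integrable (fun v => x s v * x t v) P := fun s t =>
    (hx s).integrable_mul (hx t)
  simp_rw [h2]
  rw [integral_finsetSum _ fun s _ => integrable_finsetSum _ fun t _ => (hi s t).const_mul _]
  simp_rw [integral_finsetSum _ fun t _ => (hi _ t).const_mul _, integral_const_mul]
  simp only [dotProduct, mulVec, of_apply, Finset.mul_sum]
  refine Finset.sum_congr rfl fun s _ => Finset.sum_congr rfl fun t _ => ?_
  ring

variable {x : 𝒱 → S → ℝ} {b c : ℝ}

theorem memLp_of_bounded (hxm : ∀ s, Measurable fun v => x v s) (hxb : ∀ v s, |x v s| ≤ b) (s : S)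
    (p : ℝ≥0∞) : MemLp (fun v => x v s) p P :=
  MemLp.of_bound (hxm s).aestronglyMeasurable b (ae_of_all _ fun v => hxb v s)

theorem abs_centred_le (hxb : ∀ v s, |x v s| ≤ b) (v : 𝒱) (s : S) : |centred P x v s| ≤ 2 * b := by
  have h1 : |∫ u, x u s ∂P| ≤ b := by
    have := norm_integral_le_of_norm_le_const (μ := P) (f := fun u => x u s) (C := b)
      (ae_of_all _ fun v => hxb v s)
    simpa using this
  calc _ ≤ |x v s| + |∫ u, x u s ∂P| := abs_sub _ _
    _ ≤ _ := by linarith [hxb v s]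

omit [IsProbabilityMeasure P] in
theorem measurable_centred (hxm : ∀ s, Measurable fun v => x v s) : Measurable (centred P x) :=
  measurable_pi_lambda _ fun s => (hxm s).sub_const _

omit [IsProbabilityMeasure P] in
theorem secondMoment_map_centred (hxm : ∀ s, Measurable fun v => x v s) :
    secondMoment (P.map (centred P x)) = covMatrix P x := by
  ext s t
  simp only [secondMoment, covMatrix, of_apply]
  rw [integral_map (measurable_centred hxm).aemeasurable (by fun_prop)]

variable [Fintype S]

theorem dotProduct_covMatrix_mulVec (hxm : ∀ s, Measurable fun v => x v s)
    (hxb : ∀ v s, |x v s| ≤ b) (u : S → ℝ) :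
    u ⬝ᵥ covMatrix P x *ᵥ u = ∫ v, (∑ s, u s * centred P x v s) ^ 2 ∂P :=
  (integral_sq_sum_eq_dotProduct (x := fun s v => centred P x v s)
    (fun s => (memLp_of_bounded hxm hxb s 2).sub (memLp_const _)) u).symm

theorem dotProduct_covMatrix_mulVec_le (hxm : ∀ s, Measurable fun v => x v s)
    (hxb : ∀ v s, |x v s| ≤ b) (hc : ∀ u : S → ℝ, ∫ v, (∑ s, u s * x v s) ^ 2 ∂P ≤ c * (u ⬝ᵥ u))
    (u : S → ℝ) : u ⬝ᵥ covMatrix P x *ᵥ u ≤ c * (u ⬝ᵥ u) := by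
  refine le_trans ?_ (hc u)
  set g : 𝒱 → ℝ := fun v => ∑ s, u s * x v s with hgdef
  have hg : MemLp g 2 P := memLp_finsetSum _ fun s _ => (memLp_of_bounded hxm hxb s 2).const_mul _
  have hmean : ∫ v, g v ∂P = ∑ s, u s * ∫ v, x v s ∂P := by
    rw [hgdef, integral_finsetSum _ fun s _ =>
      ((memLp_of_bounded hxm hxb s 2).integrable one_le_two).const_mul _]
    simp_rw [integral_const_mul]
  have h1 := variance_le_expectation_sq hg.1
  rw [variance_eq_integral hg.1.aemeasurable, hmean] at h1
  refine le_trans (le_of_eq ?_) h1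
  rw [dotProduct_covMatrix_mulVec hxm hxb]
  refine integral_congr_ae (ae_of_all _ fun v => ?_)
  simp only [hgdef, centred, mul_sub, Finset.sum_sub_distrib]

theorem posSemidef_covMatrix (hxm : ∀ s, Measurable fun v => x v s) (hxb : ∀ v s, |x v s| ≤ b) :
    (covMatrix P x).PosSemidef := by
  refine PosSemidef.of_dotProduct_mulVec_nonneg ?_ fun u => ?_
  · rw [← secondMoment_map_centred hxm]
    exact secondMoment_isHermitian _
  · rw [star_trivial, dotProduct_covMatrix_mulVec hxm hxb]
    exact integral_nonneg fun v => sq_nonneg _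

end EmpiricalCovariance

section CovarianceEvents

open Matrix

variable {𝒱 : Type*} [MeasurableSpace 𝒱] {P : Measure 𝒱} [IsProbabilityMeasure P]
  {S : Type*} [Fintype S] {x : 𝒱 → S → ℝ} {b c : ℝ}

/-- The order `b √(d (log d + 1) / n)` of the error of the empirical covariance matrix of `n`
vectors in dimension `d` with coordinates bounded by `b`. -/
noncomputable def covRate (b : ℝ) (d n : ℕ) : ℝ := b * √(d * (Real.log d + 1) / n)

theorem covRate_pos (hb : 1 ≤ b) {d n : ℕ} (hd : 0 < d) (hn : 0 < n) : 0 < covRate b d n := by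
  have h1 : 0 ≤ Real.log d := Real.log_natCast_nonneg d
  unfold covRate
  positivity

theorem covRate_sq {d n : ℕ} : covRate b d n ^ 2 = b ^ 2 * (d * (Real.log d + 1) / n) := by
  have h1 : 0 ≤ Real.log d := Real.log_natCast_nonneg d
  rw [covRate, mul_pow, Real.sq_sqrt (by positivity)]

theorem div_le_covRate_sq (hb : 1 ≤ b) {d n : ℕ} : (d : ℝ) / n ≤ covRate b d n ^ 2 := by
  have h1 : 0 ≤ Real.log d := Real.log_natCast_nonneg d
  have h2 : (d : ℝ) ≤ d * (Real.log d + 1) := le_mul_of_one_le_right (by positivity) (by linarith)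
  have h3 : (d : ℝ) / n ≤ d * (Real.log d + 1) / n := by gcongr
  rw [covRate_sq]
  exact h3.trans (le_mul_of_one_le_left (by positivity) (by nlinarith))

omit [IsProbabilityMeasure P] in
theorem secondMoment_coord_le [DecidableEq S]
    (hc : ∀ u : S → ℝ, ∫ v, (∑ s, u s * x v s) ^ 2 ∂P ≤ c * (u ⬝ᵥ u)) (s : S) :
    ∫ v, x v s ^ 2 ∂P ≤ c := by
  have h := hc (Pi.single s 1)
  simpa [Pi.single_apply] using h

/-- Outside an event of small probability, the empirical covariance matrix is close to the
covariance matrix in operator norm, provided that the rate is at most one. -/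
theorem measure_scoreMatrix_cov_gt_le [DecidableEq S] [Nonempty S]
    (hxm : ∀ s, Measurable fun v => x v s) (hxb : ∀ v s, |x v s| ≤ b) (hb : 1 ≤ b) (hc1 : 1 ≤ c)
    (hc : ∀ u : S → ℝ, ∫ v, (∑ s, u s * x v s) ^ 2 ∂P ≤ c * (u ⬝ᵥ u)) {n : ℕ} (hn : 0 < n)
    (hz : covRate b (Fintype.card S) n ≤ 1) {K : ℝ} (hK : 1 ≤ K) :
    (Measure.pi fun _ => P) {v : Fin n → 𝒱 | ∃ u : S → ℝ,
        31 * K ^ 2 * c * covRate b (Fintype.card S) n * (u ⬝ᵥ u) <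
          |u ⬝ᵥ (scoreMatrix x v * (scoreMatrix x v)ᵀ - covMatrix P x) *ᵥ u|} ≤
      ENNReal.ofReal (2 / K ^ 2) := by
  set d := Fintype.card S with hd
  have hd0 : 0 < d := Fintype.card_pos
  set z := covRate b d n with hzdef
  have hz0 : 0 < z := covRate_pos hb hd0 hn
  have hnR : (0 : ℝ) < n := by exact_mod_cast hn
  have hlog : 0 ≤ Real.log d := Real.log_natCast_nonneg d
  set Q := P.map (centred P x) with hQ
  have hQm := measurable_centred (P := P) hxm
  have : IsProbabilityMeasure Q := Measure.isProbabilityMeasure_map hQm.aemeasurable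
  -- The sample mean contributes the rank one matrix `x̄ x̄ᵀ`, of trace `O(d / n)`.
  have hE1 := measure_sum_sq_empirical_gt_le (P := P) (g := fun s v => x v s)
    (fun s => memLp_of_bounded hxm hxb s 2) (secondMoment_coord_le hc) hn
    (t := K ^ 2 * c * z) (by positivity)
  have hE1' : Fintype.card S * c / (n * (K ^ 2 * c * z)) ≤ 1 / K ^ 2 := by
    have h1 : (d : ℝ) / n ≤ z := by
      refine (div_le_covRate_sq hb).trans ?_
      rw [pow_two]
      exact mul_le_of_le_one_left hz0.le hz
    rw [← hd, div_le_div_iff₀ (by positivity) (by positivity)]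
    rw [div_le_iff₀ hnR] at h1
    have h2 : 0 ≤ c * K ^ 2 := by positivity
    nlinarith [mul_le_mul_of_nonneg_right h1 h2]
  -- The moment bound with exponent of order `log d + 1`, for vectors of squared norm at most `4 d b²`.
  set p := ⌈Real.log d + 1⌉₊ with hp
  have hp1 : Real.log d + 1 ≤ p := Nat.le_ceil _
  have hp2 : (p : ℝ) ≤ 2 * (Real.log d + 1) := by
    have := Nat.ceil_lt_add_one (show 0 ≤ Real.log d + 1 by positivity)
    linarith
  have hE2 := measure_momentError_gt_le (Q := Q) (b := 2 * b) (L := 4 * (d * b ^ 2)) (c := c) hn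
    (by
      rw [hQ, ae_map_iff hQm.aemeasurable (by
        have : {y : S → ℝ | ∀ s, |y s| ≤ 2 * b} = ⋂ s, {y | |y s| ≤ 2 * b} := by ext; simp
        rw [this]
        exact MeasurableSet.iInter fun s => measurableSet_le (by fun_prop) (by fun_prop))]
      exact ae_of_all _ fun v s => abs_centred_le hxb v s)
    (by
      rw [hQ, ae_map_iff hQm.aemeasurable (by
        simp only [dotProduct]
        exact measurableSet_le (by fun_prop) (by fun_prop))]
      refine ae_of_all _ fun v => ?_
      simp only [dotProduct]
      calc _ ≤ ∑ s : S, (2 * b) ^ 2 := Finset.sum_le_sum fun s _ => by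
            rw [← pow_two]
            exact sq_le_sq' (by linarith [abs_le.1 (abs_centred_le (P := P) hxb v s)])
              (abs_le.1 (abs_centred_le hxb v s)).2
        _ = _ := by simp [← hd]; ring)
    (by positivity)
    (by
      rw [hQ, secondMoment_map_centred hxm]
      exact dotProduct_covMatrix_mulVec_le hxm hxb hc)
    (by positivity) (p := p) (by
      have : (0 : ℝ) < p := by linarith
      exact_mod_cast this.ne')
    (by
      rw [← hd, ← Real.log_le_iff_le_exp (by positivity)]
      linarith) hK (t := 30 * K * c * z) (by positivity) (by
      have h1 : 2 * p * (4 * (d * b ^ 2)) / n ≤ 16 * z ^ 2 := by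
        rw [hzdef, covRate_sq, div_le_iff₀ hnR]
        have : 16 * (b ^ 2 * (d * (Real.log d + 1) / n)) * n =
          16 * (b ^ 2 * (d * (Real.log d + 1))) := by field_simp
        rw [this]
        nlinarith [mul_le_mul_of_nonneg_right hp2 (show 0 ≤ d * b ^ 2 by positivity)]
      have h0 : 0 ≤ 2 * p * (4 * (d * b ^ 2)) / (n : ℝ) := by positivity
      set a := 2 * p * (4 * (d * b ^ 2)) / (n : ℝ)
      have hzz : z ^ 2 ≤ 1 := by nlinarith
      have h2 : a ^ 2 + 4 * a * c ≤ 320 * c ^ 2 * z ^ 2 := by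
        have e1 : a ^ 2 ≤ (16 * z ^ 2) * (16 * z ^ 2) := by
          rw [pow_two]; exact mul_le_mul h1 h1 h0 (by positivity)
        have e2 : (16 * z ^ 2) * (16 * z ^ 2) ≤ 256 * z ^ 2 := by nlinarith [sq_nonneg z]
        have e3 : 4 * a * c ≤ 64 * z ^ 2 * c := by nlinarith
        have e4 : z ^ 2 * c ≤ z ^ 2 * c ^ 2 :=
          mul_le_mul_of_nonneg_left (by nlinarith) (sq_nonneg z)
        have e5 : z ^ 2 ≤ z ^ 2 * c ^ 2 := by
          nlinarith [mul_le_mul_of_nonneg_left (show 1 ≤ c ^ 2 by nlinarith) (sq_nonneg z)]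
        nlinarith
      have h3 : Real.exp 1 ≤ 2.8 := by linarith [Real.exp_one_lt_d9]
      calc Real.exp 1 * K ^ 2 * (a ^ 2 + 4 * a * c)
          ≤ 2.8 * K ^ 2 * (320 * c ^ 2 * z ^ 2) := by gcongr
        _ ≤ _ := by
          have : 0 ≤ K ^ 2 * (c ^ 2 * z ^ 2) := by positivity
          nlinarith)
  have hpi := Measure.pi_map_pi (μ := fun _ : Fin n => P) (f := fun _ => centred P x)
    (hμ := fun _ => by rw [← hQ]; infer_instance) fun _ => hQm.aemeasurable
  rw [← hQ] at hpi
  rw [← hpi] at hE2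
  have hE2' := (Measure.le_map_apply (μ := Measure.pi fun _ : Fin n => P)
    (f := fun v i => centred P x (v i))
    (measurable_pi_lambda _ fun i => hQm.comp (measurable_pi_apply i)).aemeasurable _).trans hE2
  refine le_trans (measure_mono ?_) (le_trans (measure_union_le _ _) (le_trans (add_le_add hE2'
    (hE1.trans (ENNReal.ofReal_le_ofReal hE1'))) (le_of_eq ?_)))
  · rintro v ⟨u, hu⟩
    by_contra hv
    simp only [Set.mem_union, Set.mem_preimage, Set.mem_ofPred_eq, not_or, not_exists, not_lt] at hv
    set ybar : S → ℝ := fun s => (1 / (n : ℝ)) * ∑ i, x (v i) s - ∫ u, x u s ∂P with hy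
    have hdec : scoreMatrix x v * (scoreMatrix x v)ᵀ - covMatrix P x =
        momentError Q (fun i => centred P x (v i)) - vecMulVec ybar ybar := by
      ext s t
      rw [Matrix.sub_apply, scoreMatrix_mul_transpose (P := P) hn, momentError,
        secondMoment_map_centred hxm]
      simp only [Matrix.sub_apply, Matrix.smul_apply, Matrix.sum_apply, vecMulVec_apply, hy,
        smul_eq_mul]
      ring
    have h1 := hv.1 u
    have h2 : (u ⬝ᵥ ybar) ^ 2 ≤ (K ^ 2 * c * z) * (u ⬝ᵥ u) := by
      have h3 := Finset.sum_mul_sq_le_sq_mul_sq Finset.univ u ybar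
      have h4 : ∑ s, u s ^ 2 = u ⬝ᵥ u := by simp [dotProduct, pow_two]
      rw [h4] at h3
      have h5 : 0 ≤ u ⬝ᵥ u := by rw [← h4]; positivity
      calc _ ≤ (u ⬝ᵥ u) * ∑ s, ybar s ^ 2 := h3
        _ ≤ (u ⬝ᵥ u) * (K ^ 2 * c * z) := mul_le_mul_of_nonneg_left hv.2 h5
        _ = _ := mul_comm _ _
    have h6 : u ⬝ᵥ vecMulVec ybar ybar *ᵥ u = (u ⬝ᵥ ybar) ^ 2 := by
      rw [vecMulVec_mulVec, dotProduct_smul, dotProduct_comm ybar u]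
      simp [pow_two]
    rw [hdec, sub_mulVec, dotProduct_sub, h6] at hu
    have h7 : 0 ≤ u ⬝ᵥ u := by
      simp only [dotProduct]; exact Finset.sum_nonneg fun s _ => mul_self_nonneg _
    have h8 : 30 * K * c * z * (u ⬝ᵥ u) ≤ 30 * K ^ 2 * c * z * (u ⬝ᵥ u) := by
      have : K ≤ K ^ 2 := by nlinarith
      gcongr
    have h9 := abs_sub (u ⬝ᵥ momentError Q (fun i => centred P x (v i)) *ᵥ u) ((u ⬝ᵥ ybar) ^ 2)
    rw [abs_of_nonneg (sq_nonneg (u ⬝ᵥ ybar))] at h9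
    nlinarith
  · rw [← ENNReal.ofReal_add (by positivity) (by positivity)]
    congr 1
    ring

/-- Outside an event of small probability, the diagonal of the empirical covariance matrix is
bounded by the rate, provided that the rate is at least one. -/
theorem measure_scoreMatrix_diag_gt_le [Nonempty S]
    (hxm : ∀ s, Measurable fun v => x v s) (hxb : ∀ v s, |x v s| ≤ b) (hb : 1 ≤ b) (hc1 : 1 ≤ c)
    (hc : ∀ u : S → ℝ, ∫ v, (∑ s, u s * x v s) ^ 2 ∂P ≤ c * (u ⬝ᵥ u)) {n : ℕ} (hn : 0 < n)
    (hz : 1 ≤ covRate b (Fintype.card S) n) {K : ℝ} (hK : 1 ≤ K) :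
    (Measure.pi fun _ => P) {v : Fin n → 𝒱 | ∃ s : S,
        5 * K * c * covRate b (Fintype.card S) n <
          (scoreMatrix x v * (scoreMatrix x v)ᵀ) s s} ≤ ENNReal.ofReal (1 / K ^ 2) := by
  classical
  set d := Fintype.card S with hd
  have hd0 : 0 < d := Fintype.card_pos
  set z := covRate b d n with hzdef
  have hz0 : 0 < z := covRate_pos hb hd0 hn
  have hnR : (0 : ℝ) < n := by exact_mod_cast hn
  have hlog : 0 ≤ Real.log d := Real.log_natCast_nonneg d
  have hcm : ∀ s, Measurable fun v => centred P x v s := fun s =>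
    (measurable_pi_apply s).comp (measurable_centred hxm)
  have hsqb : ∀ v s, |centred P x v s ^ 2| ≤ 4 * b ^ 2 := fun v s => by
    rw [abs_pow, sq_abs, ← sq_abs]
    have := abs_centred_le (P := P) hxb v s
    nlinarith [abs_nonneg (centred P x v s)]
  have hvar : ∀ s, ∫ v, centred P x v s ^ 2 ∂P ≤ c := fun s => by
    have h1 := dotProduct_covMatrix_mulVec_le hxm hxb hc (Pi.single s 1)
    rw [mulVec_single_one, single_one_dotProduct, single_one_dotProduct, Pi.single_eq_same,
      mul_one] at h1
    simpa [covMatrix, pow_two] using h1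
  have hmem : ∀ s p, MemLp (fun v => centred P x v s ^ 2) p P := fun s p =>
    MemLp.of_bound ((hcm s).pow_const 2).aestronglyMeasurable (4 * b ^ 2)
      (ae_of_all _ fun v => hsqb v s)
  -- Chebyshev's inequality suffices: `d b² / n` is at most the square of the rate.
  have hE := measure_sum_sq_empirical_gt_le (P := P) (g := fun s v => centred P x v s ^ 2)
    (fun s => hmem s 2) (C := 4 * b ^ 2 * c) (fun s => by
      calc ∫ v, (centred P x v s ^ 2) ^ 2 ∂P ≤ ∫ v, 4 * b ^ 2 * centred P x v s ^ 2 ∂P := by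
            refine integral_mono (hmem s 2).integrable_sq
              (((hmem s 1).integrable le_rfl).const_mul _) fun v => ?_
            simp only
            rw [pow_two (centred P x v s ^ 2)]
            exact mul_le_mul_of_nonneg_right ((le_abs_self _).trans (hsqb v s)) (sq_nonneg _)
        _ ≤ _ := by
            rw [integral_const_mul]
            exact mul_le_mul_of_nonneg_left (hvar s) (by positivity)) hn
    (t := 4 * K ^ 2 * c ^ 2 * z ^ 2) (by positivity)
  refine le_trans (measure_mono ?_) (hE.trans (ENNReal.ofReal_le_ofReal ?_))
  · rintro v ⟨s, hs⟩
    simp only [Set.mem_ofPred_eq]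
    by_contra hv
    rw [not_lt] at hv
    have h1 := (Finset.single_le_sum (f := fun s => ((1 / (n : ℝ)) * ∑ i, centred P x (v i) s ^ 2 -
      ∫ u, centred P x u s ^ 2 ∂P) ^ 2) (fun _ _ => sq_nonneg _) (Finset.mem_univ s)).trans hv
    have h2 : (1 / (n : ℝ)) * ∑ i, centred P x (v i) s ^ 2 - ∫ u, centred P x u s ^ 2 ∂P ≤
        2 * K * c * z := by
      refine le_of_sq_le_sq ?_ (by positivity)
      refine h1.trans (le_of_eq ?_)
      ring
    rw [scoreMatrix_mul_transpose (P := P) hn] at hs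
    simp only [← pow_two] at hs
    have h3 : c ≤ K * c * z := by
      have : 1 ≤ K * z := by nlinarith
      nlinarith
    nlinarith [hvar s, sq_nonneg ((1 / (n : ℝ)) * ∑ i, x (v i) s - ∫ u, x u s ∂P)]
  · have h1 : b ^ 2 * (d / n) ≤ z ^ 2 := by
      rw [hzdef, covRate_sq]
      gcongr
      nlinarith [show (0 : ℝ) ≤ d by positivity]
    rw [div_le_div_iff₀ (by positivity) (by positivity), one_mul, ← hd]
    have h2 : b ^ 2 * d ≤ z ^ 2 * n := by
      rw [← mul_div_assoc, div_le_iff₀ hnR] at h1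
      exact h1
    have h3 : 0 ≤ 4 * c * K ^ 2 := by positivity
    have h4 := mul_le_mul_of_nonneg_right h2 h3
    have h5 : z ^ 2 * n * (4 * c * K ^ 2) ≤ c * (z ^ 2 * n * (4 * c * K ^ 2)) :=
      le_mul_of_one_le_left (by positivity) hc1
    nlinarith

end CovarianceEvents

/-! ### Conditional Gaussian bounds given the data -/

section ConditionalBounds

/-- Markov's inequality for a function whose conditional expectation given the first variable is
bounded on an event for that variable. The event need not be measurable. -/
theorem measure_prod_gt_le {α β : Type*} [MeasurableSpace α] [MeasurableSpace β] {π : Measure α}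
    {κ : Measure β} [IsProbabilityMeasure π] [IsProbabilityMeasure κ] {𝒢 : Set α} {q : ℝ≥0∞}
    (hq : π 𝒢ᶜ ≤ q) {F : α × β → ℝ≥0∞} (hF : Measurable F) {M : ℝ≥0∞}
    (hM : ∀ a ∈ 𝒢, ∫⁻ y, F (a, y) ∂κ ≤ M) {l : ℝ≥0∞} (hl : l ≠ 0) (hl' : l ≠ ∞) :
    (π.prod κ) {x | l < F x} ≤ q + M / l := by
  set N := toMeasurable π 𝒢ᶜ with hN
  have hNm : MeasurableSet N := measurableSet_toMeasurable _ _
  have hGm : Measurable fun x : α × β => Nᶜ.indicator (fun _ => F x) x.1 := by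
    have h0 : (fun x : α × β => Nᶜ.indicator (fun _ => F x) x.1) =
        (Prod.fst ⁻¹' Nᶜ).indicator F := by
      funext x
      by_cases hx : x.1 ∈ Nᶜ
      · rw [Set.indicator_of_mem hx, Set.indicator_of_mem (show x ∈ Prod.fst ⁻¹' Nᶜ from hx)]
      · rw [Set.indicator_of_notMem hx,
          Set.indicator_of_notMem (show x ∉ Prod.fst ⁻¹' Nᶜ from hx)]
    rw [h0]
    exact hF.indicator (measurable_fst hNm.compl)
  have h1 : ∫⁻ x, Nᶜ.indicator (fun _ => F x) x.1 ∂(π.prod κ) ≤ M := by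
    rw [lintegral_prod _ hGm.aemeasurable]
    calc _ ≤ ∫⁻ _, M ∂π := lintegral_mono fun a => by
          by_cases ha : a ∈ Nᶜ
          · simp only [Set.indicator_of_mem ha]
            refine hM a ?_
            by_contra h
            exact ha (subset_toMeasurable _ _ h)
          · simp [Set.indicator_of_notMem ha]
      _ = M := by simp
  have h2 : {x : α × β | l < F x} ⊆
      N ×ˢ Set.univ ∪ {x | l ≤ Nᶜ.indicator (fun _ => F x) x.1} := fun x hx => by
    by_cases hx1 : x.1 ∈ N
    · exact Or.inl ⟨hx1, Set.mem_univ _⟩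
    · right
      change l ≤ Nᶜ.indicator (fun _ => F x) x.1
      rw [Set.indicator_of_mem (show x.1 ∈ Nᶜ from hx1)]
      exact le_of_lt hx
  refine (measure_mono h2).trans ((measure_union_le _ _).trans (add_le_add ?_ ?_))
  · rw [Measure.prod_prod, measure_univ, mul_one, hN, measure_toMeasurable]
    exact hq
  · refine (ENNReal.le_div_iff_mul_le (Or.inl hl) (Or.inl hl')).2 ?_
    rw [mul_comm]
    exact (mul_meas_ge_le_lintegral hGm l).trans h1

theorem sqrt_sum_sub_sq_le {T : Type*} [Fintype T] (f g : T → ℝ) :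
    √(∑ t, (f t - g t) ^ 2) ≤ √(∑ t, f t ^ 2) + √(∑ t, g t ^ 2) := by
  have h := norm_sub_le (WithLp.toLp 2 f : EuclideanSpace ℝ T) (WithLp.toLp 2 g)
  simp only [EuclideanSpace.norm_eq] at h
  simpa using h

theorem measurable_expBound {A T α : Type*} [Fintype A] [Fintype T] [MeasurableSpace α] (τ : ℝ)
    {Z : α → A → T → ℝ} (hZ : ∀ i t, Measurable fun x => Z x i t) :
    Measurable fun x => expBound τ (Z x) := by
  unfold expBound
  fun_prop

theorem lintegral_expBound_le_of_map_eq {A T Γ : Type*} [Fintype A] [Fintype T] [MeasurableSpace Γ]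
    {ρ : Measure Γ} [IsProbabilityMeasure ρ] {τ : ℝ} (hτ : 0 < τ) {Z : Γ → A → T → ℝ}
    (hZm : ∀ a j, Measurable fun x => Z x a j)
    (hZ : ∀ a j, ∃ σ ≤ τ ^ 2, ρ.map (fun x => Z x a j) = gaussianReal 0 σ.toNNReal) :
    ∫⁻ x, ENNReal.ofReal (expBound τ (Z x)) ∂ρ ≤
      ENNReal.ofReal (4 * (τ * √(Fintype.card T * logPlus (Fintype.card A)))) := by
  refine lintegral_expBound_le hτ.le hZm fun a j => ?_
  obtain ⟨σ, hσ, h⟩ := hZ a j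
  exact lintegral_exp_sq_le_of_hasLaw h (hZm a j) hτ hσ

/-- If, on an event for the data, two families are conditionally Gaussian with small variances, then
all the blocks of their difference are small with large probability. The two families may be
dependent. -/
theorem measure_block_gt_le {α β A T : Type*} [MeasurableSpace α] [MeasurableSpace β] [Fintype A]
    [Fintype T] [Nonempty T] {π : Measure α} {κ : Measure β} [IsProbabilityMeasure π]
    [IsProbabilityMeasure κ] {𝒢 : Set α} {q : ℝ≥0∞} (hq : π 𝒢ᶜ ≤ q) {Z₁ Z₂ : α × β → A → T → ℝ}
    (hZ₁m : ∀ i t, Measurable fun x => Z₁ x i t) (hZ₂m : ∀ i t, Measurable fun x => Z₂ x i t)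
    {τ₁ τ₂ : ℝ} (hτ₁ : 0 < τ₁) (hτ₂ : 0 < τ₂)
    (hZ₁ : ∀ a ∈ 𝒢, ∀ i t, ∃ σ ≤ τ₁ ^ 2,
      κ.map (fun y => Z₁ (a, y) i t) = gaussianReal 0 σ.toNNReal)
    (hZ₂ : ∀ a ∈ 𝒢, ∀ i t, ∃ σ ≤ τ₂ ^ 2,
      κ.map (fun y => Z₂ (a, y) i t) = gaussianReal 0 σ.toNNReal) {K l : ℝ} (hK : 1 ≤ K)
    (hl : K ^ 2 * (4 * (τ₁ + τ₂) * √(Fintype.card T * logPlus (Fintype.card A))) ≤ l) :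
    (π.prod κ) {x | ∃ i, l < √(∑ t, (Z₁ x i t - Z₂ x i t) ^ 2)} ≤
      q + ENNReal.ofReal (1 / K ^ 2) := by
  set M := 4 * (τ₁ + τ₂) * √(Fintype.card T * logPlus (Fintype.card A)) with hM
  have hL : 0 < logPlus (Fintype.card A) := lt_of_lt_of_le one_pos (le_max_right _ _)
  have hT : (0 : ℝ) < Fintype.card T := by exact_mod_cast Fintype.card_pos
  have hM0 : 0 < M := by positivity
  have hl0 : 0 < l := lt_of_lt_of_le (by positivity) hl
  have h1 := measure_prod_gt_le (κ := κ) hq (F := fun x => ENNReal.ofReal (expBound τ₁ (Z₁ x)) +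
      ENNReal.ofReal (expBound τ₂ (Z₂ x)))
    ((measurable_expBound _ hZ₁m).ennreal_ofReal.add (measurable_expBound _ hZ₂m).ennreal_ofReal)
    (M := ENNReal.ofReal M) (fun a ha => by
      have hp : Measurable fun y : β => (a, y) := measurable_prodMk_left
      have e1 := lintegral_expBound_le_of_map_eq hτ₁ (Z := fun y => Z₁ (a, y))
        (fun i t => (hZ₁m i t).comp hp) (hZ₁ a ha)
      have e2 := lintegral_expBound_le_of_map_eq hτ₂ (Z := fun y => Z₂ (a, y))
        (fun i t => (hZ₂m i t).comp hp) (hZ₂ a ha)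
      have hm1 : Measurable fun y : β => ENNReal.ofReal (expBound τ₁ (Z₁ (a, y))) :=
        (measurable_expBound τ₁ (Z := fun y => Z₁ (a, y))
          fun i t => (hZ₁m i t).comp hp).ennreal_ofReal
      rw [lintegral_add_left hm1]
      refine (add_le_add e1 e2).trans (le_of_eq ?_)
      rw [← ENNReal.ofReal_add (by positivity) (by positivity)]
      congr 1
      rw [hM]; ring) (l := ENNReal.ofReal l) (by simpa using hl0) ENNReal.ofReal_ne_top
  refine le_trans (measure_mono ?_) (h1.trans (add_le_add le_rfl ?_))
  · rintro x ⟨i, hi⟩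
    have e1 : √(∑ t, Z₁ x i t ^ 2) ≤ expBound τ₁ (Z₁ x) := sqrt_sum_sq_le_of_exp hτ₁ _ i
    have e2 : √(∑ t, Z₂ x i t ^ 2) ≤ expBound τ₂ (Z₂ x) := sqrt_sum_sq_le_of_exp hτ₂ _ i
    have e3 := sqrt_sum_sub_sq_le (Z₁ x i) (Z₂ x i)
    change ENNReal.ofReal l < _
    rw [← ENNReal.ofReal_add (expBound_nonneg hτ₁.le _) (expBound_nonneg hτ₂.le _)]
    exact (ENNReal.ofReal_lt_ofReal_iff (by linarith)).2 (by linarith)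
  · rw [← ENNReal.ofReal_div_of_pos hl0]
    refine ENNReal.ofReal_le_ofReal ?_
    rw [div_le_div_iff₀ hl0 (by positivity)]
    linarith

end ConditionalBounds

/-! ### The discrepancy between the multiplier process and its Gaussian copy -/

section Discrepancy

open Matrix
open scoped MatrixOrder

variable {𝒱 : Type*} [MeasurableSpace 𝒱] {P : Measure 𝒱} [IsProbabilityMeasure P]

/-- The standard Gaussian measure on `ℝ^T`. -/
noncomputable abbrev stdGaussian (T : Type*) [Fintype T] : Measure (T → ℝ) :=
  Measure.pi fun _ => gaussianReal 0 1

theorem map_mulVec_apply_of_map_eq {S β : Type*} [Fintype S] [MeasurableSpace β] {κ : Measure β}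
    {N : β → S → ℝ} (hN : Measurable N) (h : κ.map N = stdGaussian S) {S' : Type*}
    (D : Matrix S' S ℝ) (s : S') :
    κ.map (fun y => (D *ᵥ N y) s) = gaussianReal 0 (D s ⬝ᵥ D s).toNNReal := by
  have h1 : (stdGaussian S).map (fun x => D s ⬝ᵥ x) = _ := map_dotProduct_pi_gaussianReal (D s)
  rw [← h, Measure.map_map (by simp only [dotProduct]; fun_prop) hN] at h1
  exact h1

theorem dotProduct_row_self {S T : Type*} [Fintype T] (D : Matrix S T ℝ) (s : S) :
    D s ⬝ᵥ D s = (D * Dᵀ) s s := rfl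

theorem map_mulVec_fst_apply {S T S' : Type*} [Fintype S] [Fintype T] (D : Matrix S' T ℝ) (s : S') :
    ((stdGaussian T).prod (stdGaussian S)).map (fun y => (D *ᵥ y.1) s) =
      gaussianReal 0 ((D * Dᵀ) s s).toNNReal := by
  have h := Measure.map_fst_prod (μ := stdGaussian T) (ν := stdGaussian S)
  rw [measure_univ, one_smul] at h
  rw [← dotProduct_row_self]
  exact map_mulVec_apply_of_map_eq measurable_fst h D s

theorem map_mulVec_standardize_apply {S T S' : Type*} [Fintype S] [DecidableEq S] [Fintype T]
    {δ : ℝ} (hδ : 0 < δ) (M : Matrix S T ℝ) (D : Matrix S' S ℝ) (s : S') :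
    ((stdGaussian T).prod (stdGaussian S)).map (fun y => (D *ᵥ standardize δ M y.1 y.2) s) =
      gaussianReal 0 ((D * Dᵀ) s s).toNNReal := by
  have hm : Measurable fun y : (T → ℝ) × (S → ℝ) => standardize δ M y.1 y.2 :=
    measurable_standardize (A := fun _ => M) (fun _ _ => measurable_const) hδ.le measurable_fst measurable_snd
  rw [← dotProduct_row_self]
  exact map_mulVec_apply_of_map_eq hm (map_standardize hδ M) D s

theorem measurable_scoreMatrix_apply {S : Type*} {n : ℕ} {x : 𝒱 → S → ℝ}
    (hxm : ∀ s, Measurable fun v => x v s) (s : S) (i : Fin n) :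
    Measurable fun v : Fin n → 𝒱 => scoreMatrix x v s i := by
  simp only [scoreMatrix, of_apply]
  have h : ∀ i : Fin n, Measurable fun v : Fin n → 𝒱 => x (v i) s := fun i =>
    (hxm s).comp (measurable_pi_apply i)
  exact ((h i).sub ((Finset.measurable_sum _ fun l _ => h l).const_mul _)).const_mul _

theorem measurable_mulVec_apply {S T α : Type*} [Fintype T] [MeasurableSpace α]
    {D : α → Matrix S T ℝ} (hD : ∀ s t, Measurable fun x => D x s t) {N : α → T → ℝ}
    (hN : Measurable N) (s : S) : Measurable fun x => (D x *ᵥ N x) s := by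
  simp only [mulVec, dotProduct]
  exact Finset.measurable_sum _ fun t _ => (hD s t).mul ((measurable_pi_apply t).comp hN)

variable {A T : Type*} [Fintype A] [Fintype T] [DecidableEq A] [DecidableEq T] [Nonempty A]
  [Nonempty T] {x : 𝒱 → A × T → ℝ} {b c : ℝ}

/-- The difference between the multiplier process at the coordinates of `x` and the Gaussian vector
with covariance matrix `covMatrix P x` that is built from the standardization, with regularization
`δ`, of the same weights. -/
noncomputable def discrepancy (P : Measure 𝒱) (x : 𝒱 → A × T → ℝ) {n : ℕ} (δ : ℝ) (v : Fin n → 𝒱)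
    (y : (Fin n → ℝ) × (A × T → ℝ)) : A × T → ℝ :=
  scoreMatrix x v *ᵥ y.1 - CFC.sqrt (covMatrix P x) *ᵥ standardize δ (scoreMatrix x v) y.1 y.2

/-- If the covariance rate `z` is at most one, the square roots of the two covariance matrices
differ by `O(√z)` in operator norm. The discrepancy is `(R - C) N - √z g`, where `R` and `C` are
these roots, `N` is the standardized vector and `g` the regularizing one. -/
theorem measure_discrepancy_gt_le_of_covRate_le_one
    (hxm : ∀ s, Measurable fun v => x v s) (hxb : ∀ v s, |x v s| ≤ b) (hb : 1 ≤ b) (hc1 : 1 ≤ c)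
    (hc : ∀ u : A × T → ℝ, ∫ v, (∑ s, u s * x v s) ^ 2 ∂P ≤ c * (u ⬝ᵥ u)) {n : ℕ} (hn : 0 < n)
    (hz : covRate b (Fintype.card (A × T)) n ≤ 1)
    {K : ℝ} (hK : 1 ≤ K) :
    ((Measure.pi fun _ : Fin n => P).prod ((stdGaussian (Fin n)).prod (stdGaussian (A × T))))
      {y | ∃ a, 28 * K ^ 3 * c * √(covRate b (Fintype.card (A × T)) n) *
          √(Fintype.card T * logPlus (Fintype.card A)) <
        √(∑ t, (discrepancy P x (covRate b (Fintype.card (A × T)) n) y.1 y.2 (a, t)) ^ 2)} ≤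
      ENNReal.ofReal (3 / K ^ 2) := by
  set z := covRate b (Fintype.card (A × T)) n with hzdef
  have hz0 : 0 < z := covRate_pos hb Fintype.card_pos hn
  set U := √(Fintype.card T * logPlus (Fintype.card A)) with hU
  have hU0 : 0 ≤ U := Real.sqrt_nonneg _
  set Cov := covMatrix P x with hCov
  have hCpos' : Cov.PosSemidef := posSemidef_covMatrix hxm hxb
  set C := CFC.sqrt Cov with hC
  have hCC : C * C = Cov := sqrt_mul_sqrt_of_posSemidef hCpos'
  have hCpos : C.PosSemidef := posSemidef_sqrt _
  have hCt : Cᵀ = C := transpose_sqrt _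
  set N : (Fin n → 𝒱) × ((Fin n → ℝ) × (A × T → ℝ)) → A × T → ℝ :=
    fun y => standardize z (scoreMatrix x y.1) y.2.1 y.2.2 with hNdef
  have hSm : ∀ s i, Measurable fun y : (Fin n → 𝒱) × ((Fin n → ℝ) × (A × T → ℝ)) =>
      scoreMatrix x y.1 s i := fun s i => (measurable_scoreMatrix_apply hxm s i).comp measurable_fst
  have hNm : Measurable N := measurable_standardize hSm hz0.le (by fun_prop) (by fun_prop)
  have hsqz : √z ^ 2 = z := Real.sq_sqrt hz0.le
  have hsqz0 : 0 < √z := Real.sqrt_pos.2 hz0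
  have hE := measure_scoreMatrix_cov_gt_le hxm hxb hb hc1 hc hn hz hK
  set 𝒢 : Set (Fin n → 𝒱) := {v | ∀ u : A × T → ℝ,
    |u ⬝ᵥ (scoreMatrix x v * (scoreMatrix x v)ᵀ - Cov) *ᵥ u| ≤ 31 * K ^ 2 * c * z * (u ⬝ᵥ u)}
    with h𝒢
  have hcompl : 𝒢ᶜ = {v : Fin n → 𝒱 | ∃ u : A × T → ℝ, 31 * K ^ 2 * c * z * (u ⬝ᵥ u) <
      |u ⬝ᵥ (scoreMatrix x v * (scoreMatrix x v)ᵀ - Cov) *ᵥ u|} := by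
    ext v; simp [h𝒢]
  rw [← hcompl] at hE
  have hτ : √(32 * K ^ 2 * c * z) ≤ 6 * K * c * √z := by
    rw [Real.sqrt_mul (by positivity)]
    refine mul_le_mul_of_nonneg_right ?_ hsqz0.le
    refine Real.sqrt_le_iff.2 ⟨by positivity, ?_⟩
    have : K ^ 2 * c ≤ K ^ 2 * c ^ 2 := by
      refine mul_le_mul_of_nonneg_left ?_ (sq_nonneg K)
      nlinarith
    nlinarith [show 0 ≤ K ^ 2 * c by positivity]
  have hmain := measure_block_gt_le (κ := (stdGaussian (Fin n)).prod (stdGaussian (A × T))) hE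
    (Z₁ := fun y a t => ((regSqrt z (scoreMatrix x y.1) - C) *ᵥ N y) (a, t))
    (Z₂ := fun y a t => √z * y.2.2 (a, t)) (τ₁ := √(32 * K ^ 2 * c * z)) (τ₂ := √z)
    (fun a t => measurable_mulVec_apply
      (fun s s' => (measurable_regSqrt hSm hz0.le s s').sub_const _) hNm _)
    (fun a t => by fun_prop) (by positivity) hsqz0
    (fun v hv a t => by
      refine ⟨_, ?_, map_mulVec_standardize_apply hz0 (scoreMatrix x v)
        (regSqrt z (scoreMatrix x v) - C) (a, t)⟩
      set R := regSqrt z (scoreMatrix x v) with hR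
      have hRt : Rᵀ = R := transpose_sqrt _
      have hRpos : R.PosSemidef := posSemidef_sqrt _
      rw [Real.sq_sqrt (by positivity)]
      have h1 := sub_mulVec_dotProduct_le hRpos hCpos (t := 32 * K ^ 2 * c * z) (fun u => by
        rw [hCC, hR, regSqrt_mul_self hz0.le, add_sub_right_comm, add_mulVec, dotProduct_add,
          smul_mulVec, one_mulVec, dotProduct_smul, smul_eq_mul]
        have h2 : 0 ≤ u ⬝ᵥ u := by
          simp only [dotProduct]; exact Finset.sum_nonneg fun s _ => mul_self_nonneg _
        refine (abs_add_le _ _).trans ?_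
        rw [abs_of_nonneg (mul_nonneg hz0.le h2)]
        have h3 : z * (u ⬝ᵥ u) ≤ K ^ 2 * c * (z * (u ⬝ᵥ u)) :=
          le_mul_of_one_le_left (by positivity)
            (one_le_mul_of_one_le_of_one_le (one_le_pow₀ hK) hc1)
        linarith [hv u]) (Pi.single (a, t) 1)
      rw [mulVec_single_one, single_one_dotProduct, Pi.single_eq_same, mul_one] at h1
      refine le_trans (le_of_eq ?_) h1
      have hRCt : (R - C)ᵀ = R - C := by rw [transpose_sub, hRt, hCt]
      conv_rhs => rw [← hRCt]
      exact (dotProduct_row_self (R - C) (a, t)).symm)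
    (fun v hv a t => ⟨z, hsqz.ge, by
      have h1 : Measurable fun g : A × T → ℝ => √z * g (a, t) := by fun_prop
      have h2 := map_dotProduct_pi_gaussianReal (Pi.single (a, t) √z : A × T → ℝ)
      simp only [single_dotProduct, Pi.single_eq_same, Real.mul_self_sqrt hz0.le] at h2
      rw [← h2, show (Measure.pi fun _ : A × T => gaussianReal 0 1) = stdGaussian (A × T) from rfl]
      have h3 := Measure.map_snd_prod (μ := stdGaussian (Fin n)) (ν := stdGaussian (A × T))
      rw [measure_univ, one_smul] at h3
      conv_rhs => rw [← h3]
      rw [Measure.map_map h1 measurable_snd]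
      rfl⟩) hK
    (l := 28 * K ^ 3 * c * √z * U) (by
      have h1 : √z ≤ K * c * √z :=
        le_mul_of_one_le_left hsqz0.le (one_le_mul_of_one_le_of_one_le hK hc1)
      calc K ^ 2 * (4 * (√(32 * K ^ 2 * c * z) + √z) * U)
          ≤ K ^ 2 * (4 * (6 * K * c * √z + K * c * √z) * U) := by gcongr
        _ = _ := by ring)
  refine le_trans (measure_mono ?_) (hmain.trans (le_of_eq ?_))
  · rintro y ⟨a, ha⟩
    refine ⟨a, ha.trans_le (le_of_eq ?_)⟩
    congr 1
    refine Finset.sum_congr rfl fun t _ => ?_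
    congr 1
    simp only [discrepancy, hNdef, sub_mulVec, Pi.sub_apply, regSqrt_mulVec_standardize hz0,
      Pi.add_apply, Pi.smul_apply, smul_eq_mul]
    ring
  · rw [← ENNReal.ofReal_add (by positivity) (by positivity)]
    congr 1
    ring

/-- If the covariance rate `z` is at least one, both vectors have variances `O(z)`, and no
cancellation between them is used. -/
theorem measure_discrepancy_gt_le_of_one_le_covRate
    (hxm : ∀ s, Measurable fun v => x v s) (hxb : ∀ v s, |x v s| ≤ b) (hb : 1 ≤ b) (hc1 : 1 ≤ c)
    (hc : ∀ u : A × T → ℝ, ∫ v, (∑ s, u s * x v s) ^ 2 ∂P ≤ c * (u ⬝ᵥ u)) {n : ℕ} (hn : 0 < n)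
    (hz : 1 ≤ covRate b (Fintype.card (A × T)) n)
    {K : ℝ} (hK : 1 ≤ K) :
    ((Measure.pi fun _ : Fin n => P).prod ((stdGaussian (Fin n)).prod (stdGaussian (A × T))))
      {y | ∃ a, 28 * K ^ 3 * c * √(covRate b (Fintype.card (A × T)) n) *
          √(Fintype.card T * logPlus (Fintype.card A)) <
        √(∑ t, (discrepancy P x (covRate b (Fintype.card (A × T)) n) y.1 y.2 (a, t)) ^ 2)} ≤
      ENNReal.ofReal (3 / K ^ 2) := by
  set z := covRate b (Fintype.card (A × T)) n with hzdef
  have hz0 : 0 < z := covRate_pos hb Fintype.card_pos hn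
  set U := √(Fintype.card T * logPlus (Fintype.card A)) with hU
  have hU0 : 0 ≤ U := Real.sqrt_nonneg _
  set Cov := covMatrix P x with hCov
  have hCpos' : Cov.PosSemidef := posSemidef_covMatrix hxm hxb
  set C := CFC.sqrt Cov with hC
  have hCC : C * C = Cov := sqrt_mul_sqrt_of_posSemidef hCpos'
  have hCt : Cᵀ = C := transpose_sqrt _
  set N : (Fin n → 𝒱) × ((Fin n → ℝ) × (A × T → ℝ)) → A × T → ℝ :=
    fun y => standardize z (scoreMatrix x y.1) y.2.1 y.2.2 with hNdef
  have hSm : ∀ s i, Measurable fun y : (Fin n → 𝒱) × ((Fin n → ℝ) × (A × T → ℝ)) =>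
      scoreMatrix x y.1 s i := fun s i => (measurable_scoreMatrix_apply hxm s i).comp measurable_fst
  have hNm : Measurable N := measurable_standardize hSm hz0.le (by fun_prop) (by fun_prop)
  have hsqz0 : 0 < √z := Real.sqrt_pos.2 hz0
  have hE := measure_scoreMatrix_diag_gt_le hxm hxb hb hc1 hc hn hz hK
  set 𝒢 : Set (Fin n → 𝒱) := {v | ∀ s : A × T,
    (scoreMatrix x v * (scoreMatrix x v)ᵀ) s s ≤ 5 * K * c * z} with h𝒢
  have hcompl : 𝒢ᶜ = {v : Fin n → 𝒱 | ∃ s : A × T,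
      5 * K * c * z < (scoreMatrix x v * (scoreMatrix x v)ᵀ) s s} := by
    ext v; simp [h𝒢]
  rw [← hcompl] at hE
  have hτ₁ : √(5 * K * c * z) ≤ 3 * K * c * √z := by
    rw [Real.sqrt_mul (by positivity)]
    refine mul_le_mul_of_nonneg_right ?_ hsqz0.le
    refine Real.sqrt_le_iff.2 ⟨by positivity, ?_⟩
    have : 1 ≤ K * c := one_le_mul_of_one_le_of_one_le hK hc1
    nlinarith
  have hτ₂ : √(c * z) ≤ c * √z := by
    rw [Real.sqrt_mul (by positivity)]
    refine mul_le_mul_of_nonneg_right ?_ hsqz0.le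
    exact Real.sqrt_le_iff.2 ⟨by positivity, by nlinarith⟩
  have hmain := measure_block_gt_le (κ := (stdGaussian (Fin n)).prod (stdGaussian (A × T))) hE
    (Z₁ := fun y a t => (scoreMatrix x y.1 *ᵥ y.2.1) (a, t))
    (Z₂ := fun y a t => (C *ᵥ N y) (a, t)) (τ₁ := √(5 * K * c * z)) (τ₂ := √(c * z))
    (fun a t => measurable_mulVec_apply hSm (by fun_prop) _)
    (fun a t => measurable_mulVec_apply (D := fun _ => C) (fun _ _ => measurable_const) hNm _)
    (by positivity) (by positivity)
    (fun v hv a t => by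
      refine ⟨_, ?_, map_mulVec_fst_apply (scoreMatrix x v) (a, t)⟩
      rw [Real.sq_sqrt (by positivity)]
      exact hv (a, t))
    (fun v hv a t => by
      refine ⟨_, ?_, map_mulVec_standardize_apply hz0 (scoreMatrix x v) C (a, t)⟩
      rw [Real.sq_sqrt (by positivity), hCt, hCC]
      have h1 := dotProduct_covMatrix_mulVec_le hxm hxb hc (Pi.single (a, t) 1)
      rw [mulVec_single_one, single_one_dotProduct, single_one_dotProduct, Pi.single_eq_same,
        mul_one] at h1
      exact (show Cov (a, t) (a, t) ≤ c from h1).trans (le_mul_of_one_le_right (by positivity) hz))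
    hK
    (l := 28 * K ^ 3 * c * √z * U) (by
      have h1 : c * √z ≤ K * (c * √z) := le_mul_of_one_le_left (by positivity) hK
      have h2 : 0 ≤ K ^ 3 * c * √z * U := by positivity
      calc K ^ 2 * (4 * (√(5 * K * c * z) + √(c * z)) * U)
          ≤ K ^ 2 * (4 * (3 * K * c * √z + K * (c * √z)) * U) := by
            gcongr
            exact hτ₂.trans h1
        _ = 16 * (K ^ 3 * c * √z * U) := by ring
        _ ≤ 28 * (K ^ 3 * c * √z * U) := by linarith
        _ = 28 * K ^ 3 * c * √z * U := by ring)
  refine le_trans (measure_mono ?_) (hmain.trans ?_)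
  · rintro y ⟨a, ha⟩
    refine ⟨a, ha.trans_le (le_of_eq ?_)⟩
    simp only [discrepancy, hNdef, Pi.sub_apply, hC, hCov]
  · rw [← ENNReal.ofReal_add (by positivity) (by positivity)]
    refine ENNReal.ofReal_le_ofReal ?_
    rw [← add_div]
    gcongr
    norm_num

/-- All the blocks of the discrepancy are of order `√z √(m log k)`, where `z` is the covariance
rate, `m` the size of a block and `k` the number of blocks. -/
theorem measure_discrepancy_gt_le
    (hxm : ∀ s, Measurable fun v => x v s) (hxb : ∀ v s, |x v s| ≤ b) (hb : 1 ≤ b) (hc1 : 1 ≤ c)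
    (hc : ∀ u : A × T → ℝ, ∫ v, (∑ s, u s * x v s) ^ 2 ∂P ≤ c * (u ⬝ᵥ u)) {n : ℕ} (hn : 0 < n)
    {K : ℝ} (hK : 1 ≤ K) :
    ((Measure.pi fun _ : Fin n => P).prod ((stdGaussian (Fin n)).prod (stdGaussian (A × T))))
      {y | ∃ a, 28 * K ^ 3 * c * √(covRate b (Fintype.card (A × T)) n) *
          √(Fintype.card T * logPlus (Fintype.card A)) <
        √(∑ t, (discrepancy P x (covRate b (Fintype.card (A × T)) n) y.1 y.2 (a, t)) ^ 2)} ≤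
      ENNReal.ofReal (3 / K ^ 2) :=
  (le_total (covRate b (Fintype.card (A × T)) n) 1).elim
    (fun hz => measure_discrepancy_gt_le_of_covRate_le_one hxm hxb hb hc1 hc hn hz hK)
    fun hz => measure_discrepancy_gt_le_of_one_le_covRate hxm hxb hb hc1 hc hn hz hK

end Discrepancy

/-! ### Series expansions in `L²` and of the multiplier process -/

section Series

variable {𝒱 : Type*} [MeasurableSpace 𝒱] {P : Measure 𝒱} [IsProbabilityMeasure P]

/-- The remainder after `N` terms, uniformly in the point and in the coefficients. -/
theorem abs_tsum_tail_le {h β β' : ℕ → ℝ} {b y : ℝ} (hb : ∀ j, |h j| ≤ b)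
    (hβ : ∀ j, |β j| ≤ β' j) (hβ' : Summable β') (hy : HasSum (fun j => h j * β j) y) (N : ℕ) :
    |∑ j ∈ Finset.range N, h j * β j - y| ≤ b * ∑' j, β' (j + N) := by
  have h1 := hy.summable.sum_add_tsum_nat_add N
  rw [hy.tsum_eq] at h1
  have h2 : ∑ j ∈ Finset.range N, h j * β j - y = -∑' j, h (j + N) * β (j + N) := by linarith
  have h3 : Summable fun j => b * β' (j + N) := ((summable_nat_add_iff N).2 hβ').mul_left b
  rw [h2, abs_neg, ← tsum_mul_left]
  refine tsum_of_norm_bounded (f := fun j => h (j + N) * β (j + N)) h3.hasSum fun j => ?_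
  rw [norm_mul, Real.norm_eq_abs, Real.norm_eq_abs]
  exact mul_le_mul (hb _) (hβ _) (abs_nonneg _) ((abs_nonneg _).trans (hb j))

theorem memLp_of_hasSum {h : ℕ → 𝒱 → ℝ} {β β' : ℕ → ℝ} {b : ℝ} {g : 𝒱 → ℝ}
    (hb : ∀ j v, |h j v| ≤ b) (hβ : ∀ j, |β j| ≤ β' j) (hβ' : Summable β') (hg : Measurable g)
    (hsum : ∀ᵐ v ∂P, HasSum (fun j => h j v * β j) (g v)) (p : ℝ≥0∞) : MemLp g p P := by
  refine MemLp.of_bound hg.aestronglyMeasurable (b * ∑' j, β' j) ?_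
  filter_upwards [hsum] with v hv
  have := abs_tsum_tail_le (fun j => hb j v) hβ hβ' hv 0
  simpa using this

/-- A uniformly convergent expansion of a function gives an expansion of its centred class. -/
theorem hasSum_smul_centredClass {h : ℕ → 𝒱 → ℝ} {β β' : ℕ → ℝ} {b : ℝ} {g : 𝒱 → ℝ}
    (hh : ∀ j, Measurable (h j)) (hb : ∀ j v, |h j v| ≤ b) (hβ : ∀ j, |β j| ≤ β' j)
    (hβ' : Summable β') (hg : Measurable g)
    (hsum : ∀ᵐ v ∂P, HasSum (fun j => h j v * β j) (g v)) :
    HasSum (fun j => β j • centredClass P (h j)) (centredClass P g) := by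
  have hmem : ∀ j, MemLp (h j) 2 P := fun j =>
    MemLp.of_bound (hh j).aestronglyMeasurable b (ae_of_all _ fun v => hb j v)
  have hgm : MemLp g 2 P := memLp_of_hasSum hb hβ hβ' hg hsum 2
  have hle : ∀ j, ‖centredClass P (h j)‖ ≤ |b| := fun j =>
    norm_centredClass_le_of_bounded (hh j) (abs_nonneg b) fun v => (hb j v).trans (le_abs_self b)
  have hsm : Summable fun j => β j • centredClass P (h j) := by
    refine Summable.of_norm_bounded (hβ'.mul_right |b|) fun j => ?_
    rw [norm_smul, Real.norm_eq_abs]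
    exact mul_le_mul (hβ j) (hle j) (norm_nonneg _) ((abs_nonneg _).trans (hβ j))
  have hlim : Tendsto (fun N => ∑ j ∈ Finset.range N, β j • centredClass P (h j)) atTop
      (𝓝 (centredClass P g)) := by
    have htail : Tendsto (fun N => 2 * (b * ∑' j, β' (j + N))) atTop (𝓝 0) := by
      have := ((tendsto_sum_nat_add β').const_mul b).const_mul 2
      simpa using this
    refine tendsto_iff_norm_sub_tendsto_zero.2
      (squeeze_zero (fun _ => norm_nonneg _) (fun N => ?_) htail)
    set e := b * ∑' j, β' (j + N) with he
    have hE : |∑ j ∈ Finset.range N, (∫ u, h j u ∂P) * β j - ∫ u, g u ∂P| ≤ e := by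
      have h1 : ∑ j ∈ Finset.range N, (∫ u, h j u ∂P) * β j - ∫ u, g u ∂P =
          ∫ u, (∑ j ∈ Finset.range N, h j u * β j - g u) ∂P := by
        rw [integral_sub (integrable_finsetSum _ fun j _ =>
          ((hmem j).integrable one_le_two).mul_const _) (hgm.integrable one_le_two),
          integral_finsetSum _ fun j _ => ((hmem j).integrable one_le_two).mul_const _]
        simp_rw [integral_mul_const]
      rw [h1]
      have h2 := norm_integral_le_of_norm_le_const (μ := P) (C := e)
        (f := fun u => ∑ j ∈ Finset.range N, h j u * β j - g u) (by
          filter_upwards [hsum] with v hv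
          exact abs_tsum_tail_le (fun j => hb j v) hβ hβ' hv N)
      simpa using h2
    have hae : ∀ᵐ v ∂P, ‖(∑ j ∈ Finset.range N, β j • centredClass P (h j) -
        centredClass P g : Lp ℝ 2 P) v‖ ≤ 2 * e := by
      have h3 : ∀ᵐ v ∂P, ∀ j ∈ Finset.range N, (β j • centredClass P (h j) : Lp ℝ 2 P) v =
          β j * (h j v - ∫ u, h j u ∂P) := by
        rw [Finset.eventually_all]
        intro j _
        filter_upwards [Lp.coeFn_smul (β j) (centredClass P (h j)), coeFn_centredClass (hmem j)]
          with v h1 h2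
        rw [h1, Pi.smul_apply, h2, smul_eq_mul]
      filter_upwards [hsum, coeFn_centredClass hgm, h3,
        Lp.coeFn_sub (∑ j ∈ Finset.range N, β j • centredClass P (h j)) (centredClass P g),
        Lp.coeFn_finsetSum (Finset.range N) fun j => β j • centredClass P (h j)]
        with v h1 h2 h3 h4 h5
      rw [h4, Pi.sub_apply, h5, h2, Finset.sum_apply, Finset.sum_congr rfl h3, Real.norm_eq_abs]
      have h6 := abs_tsum_tail_le (fun j => hb j v) hβ hβ' h1 N
      have h7 : ∑ j ∈ Finset.range N, β j * (h j v - ∫ u, h j u ∂P) - (g v - ∫ u, g u ∂P) =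
          (∑ j ∈ Finset.range N, h j v * β j - g v) -
            (∑ j ∈ Finset.range N, (∫ u, h j u ∂P) * β j - ∫ u, g u ∂P) := by
        simp only [mul_sub, Finset.sum_sub_distrib, mul_comm]
        ring
      rw [h7]
      refine (abs_sub _ _).trans ?_
      linarith
    have he0 : 0 ≤ 2 * e := by linarith [(abs_nonneg _).trans hE]
    have := Lp.norm_le_of_ae_bound he0 hae
    simpa [measureUnivNNReal] using this
  have := tendsto_nhds_unique hsm.hasSum.tendsto_sum_nat hlim
  rw [← this]
  exact hsm.hasSum

theorem hasSum_multiplier {V : Type*} {n : ℕ} (w : Fin n → ℝ) (v : Fin n → V) {h : ℕ → V → ℝ}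
    {β : ℕ → ℝ} {g : V → ℝ} (hsum : ∀ i, HasSum (fun j => h j (v i) * β j) (g (v i))) :
    HasSum (fun j => β j * multiplier w v (h j)) (multiplier w v g) := by
  have h1 : HasSum (fun j => (1 / √(n : ℝ)) * ∑ i, w i * (h j (v i) * β j -
      (1 / (n : ℝ)) * ∑ l, h j (v l) * β j)) (multiplier w v g) := by
    refine HasSum.mul_left _ (hasSum_sum fun i _ => HasSum.mul_left _ ?_)
    exact (hsum i).sub ((hasSum_sum fun l _ => hsum l).mul_left _)
  convert h1 using 1
  funext j
  simp only [multiplier]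
  rw [mul_left_comm, Finset.mul_sum]
  congr 1
  refine Finset.sum_congr rfl fun i _ => ?_
  rw [← Finset.sum_mul]
  ring

end Series

/-! ### The coupling for one distribution and one sample size -/

section Coupling

open Matrix
open scoped MatrixOrder

variable {𝒱 : Type*} [MeasurableSpace 𝒱] {P : Measure 𝒱} [IsProbabilityMeasure P]

omit [MeasurableSpace 𝒱] in
theorem scoreMatrix_mul_transpose_diag_le {S : Type*} {n : ℕ} (hn : 0 < n) {x : 𝒱 → S → ℝ} {b : ℝ}
    (hxb : ∀ v s, |x v s| ≤ b) (v : Fin n → 𝒱) (s : S) :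
    (scoreMatrix x v * (scoreMatrix x v)ᵀ) s s ≤ b ^ 2 := by
  -- With the zero measure the centring in `scoreMatrix_mul_transpose` is void.
  let _ : MeasurableSpace 𝒱 := ⊤
  have hnR : (0 : ℝ) < n := by exact_mod_cast hn
  rw [scoreMatrix_mul_transpose (P := (0 : Measure 𝒱)) hn]
  simp only [centred, integral_zero_measure, sub_zero]
  have h1 : ∑ i, x (v i) s * x (v i) s ≤ n * b ^ 2 := by
    calc _ ≤ ∑ i : Fin n, b ^ 2 := Finset.sum_le_sum fun i _ => by
          rw [← pow_two]
          exact sq_le_sq.2 ((hxb _ _).trans (le_abs_self b))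
      _ = _ := by simp
  have h2 : 1 / (n : ℝ) * ∑ i, x (v i) s * x (v i) s ≤ b ^ 2 := by
    rw [one_div, inv_mul_le_iff₀ hnR]
    exact h1
  nlinarith [mul_self_nonneg (1 / (n : ℝ) * ∑ i, x (v i) s)]

theorem measurable_multiplier {n : ℕ} {h : 𝒱 → ℝ} (hh : Measurable h) {α : Type*}
    [MeasurableSpace α] {w : α → Fin n → ℝ} {v : α → Fin n → 𝒱} (hw : Measurable w)
    (hv : Measurable v) : Measurable fun x => multiplier (w x) (v x) h := by
  unfold multiplier
  have h1 : ∀ i : Fin n, Measurable fun x => h (v x i) := fun i =>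
    hh.comp ((measurable_pi_apply i).comp hv)
  have h2 : ∀ i : Fin n, Measurable fun x => w x i := fun i => (measurable_pi_apply i).comp hw
  exact (Finset.measurable_sum _ fun i _ =>
    (h2 i).mul ((h1 i).sub ((Finset.measurable_sum _ fun l _ => h1 l).const_mul _))).const_mul _

omit [MeasurableSpace 𝒱] in
/-- Given the data, the multiplier process at a bounded function is centred normal with bounded
variance. -/
theorem map_multiplier {n : ℕ} (hn : 0 < n) {h : 𝒱 → ℝ} {b : ℝ} (hb : ∀ v, |h v| ≤ b)
    (v : Fin n → 𝒱) : ∃ σ ≤ b ^ 2,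
      (stdGaussian (Fin n)).map (fun w => multiplier w v h) = gaussianReal 0 σ.toNNReal := by
  refine ⟨_, scoreMatrix_mul_transpose_diag_le hn (x := fun v (_ : Unit) => h v)
    (fun v _ => hb v) v (), ?_⟩
  rw [← dotProduct_row_self]
  have h1 := map_mulVec_apply_of_map_eq (κ := stdGaussian (Fin n)) measurable_id Measure.map_id
    (scoreMatrix (fun v (_ : Unit) => h v) v) ()
  simp only [id, scoreMatrix_mulVec] at h1
  exact h1

/-- A variable whose conditional law given the first coordinate does not depend on it is independent
of it. -/
theorem indepFun_fst_of_measurePreserving {α β γ : Type*} [MeasurableSpace α] [MeasurableSpace β]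
    [MeasurableSpace γ] {π : Measure α} {κ : Measure β} {κ' : Measure γ} [IsProbabilityMeasure π]
    [IsProbabilityMeasure κ] [IsProbabilityMeasure κ'] {Λ : α × β → γ}
    (h : MeasurePreserving (fun x => (x.1, Λ x)) (π.prod κ) (π.prod κ')) :
    MeasurePreserving Λ (π.prod κ) κ' ∧ IndepFun Λ Prod.fst (π.prod κ) := by
  have h1 : MeasurePreserving Λ (π.prod κ) κ' := measurePreserving_snd.comp h
  refine ⟨h1, IndepFun.symm ?_⟩
  rw [indepFun_iff_map_prod_eq_prod_map_map measurable_fst.aemeasurable h1.measurable.aemeasurable,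
    h.map_eq, h1.map_eq, measurePreserving_fst.map_eq]

/-- The randomization: the data, the weights, an auxiliary standard normal vector, and the source of
an independent Gaussian field. -/
abbrev CouplingSpace (𝒱 : Type*) (n : ℕ) (S Ξ : Type*) : Type _ :=
  (Fin n → 𝒱) × ((Fin n → ℝ) × ((S → ℝ) × Ξ))

/-- The law of the randomization. -/
noncomputable abbrev couplingMeasure {S Ξ : Type*} [Fintype S] [MeasurableSpace Ξ] (P : Measure 𝒱)
    (n : ℕ) (κ : Measure Ξ) : Measure (CouplingSpace 𝒱 n S Ξ) :=
  (Measure.pi fun _ : Fin n => P).prod ((stdGaussian (Fin n)).prod ((stdGaussian S).prod κ))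

/-- The source of randomness of the Gaussian field of the coupling: the standardized normal vector
and the source of the independent field. -/
noncomputable def couplingSource {S Ξ : Type*} [Fintype S] [DecidableEq S] {n : ℕ} (δ : ℝ)
    (x : 𝒱 → S → ℝ) (y : CouplingSpace 𝒱 n S Ξ) : (S → ℝ) × Ξ :=
  (standardize δ (scoreMatrix x y.1) y.2.1 y.2.2.1, y.2.2.2)

variable {S Ξ : Type*} [Fintype S] [DecidableEq S] [MeasurableSpace Ξ] {κ : Measure Ξ}
  [IsProbabilityMeasure κ] {n : ℕ} {δ : ℝ} {x : 𝒱 → S → ℝ}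

omit [IsProbabilityMeasure P] [IsProbabilityMeasure κ] in
theorem measurable_couplingSource (hδ : 0 < δ) (hxm : ∀ s, Measurable fun v => x v s) :
    Measurable (couplingSource (Ξ := Ξ) (n := n) δ x) := by
  refine Measurable.prodMk ?_ (by fun_prop)
  exact measurable_standardize (A := fun y : CouplingSpace 𝒱 n S Ξ => scoreMatrix x y.1)
    (fun s i => (measurable_scoreMatrix_apply hxm s i).comp measurable_fst) hδ.le (by fun_prop)
    (by fun_prop)

omit [MeasurableSpace 𝒱] in
theorem map_couplingSource (hδ : 0 < δ) (v : Fin n → 𝒱) :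
    ((stdGaussian (Fin n)).prod ((stdGaussian S).prod κ)).map
      (fun y => couplingSource δ x (v, y)) = (stdGaussian S).prod κ := by
  have h1 : MeasurePreserving (fun y : (Fin n → ℝ) × (S → ℝ) =>
      standardize δ (scoreMatrix x v) y.1 y.2) ((stdGaussian (Fin n)).prod (stdGaussian S))
      (stdGaussian S) :=
    ⟨measurable_standardize (A := fun _ => scoreMatrix x v) (fun _ _ => measurable_const) hδ.le
      measurable_fst measurable_snd, map_standardize hδ (scoreMatrix x v)⟩
  have h2 := h1.prod (MeasurePreserving.id κ)
  have h3 := (measurePreserving_prodAssoc (stdGaussian (Fin n)) (stdGaussian S) κ).symm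
  exact (h2.comp h3).map_eq

/-- The source of the Gaussian field is independent of the data, although it is built from the data
and the weights. -/
theorem measurePreserving_prodMk_couplingSource (hδ : 0 < δ)
    (hxm : ∀ s, Measurable fun v => x v s) :
    MeasurePreserving (fun y : CouplingSpace 𝒱 n S Ξ => (y.1, couplingSource δ x y))
      (couplingMeasure P n κ) ((Measure.pi fun _ => P).prod ((stdGaussian S).prod κ)) :=
  (MeasurePreserving.id (Measure.pi fun _ : Fin n => P)).skew_product
    (g := fun v y => couplingSource δ x (v, y)) (measurable_couplingSource hδ hxm)
    (ae_of_all _ fun v => map_couplingSource hδ v)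

end Coupling

section CouplingBound

open Matrix
open scoped MatrixOrder

variable {𝒱 : Type*} [MeasurableSpace 𝒱] {P : Measure 𝒱} [IsProbabilityMeasure P]
  {A Ξ : Type*} [Fintype A] [MeasurableSpace Ξ] {κ : Measure Ξ} [IsProbabilityMeasure κ]
  {h : A → ℕ → 𝒱 → ℝ} {b : ℝ}

/-- A bound for the part of the multiplier process and of its Gaussian copy that comes from the
terms of the expansion beyond the first `m`. -/
noncomputable def tailBound {n : ℕ} (b : ℝ) (h : A → ℕ → 𝒱 → ℝ) (β' : ℕ → ℝ) (m : ℕ)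
    (w : Fin n → ℝ) (v : Fin n → 𝒱) (z : A → ℕ → ℝ) : ℝ≥0∞ :=
  ∑' j, ENNReal.ofReal (β' (j + m)) *
    (ENNReal.ofReal (expBound b fun a (_ : Unit) => multiplier w v (h a (j + m))) +
      ENNReal.ofReal (expBound b fun a (_ : Unit) => z a (j + m)))

theorem abs_le_expBound (hb : 0 < b) (z : A → ℝ) (a : A) :
    |z a| ≤ expBound b fun a (_ : Unit) => z a := by
  have h1 := sqrt_sum_sq_le_of_exp (T := Unit) hb (fun a _ => z a) a
  simp only [Finset.univ_unique, Finset.sum_const, Finset.card_singleton, one_smul] at h1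
  rw [Real.sqrt_sq_eq_abs] at h1
  refine h1.trans (le_of_eq ?_)
  simp [expBound]

omit [MeasurableSpace 𝒱] in
theorem ofReal_abs_tsum_le_tailBound {n : ℕ} (hb : 0 < b) {β β' : ℕ → ℝ}
    (hβ : ∀ j, |β j| ≤ β' j) (m : ℕ) (w : Fin n → ℝ) (v : Fin n → 𝒱) (z : A → ℕ → ℝ) (a : A) :
    ENNReal.ofReal |∑' j, β (j + m) * (multiplier w v (h a (j + m)) - z a (j + m))| ≤
      tailBound b h β' m w v z := by
  rw [← Real.norm_eq_abs, ofReal_norm]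
  refine enorm_tsum_le_tsum_enorm.trans (ENNReal.tsum_le_tsum fun j => ?_)
  rw [enorm_mul]
  refine mul_le_mul' ?_ ?_
  · rw [← ofReal_norm, Real.norm_eq_abs]
    exact ENNReal.ofReal_le_ofReal (hβ _)
  · rw [← ofReal_norm, Real.norm_eq_abs, ← ENNReal.ofReal_add (expBound_nonneg hb.le _)
      (expBound_nonneg hb.le _)]
    refine ENNReal.ofReal_le_ofReal ((abs_sub _ _).trans (add_le_add ?_ ?_))
    · exact abs_le_expBound hb (fun a => multiplier w v (h a (j + m))) a
    · exact abs_le_expBound hb (fun a => z a (j + m)) a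

/-- Given the data, the expected size of the tail is of the order of the sum of the coefficient
bounds. -/
theorem lintegral_tailBound_le {n : ℕ} (hn : 0 < n) {m : ℕ} (hb0 : 0 < b)
    (hh : ∀ a j, Measurable (h a j)) (hb : ∀ a j v, |h a j v| ≤ b) {β' : ℕ → ℝ}
    (hβ0 : ∀ j, 0 ≤ β' j) (hβ' : Summable β') {Y : Type*} [MeasurableSpace Y] {ρ : Measure Y}
    [IsProbabilityMeasure ρ] (v : Fin n → 𝒱) {w : Y → Fin n → ℝ} (hwm : Measurable w)
    (hw : ρ.map w = stdGaussian (Fin n)) {z : A → ℕ → Y → ℝ} (hzm : ∀ a j, Measurable (z a j))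
    (hz : ∀ a j, ∃ σ ≤ b ^ 2, ρ.map (z a j) = gaussianReal 0 σ.toNNReal) :
    ∫⁻ y, tailBound b h β' m (w y) v (fun a j => z a j y) ∂ρ ≤
      ENNReal.ofReal (8 * b * √(logPlus (Fintype.card A)) * ∑' j, β' (j + m)) := by
  have hwm' : ∀ a j, Measurable fun y => multiplier (w y) v (h a j) := fun a j =>
    measurable_multiplier (hh a j) hwm measurable_const
  have hm1 : ∀ j, Measurable fun y => ENNReal.ofReal
      (expBound b fun a (_ : Unit) => multiplier (w y) v (h a (j + m))) := fun j =>
    (measurable_expBound b (Z := fun y a (_ : Unit) => multiplier (w y) v (h a (j + m)))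
      fun a _ => hwm' a _).ennreal_ofReal
  have hm2 : ∀ j, Measurable fun y => ENNReal.ofReal
      (expBound b fun a (_ : Unit) => z a (j + m) y) := fun j =>
    (measurable_expBound b (Z := fun y a (_ : Unit) => z a (j + m) y)
      fun a _ => hzm a _).ennreal_ofReal
  unfold tailBound
  rw [lintegral_tsum fun j => (((hm1 j).fun_add (hm2 j)).const_mul _).aemeasurable]
  have hterm : ∀ j, ∫⁻ y, ENNReal.ofReal (β' (j + m)) *
      (ENNReal.ofReal (expBound b fun a (_ : Unit) => multiplier (w y) v (h a (j + m))) +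
        ENNReal.ofReal (expBound b fun a (_ : Unit) => z a (j + m) y)) ∂ρ ≤
      ENNReal.ofReal (8 * b * √(logPlus (Fintype.card A)) * β' (j + m)) := fun j => by
    have e1 := lintegral_expBound_le_of_map_eq (ρ := ρ) hb0
      (Z := fun y a (_ : Unit) => multiplier (w y) v (h a (j + m))) (fun a _ => hwm' a _)
      fun a _ => by
        obtain ⟨σ, hσ, hlaw⟩ := map_multiplier hn (hb a (j + m)) v
        refine ⟨σ, hσ, ?_⟩
        have hmw : Measurable fun w : Fin n → ℝ => multiplier w v (h a (j + m)) :=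
          measurable_multiplier (hh a _) measurable_id measurable_const
        rw [← hlaw, ← hw, Measure.map_map hmw hwm]
        rfl
    have e2 := lintegral_expBound_le_of_map_eq (ρ := ρ) hb0
      (Z := fun y a (_ : Unit) => z a (j + m) y) (fun a _ => hzm a _) fun a _ => hz a (j + m)
    rw [lintegral_const_mul _ ((hm1 j).fun_add (hm2 j)), lintegral_add_left (hm1 j)]
    refine (mul_le_mul' le_rfl (add_le_add e1 e2)).trans (le_of_eq ?_)
    rw [← ENNReal.ofReal_add (by positivity) (by positivity), ← ENNReal.ofReal_mul (hβ0 _)]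
    congr 1
    simp only [Fintype.card_unit, Nat.cast_one, one_mul]
    ring
  refine (ENNReal.tsum_le_tsum hterm).trans (le_of_eq ?_)
  rw [← tsum_mul_left, ENNReal.ofReal_tsum_of_nonneg]
  · intro j
    have := hβ0 (j + m)
    positivity
  · exact ((summable_nat_add_iff m).2 hβ').mul_left _

theorem measurable_tailBound {n m : ℕ} (hh : ∀ a j, Measurable (h a j)) {β' : ℕ → ℝ} {Y : Type*}
    [MeasurableSpace Y] {v : Y → Fin n → 𝒱} (hv : Measurable v) {w : Y → Fin n → ℝ}
    (hw : Measurable w) {z : A → ℕ → Y → ℝ} (hz : ∀ a j, Measurable (z a j)) :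
    Measurable fun y => tailBound b h β' m (w y) (v y) fun a j => z a j y := by
  unfold tailBound
  refine Measurable.tsum fun j => Measurable.const_mul (Measurable.fun_add ?_ ?_) _
  · exact (measurable_expBound b
      (Z := fun y a (_ : Unit) => multiplier (w y) (v y) (h a (j + m)))
      fun a _ => measurable_multiplier (hh a _) hw hv).ennreal_ofReal
  · exact (measurable_expBound b (Z := fun y a (_ : Unit) => z a (j + m) y)
      fun a _ => hz a _).ennreal_ofReal

variable [DecidableEq A] [Nonempty A]

/-- The coupling of the multiplier process with an isonormal process independent of the data, and
its error, for a class of functions with expansions in `h a 0, h a 1, …`. The exceptional set does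
not depend on the function, and the two summands of the error are the discrepancy of the first `m`
terms and the remaining terms. -/
theorem exists_isIsonormal_coupling {m n : ℕ} (hm : 0 < m) (hn : 0 < n)
    (hh : ∀ a j, Measurable (h a j)) (hb : ∀ a j v, |h a j v| ≤ b) (hb1 : 1 ≤ b) {c : ℝ}
    (hc1 : 1 ≤ c) (hc : ∀ u : A × Fin m → ℝ,
      ∫ v, (∑ s, u s * h s.1 s.2 v) ^ 2 ∂P ≤ c * (u ⬝ᵥ u)) {β' : ℕ → ℝ}
    (hβ0 : ∀ j, 0 < β' j) (hβ' : Summable β') {Z₁ : Lp ℝ 2 P → Ξ → ℝ} (hZ₁ : IsGaussianField Z₁ κ) :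
    ∃ W : (𝒱 → ℝ) → CouplingSpace 𝒱 n (A × Fin m) Ξ → ℝ,
      IsIsonormal P W (couplingMeasure P n κ) ∧
      IndepFun (fun y (f : {f : 𝒱 → ℝ // MemLp f 2 P}) => W f y) (fun y => y.1)
        (couplingMeasure P n κ) ∧
      ∀ K : ℝ, 1 ≤ K → ∃ bad : Set (CouplingSpace 𝒱 n (A × Fin m) Ξ),
        couplingMeasure P n κ bad ≤ ENNReal.ofReal (4 / K ^ 2) ∧
        ∀ y ∉ bad, ∀ (D : ℝ) (β : ℕ → ℝ) (g : 𝒱 → ℝ) (a : A), 0 ≤ D → (∀ j, |β j| ≤ β' j) →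
          ∑ j ∈ Finset.range m, β j ^ 2 ≤ D ^ 2 → Measurable g →
          (∀ᵐ v ∂P, HasSum (fun j => h a j v * β j) (g v)) →
          (∀ i, HasSum (fun j => h a j (y.1 i) * β j) (g (y.1 i))) →
          |multiplier y.2.1 y.1 g - W g y| ≤
            D * (28 * K ^ 3 * c * √(covRate b (Fintype.card (A × Fin m)) n) *
              √(m * logPlus (Fintype.card A))) +
            K ^ 2 * (8 * b * √(logPlus (Fintype.card A)) * ∑' j, β' (j + m)) := by
  have hb0 : 0 < b := by linarith
  have : Nonempty (Fin m) := ⟨⟨0, hm⟩⟩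
  set z := covRate b (Fintype.card (A × Fin m)) n with hzdef
  have hz0 : 0 < z := covRate_pos hb1 Fintype.card_pos hn
  set x : 𝒱 → A × Fin m → ℝ := fun v s => h s.1 s.2 v with hx
  have hxm : ∀ s, Measurable fun v => x v s := fun s => hh s.1 s.2
  have hxb : ∀ v s, |x v s| ≤ b := fun v s => hb s.1 s.2 v
  set η : A → ℕ → Lp ℝ 2 P := fun a j => centredClass P (h a j) with hη
  have hηb : ∀ a j, ‖η a j‖ ≤ b := fun a j => norm_centredClass_le_of_bounded (hh a j) hb0.le (hb a j)
  set C := CFC.sqrt (covMatrix P x) with hC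
  have hCC : ∀ s t, (C * Cᵀ) s t = inner ℝ (η s.1 s.2) (η t.1 t.2) := fun s t => by
    have hmem : ∀ s : A × Fin m, MemLp (h s.1 s.2) 2 P := fun s => memLp_of_bounded hxm hxb s 2
    rw [hC, transpose_sqrt, sqrt_mul_sqrt_of_posSemidef (posSemidef_covMatrix hxm hxb),
      hη, inner_centredClass (hmem s) (hmem t)]
    rfl
  obtain ⟨Z, hZ, hZC⟩ := exists_isGaussianField_extending hZ₁
    (fun s : A × Fin m => η s.1 s.2) C hCC
  obtain ⟨Z', hZ', -, hcoh⟩ := hZ.exists_modification η (fun j => (hβ0 j).le) fun a =>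
    Summable.of_nonneg_of_le (fun j => mul_nonneg (hβ0 j).le (norm_nonneg _))
      (fun j => mul_le_mul_of_nonneg_left (hηb a j) (hβ0 j).le) (hβ'.mul_right b)
  set Λ : CouplingSpace 𝒱 n (A × Fin m) Ξ → (A × Fin m → ℝ) × Ξ := couplingSource z x with hΛdef
  have hΛ2 := measurePreserving_prodMk_couplingSource (P := P) (κ := κ) (n := n) hz0 hxm
  obtain ⟨hΛ, hind⟩ := indepFun_fst_of_measurePreserving hΛ2
  refine ⟨fun f y => Z' (centredClass P f) (Λ y), hZ'.isIsonormal hΛ, ?_, fun K hK => ?_⟩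
  · exact hind.comp (φ := fun ξ (f : {f : 𝒱 → ℝ // MemLp f 2 P}) => Z' (centredClass P f) ξ)
      (ψ := id) (measurable_pi_lambda _ fun f => hZ'.measurable _) measurable_id
  set L := logPlus (Fintype.card A) with hL
  have hL0 : 0 < L := lt_of_lt_of_le one_pos (le_max_right _ _)
  set tail := ∑' j, β' (j + m) with htail
  have htail0 : 0 < tail :=
    ((summable_nat_add_iff m).2 hβ').tsum_pos (fun j => (hβ0 _).le) 0 (hβ0 _)
  set t₁ := 28 * K ^ 3 * c * √z * √(m * L) with ht₁
  set t₂ := K ^ 2 * (8 * b * √L * tail) with ht₂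
  have ht₂0 : 0 < t₂ := by positivity
  -- The null event where the field is not coherent, or does not have the prescribed finite part.
  set bad₀ : Set (CouplingSpace 𝒱 n (A × Fin m) Ξ) := {y | ¬ (((∀ a, Summable fun j =>
      β' j * |Z (η a j) (Λ y)|) ∧ ∀ a (β : ℕ → ℝ), (∀ j, |β j| ≤ β' j) →
        Z' (∑' j, β j • η a j) (Λ y) = ∑' j, β j * Z (η a j) (Λ y)) ∧
      ∀ s : A × Fin m, Z (η s.1 s.2) (Λ y) = (C *ᵥ (Λ y).1) s)} with hbad₀
  have h₀ : couplingMeasure P n κ bad₀ = 0 := by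
    have h1 := hcoh.and (ae_all_iff.2 hZC)
    exact hΛ.quasiMeasurePreserving.ae h1
  -- The event of a large discrepancy among the first `m` terms.
  set bad₁ : Set (CouplingSpace 𝒱 n (A × Fin m) Ξ) := {y | ∃ a,
    t₁ < √(∑ t, (discrepancy P x z y.1 (y.2.1, y.2.2.1) (a, t)) ^ 2)} with hbad₁
  have h₁ : couplingMeasure P n κ bad₁ ≤ ENNReal.ofReal (3 / K ^ 2) := by
    have h1 := measure_discrepancy_gt_le (P := P) hxm hxb hb1 hc1 hc hn hK
    have h2 : MeasurePreserving (fun y : CouplingSpace 𝒱 n (A × Fin m) Ξ =>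
        (y.1, (y.2.1, y.2.2.1))) (couplingMeasure P n κ) ((Measure.pi fun _ : Fin n => P).prod
          ((stdGaussian (Fin n)).prod (stdGaussian (A × Fin m)))) :=
      (MeasurePreserving.id _).prod ((MeasurePreserving.id _).prod measurePreserving_fst)
    rw [← h2.map_eq] at h1
    rw [Fintype.card_fin] at h1
    exact (Measure.le_map_apply h2.measurable.aemeasurable _).trans h1
  -- The terms beyond the first `m`, by Markov's inequality.
  set F : CouplingSpace 𝒱 n (A × Fin m) Ξ → ℝ≥0∞ := fun y =>
    tailBound b h β' m y.2.1 y.1 fun a j => Z (η a j) (Λ y) with hF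
  have hFm : Measurable F := measurable_tailBound hh measurable_fst (by fun_prop)
    fun a j => (hZ.measurable _).comp hΛ.measurable
  have h₂ : couplingMeasure P n κ {y | ENNReal.ofReal t₂ < F y} ≤ ENNReal.ofReal (1 / K ^ 2) := by
    have h1 := measure_prod_gt_le (π := Measure.pi fun _ : Fin n => P)
      (κ := (stdGaussian (Fin n)).prod ((stdGaussian (A × Fin m)).prod κ)) (𝒢 := Set.univ) (q := 0)
      (by simp) hFm (M := ENNReal.ofReal (8 * b * √L * tail)) (fun v _ => by
        have hΛv : Measurable fun y => Λ (v, y) := hΛ.measurable.comp measurable_prodMk_left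
        refine lintegral_tailBound_le hn hb0 hh hb (fun j => (hβ0 j).le) hβ' v measurable_fst
          measurePreserving_fst.map_eq (fun a j => (hZ.measurable _).comp hΛv) fun a j => ?_
        refine ⟨‖η a j‖ ^ 2, pow_le_pow_left₀ (norm_nonneg _) (hηb a j) 2, ?_⟩
        have hlaw := hZ.law (η a j)
        change Measure.map _ ((stdGaussian (A × Fin m)).prod κ) = _ at hlaw
        rw [← hlaw]
        conv_rhs => rw [← map_couplingSource (κ := κ) (x := x) hz0 v]
        rw [Measure.map_map (hZ.measurable _) hΛv]
        rfl) (l := ENNReal.ofReal t₂) (by simpa using ht₂0) ENNReal.ofReal_ne_top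
    refine h1.trans (le_of_eq ?_)
    rw [zero_add, ← ENNReal.ofReal_div_of_pos ht₂0]
    congr 1
    rw [ht₂]
    field_simp
  refine ⟨bad₀ ∪ (bad₁ ∪ {y | ENNReal.ofReal t₂ < F y}), ?_, ?_⟩
  · refine (measure_union_le _ _).trans ?_
    rw [h₀, zero_add]
    refine (measure_union_le _ _).trans ((add_le_add h₁ h₂).trans (le_of_eq ?_))
    rw [← ENNReal.ofReal_add (by positivity) (by positivity)]
    congr 1
    ring
  intro y hy D β g a hD hβ hβD hg hgP hgy
  simp only [Set.mem_union, not_or] at hy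
  obtain ⟨hy₀, hy₁, hy₂⟩ := hy
  obtain ⟨⟨hysum, hycoh⟩, hyC⟩ := not_not.1 hy₀
  have hy₁' : √(∑ t, (discrepancy P x z y.1 (y.2.1, y.2.2.1) (a, t)) ^ 2) ≤ t₁ :=
    not_lt.1 fun hlt => hy₁ ⟨a, hlt⟩
  have hy₂' : F y ≤ ENNReal.ofReal t₂ := not_lt.1 hy₂
  have hWg : Z' (centredClass P g) (Λ y) = ∑' j, β j * Z (η a j) (Λ y) := by
    rw [← hycoh a β hβ, (hasSum_smul_centredClass (hh a) (hb a) hβ hβ' hg hgP).tsum_eq]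
  have hs1 := hasSum_multiplier y.2.1 y.1 hgy
  have hs2 : HasSum (fun j => β j * Z (η a j) (Λ y)) (Z' (centredClass P g) (Λ y)) := by
    rw [hWg]
    exact (summable_mul_of_abs_le (hysum a) hβ).hasSum
  have hs := hs1.sub hs2
  simp only [← mul_sub] at hs
  have hsplit := hs.summable.sum_add_tsum_nat_add m
  rw [hs.tsum_eq] at hsplit
  rw [← hsplit]
  refine (abs_add_le _ _).trans (add_le_add ?_ ?_)
  · have hd : ∀ t : Fin m, multiplier y.2.1 y.1 (h a t) - Z (η a t) (Λ y) =
        discrepancy P x z y.1 (y.2.1, y.2.2.1) (a, t) := fun t => by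
      rw [hyC (a, t), discrepancy, Pi.sub_apply, scoreMatrix_mulVec]
      rfl
    rw [Finset.sum_range]
    simp_rw [hd]
    have h1 := Finset.sum_mul_sq_le_sq_mul_sq Finset.univ (fun t : Fin m => β t)
      fun t => discrepancy P x z y.1 (y.2.1, y.2.2.1) (a, t)
    refine (Real.abs_le_sqrt h1).trans ?_
    rw [Real.sqrt_mul (Finset.sum_nonneg fun _ _ => sq_nonneg _)]
    rw [Finset.sum_range] at hβD
    exact mul_le_mul (Real.sqrt_le_iff.2 ⟨hD, hβD⟩) hy₁' (Real.sqrt_nonneg _) hD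
  · have h1 := (ofReal_abs_tsum_le_tailBound (h := h) hb0 hβ m y.2.1 y.1
      (fun a j => Z (η a j) (Λ y)) a).trans hy₂'
    exact (ENNReal.ofReal_le_ofReal_iff ht₂0.le).1 h1

end CouplingBound

/-! ### The enlarged probability space -/

section Enlargement

/-- Countably many independent standard normal variables, and independent standard normal variables
indexed by all real functions; the latter generate a Gaussian field on every `L²_P`. -/
abbrev AuxSpace (𝒱 : Type) : Type := (ℕ → ℝ) × ((𝒱 → ℝ) → ℝ)

/-- The law of the variables of the auxiliary space. -/
noncomputable def auxMeasure (𝒱 : Type) : Measure (AuxSpace 𝒱) :=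
  (Measure.infinitePi fun _ : ℕ => gaussianReal 0 1).prod
    (Measure.infinitePi fun _ : 𝒱 → ℝ => gaussianReal 0 1)

instance (𝒱 : Type) : IsProbabilityMeasure (auxMeasure 𝒱) := by
  unfold auxMeasure; infer_instance

theorem iIndepFun_eval_comp {I ι : Type*} {f : I → ι} (hf : Function.Injective f) :
    iIndepFun (fun i (x : ι → ℝ) => x (f i)) (Measure.infinitePi fun _ : ι => gaussianReal 0 1) :=
  (iIndepFun_infinitePi (P := fun _ : ι => gaussianReal 0 1) (X := fun _ (y : ℝ) => y)
    fun _ => measurable_id).precomp hf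

theorem measurePreserving_eval_comp {S ι : Type*} [Fintype S] {f : S → ι}
    (hf : Function.Injective f) :
    MeasurePreserving (fun (x : ι → ℝ) s => x (f s))
      (Measure.infinitePi fun _ : ι => gaussianReal 0 1) (stdGaussian S) := by
  have hm : ∀ s : S, Measurable fun x : ι → ℝ => x (f s) := fun s => measurable_pi_apply _
  refine ⟨measurable_pi_lambda _ hm, ?_⟩
  rw [(iIndepFun_iff_map_fun_eq_pi_map fun s => (hm s).aemeasurable).1 (iIndepFun_eval_comp hf)]
  congr 1
  funext s
  exact (measurePreserving_eval_infinitePi (fun _ : ι => gaussianReal 0 1) (f s)).map_eq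

/-- A Hilbert basis of `L²_P` is indexed by representatives of its members, so that the same family
of standard normal variables, indexed by all real functions, serves every `P`. -/
theorem exists_isGaussianField_Lp {𝒱 : Type} [MeasurableSpace 𝒱] (P : Measure 𝒱) :
    ∃ Z : Lp ℝ 2 P → ((𝒱 → ℝ) → ℝ) → ℝ,
      IsGaussianField Z (Measure.infinitePi fun _ : 𝒱 → ℝ => gaussianReal 0 1) := by
  obtain ⟨w, b, -⟩ := exists_hilbertBasis ℝ (Lp ℝ 2 P)
  have hinj : Function.Injective fun (i : w) => ((i : Lp ℝ 2 P) : 𝒱 → ℝ) := fun i j hij =>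
    Subtype.ext (Lp.ext (Eventually.of_forall fun v => congrFun hij v))
  exact exists_isGaussianField b
    (g := fun (i : w) (x : (𝒱 → ℝ) → ℝ) => x ((i : Lp ℝ 2 P) : 𝒱 → ℝ))
    (fun i => measurable_pi_apply _) (iIndepFun_eval_comp hinj)
    fun i => (measurePreserving_eval_infinitePi (fun _ : 𝒱 → ℝ => gaussianReal 0 1) _).map_eq

/-- An isonormal process may be pulled back to a larger probability space. -/
theorem IsIsonormal.comp_measurePreserving {𝒱 Ω Ω' : Type*} [MeasurableSpace 𝒱]
    [MeasurableSpace Ω] [MeasurableSpace Ω'] {P : Measure 𝒱} {W : (𝒱 → ℝ) → Ω → ℝ} {μ : Measure Ω}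
    {μ' : Measure Ω'} (hW : IsIsonormal P W μ) {Φ : Ω' → Ω} (hΦ : MeasurePreserving Φ μ' μ) :
    IsIsonormal P (fun f x => W f (Φ x)) μ' := by
  refine ⟨fun f hf => (hW.measurable f hf).comp hΦ.measurable, ⟨fun I => ⟨?_⟩⟩, fun f hf => ?_,
    fun f g hf hg => ?_, fun f g hf hg h => ?_⟩
  · have h1 := (hW.gaussian.hasGaussianLaw I).isGaussian_map
    have hm : Measurable fun ω =>
        I.restrict fun f : {f : 𝒱 → ℝ // MemLp f 2 P} => W f ω :=
      measurable_pi_lambda _ fun i => hW.measurable _ i.1.2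
    rw [← hΦ.map_eq, Measure.map_map hm hΦ.measurable] at h1
    exact h1
  · rw [← hW.mean_zero f hf, ← hΦ.map_eq, integral_map hΦ.measurable.aemeasurable
      (hW.measurable f hf).aestronglyMeasurable]
  · rw [← hW.cov f g hf hg, ← hΦ.map_eq, integral_map hΦ.measurable.aemeasurable
      ((hW.measurable f hf).fun_mul (hW.measurable g hg)).aestronglyMeasurable]
  · rw [hW.congr f g hf hg h]

theorem indepFun_comp_measurePreserving {Ω Ω' α β : Type*} [MeasurableSpace Ω] [MeasurableSpace Ω']
    [MeasurableSpace α] [MeasurableSpace β] {μ : Measure Ω} {μ' : Measure Ω'} {X : Ω → α}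
    {Y : Ω → β} (h : IndepFun X Y μ) (hX : Measurable X) (hY : Measurable Y) {Φ : Ω' → Ω}
    (hΦ : MeasurePreserving Φ μ' μ) : IndepFun (fun x => X (Φ x)) (fun x => Y (Φ x)) μ' := by
  rw [indepFun_iff_measure_inter_preimage_eq_mul] at h ⊢
  intro s t hs ht
  have h1 := h s t hs ht
  rw [← hΦ.measure_preimage ((hX hs).inter (hY ht)).nullMeasurableSet,
    ← hΦ.measure_preimage (hX hs).nullMeasurableSet,
    ← hΦ.measure_preimage (hY ht).nullMeasurableSet] at h1
  exact h1

variable {𝒱 : Type} [MeasurableSpace 𝒱] {P : Measure 𝒱} [IsProbabilityMeasure P] {Ω : Type*}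
  [MeasurableSpace Ω] {μ : Measure Ω} [IsProbabilityMeasure μ] {n : ℕ} {V : Fin n → Ω → 𝒱}
  {w : Fin n → Ω → ℝ}

omit [IsProbabilityMeasure P] in
/-- The randomization of the coupling as a function on the enlarged probability space. The auxiliary
standard normal vector, of arbitrary finite size, is read from the sequence of standard normal
variables. -/
theorem exists_measurePreserving_couplingMeasure (hVm : ∀ i, Measurable (V i))
    (hV : iIndepFun V μ) (hVP : ∀ i, μ.map (V i) = P) (hwm : ∀ i, Measurable (w i))
    (hw : iIndepFun w μ) (hwl : ∀ i, μ.map (w i) = gaussianReal 0 1)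
    (hVw : IndepFun (fun x i => V i x) (fun x i => w i x) μ) (S : Type*) [Fintype S] :
    ∃ Φ : Ω × AuxSpace 𝒱 → CouplingSpace 𝒱 n S ((𝒱 → ℝ) → ℝ),
      MeasurePreserving Φ (μ.prod (auxMeasure 𝒱))
        (couplingMeasure P n (Measure.infinitePi fun _ : 𝒱 → ℝ => gaussianReal 0 1)) ∧
      ∀ x, (Φ x).1 = (fun i => V i x.1) ∧ (Φ x).2.1 = fun i => w i x.1 := by
  obtain ⟨f, hf⟩ := Countable.exists_injective_nat S
  have hVm' : Measurable fun x i => V i x := measurable_pi_lambda _ hVm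
  have hwm' : Measurable fun x i => w i x := measurable_pi_lambda _ hwm
  have h1 : MeasurePreserving (fun x => ((fun i => V i x), fun i => w i x)) μ
      ((Measure.pi fun _ : Fin n => P).prod (stdGaussian (Fin n))) := by
    refine ⟨hVm'.prodMk hwm', ?_⟩
    rw [(indepFun_iff_map_prod_eq_prod_map_map hVm'.aemeasurable hwm'.aemeasurable).1 hVw,
      (iIndepFun_iff_map_fun_eq_pi_map fun i => (hVm i).aemeasurable).1 hV,
      (iIndepFun_iff_map_fun_eq_pi_map fun i => (hwm i).aemeasurable).1 hw]
    simp only [hVP, hwl]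
  have h2 := (measurePreserving_eval_comp hf).prod
    (MeasurePreserving.id (Measure.infinitePi fun _ : 𝒱 → ℝ => gaussianReal 0 1))
  have h3 := (measurePreserving_prodAssoc (Measure.pi fun _ : Fin n => P) (stdGaussian (Fin n))
    ((stdGaussian S).prod (Measure.infinitePi fun _ : 𝒱 → ℝ => gaussianReal 0 1))).comp (h1.prod h2)
  exact ⟨_, h3, fun x => ⟨rfl, rfl⟩⟩

/-- On the product of any space that carries the data and the weights with the auxiliary space there
is an isonormal process independent of the data. -/
theorem exists_isIsonormal_indepFun (P : Measure 𝒱) [IsProbabilityMeasure P] (μ : Measure Ω)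
    [IsProbabilityMeasure μ] (hVm : ∀ i, Measurable (V i)) :
    ∃ W : (𝒱 → ℝ) → Ω × AuxSpace 𝒱 → ℝ,
      IsIsonormal P W (μ.prod (auxMeasure 𝒱)) ∧
      IndepFun (fun x (f : {f : 𝒱 → ℝ // MemLp f 2 P}) => W f x) (fun x i => V i x.1)
        (μ.prod (auxMeasure 𝒱)) := by
  obtain ⟨Z, hZ⟩ := exists_isGaussianField_Lp P
  have h1 : MeasurePreserving (fun x : Ω × AuxSpace 𝒱 => x.2.2) (μ.prod (auxMeasure 𝒱))
      (Measure.infinitePi fun _ : 𝒱 → ℝ => gaussianReal 0 1) :=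
    measurePreserving_snd.comp (measurePreserving_snd (μ := μ) (ν := auxMeasure 𝒱))
  refine ⟨fun f x => Z (centredClass P f) x.2.2, hZ.isIsonormal h1, ?_⟩
  have h2 := indepFun_prod (μ := μ) (ν := auxMeasure 𝒱)
    (X := fun x i => V i x)
    (Y := fun e (f : {f : 𝒱 → ℝ // MemLp f 2 P}) => Z (centredClass P f) e.2)
    (measurable_pi_lambda _ hVm)
    (measurable_pi_lambda _ fun f => (hZ.measurable _).comp measurable_snd)
  exact h2.symm

variable {A : Type*} [Fintype A] {h : A → ℕ → 𝒱 → ℝ} {b : ℝ}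

/-- The coupling of `exists_isIsonormal_coupling` on the enlarged probability space. -/
theorem exists_isIsonormal_coupling_prod [Nonempty A] (hVm : ∀ i, Measurable (V i))
    (hV : iIndepFun V μ) (hVP : ∀ i, μ.map (V i) = P) (hwm : ∀ i, Measurable (w i))
    (hw : iIndepFun w μ) (hwl : ∀ i, μ.map (w i) = gaussianReal 0 1)
    (hVw : IndepFun (fun x i => V i x) (fun x i => w i x) μ)
    {m : ℕ} (hm : 0 < m) (hn : 0 < n)
    (hh : ∀ a j, Measurable (h a j)) (hb : ∀ a j v, |h a j v| ≤ b) (hb1 : 1 ≤ b) {c : ℝ}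
    (hc1 : 1 ≤ c) (hc : ∀ u : A × Fin m → ℝ,
      ∫ v, (∑ s, u s * h s.1 s.2 v) ^ 2 ∂P ≤ c * ∑ s, u s * u s) {β' : ℕ → ℝ}
    (hβ0 : ∀ j, 0 < β' j) (hβ' : Summable β') {N : Set 𝒱} (hN : P N = 0) :
    ∃ W : (𝒱 → ℝ) → Ω × AuxSpace 𝒱 → ℝ,
      IsIsonormal P W (μ.prod (auxMeasure 𝒱)) ∧
      IndepFun (fun x (f : {f : 𝒱 → ℝ // MemLp f 2 P}) => W f x) (fun x i => V i x.1)
        (μ.prod (auxMeasure 𝒱)) ∧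
      ∀ K : ℝ, 1 ≤ K → ∃ bad : Set (Ω × AuxSpace 𝒱),
        (μ.prod (auxMeasure 𝒱)) bad ≤ ENNReal.ofReal (4 / K ^ 2) ∧
        ∀ y ∉ bad, ∀ (D : ℝ) (β : ℕ → ℝ) (g : 𝒱 → ℝ) (a : A), 0 ≤ D → (∀ j, |β j| ≤ β' j) →
          ∑ j ∈ Finset.range m, β j ^ 2 ≤ D ^ 2 → Measurable g →
          (∀ v ∉ N, HasSum (fun j => h a j v * β j) (g v)) →
          |multiplier (fun i => w i y.1) (fun i => V i y.1) g - W g y| ≤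
            D * (28 * K ^ 3 * c * √(covRate b (Fintype.card (A × Fin m)) n) *
              √(m * logPlus (Fintype.card A))) +
            K ^ 2 * (8 * b * √(logPlus (Fintype.card A)) * ∑' j, β' (j + m)) := by
  classical
  obtain ⟨Z₁, hZ₁⟩ := exists_isGaussianField_Lp P
  obtain ⟨W, hW, hind, hbd⟩ :=
    exists_isIsonormal_coupling hm hn hh hb hb1 hc1 hc hβ0 hβ' hZ₁
  obtain ⟨Φ, hΦ, hΦeq⟩ := exists_measurePreserving_couplingMeasure hVm hV hVP hwm hw hwl hVw
    (A × Fin m)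
  have hVΦ : ∀ x, (Φ x).1 = fun i => V i x.1 := fun x => (hΦeq x).1
  have hwΦ : ∀ x, (Φ x).2.1 = fun i => w i x.1 := fun x => (hΦeq x).2
  refine ⟨fun f x => W f (Φ x), hW.comp_measurePreserving hΦ, ?_, fun K hK => ?_⟩
  · have h1 := indepFun_comp_measurePreserving hind
      (measurable_pi_lambda _ fun f => hW.measurable _ f.2) measurable_fst hΦ
    simp only [hVΦ] at h1
    exact h1
  · obtain ⟨bad, hbad, hgood⟩ := hbd K hK
    have hN' : (μ.prod (auxMeasure 𝒱)) {y | ∃ i, V i y.1 ∈ N} = 0 := by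
      have h1 : {y : Ω × AuxSpace 𝒱 | ∃ i, V i y.1 ∈ N} =
          ⋃ i, (fun y : Ω × AuxSpace 𝒱 => V i y.1) ⁻¹' N := by
        ext y; simp
      rw [h1]
      refine measure_iUnion_null fun i => ?_
      have h2 : MeasurePreserving (fun y : Ω × AuxSpace 𝒱 => V i y.1) (μ.prod (auxMeasure 𝒱)) P :=
        (⟨hVm i, hVP i⟩ : MeasurePreserving (V i) μ P).comp measurePreserving_fst
      exact h2.quasiMeasurePreserving.preimage_null hN
    refine ⟨Φ ⁻¹' bad ∪ {y | ∃ i, V i y.1 ∈ N}, ?_, ?_⟩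
    · refine (measure_union_le _ _).trans ?_
      rw [hN', add_zero]
      refine le_trans ?_ hbad
      rw [← hΦ.map_eq]
      exact Measure.le_map_apply hΦ.measurable.aemeasurable _
    · intro y hy D β g a hD hβ hβD hg hsum
      simp only [Set.mem_union, not_or, Set.mem_preimage] at hy
      have hVN : ∀ i, V i y.1 ∉ N := fun i hi => hy.2 ⟨i, hi⟩
      have h1 := hgood (Φ y) hy.1 D β g a hD hβ hβD hg
        (measure_mono_null (fun v hv => by_contra fun hvN => hv (hsum v hvN)) hN)
        (fun i => by rw [hVΦ]; exact hsum _ (hVN i))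
      rw [hVΦ, hwΦ] at h1
      exact h1

end Enlargement

/-! ### Consequences of the assumptions for one distribution and one sample size -/

section Assumptions

open Matrix

/-- A function that is essentially bounded by `b` has a version that is measurable and bounded by
`b` everywhere. -/
theorem exists_measurable_bounded_ae_eq {𝒱 : Type*} [MeasurableSpace 𝒱] {P : Measure 𝒱} {f : 𝒱 → ℝ}
    (hf : AEStronglyMeasurable f P) {b : ℝ} (hb : 0 ≤ b)
    (hfb : eLpNorm f ∞ P ≤ ENNReal.ofReal b) :
    ∃ g : 𝒱 → ℝ, Measurable g ∧ (∀ v, |g v| ≤ b) ∧ g =ᵐ[P] f := by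
  refine ⟨fun v => max (-b) (min (hf.mk f v) b), ?_, fun v => ?_, ?_⟩
  · exact measurable_const.max (hf.stronglyMeasurable_mk.measurable.min measurable_const)
  · exact abs_le.2 ⟨le_max_left _ _, max_le (by linarith) (min_le_right _ _)⟩
  · have h1 : ∀ᵐ v ∂P, ‖f v‖ₑ ≤ ENNReal.ofReal b := by
      rw [eLpNorm_exponent_top] at hfb
      filter_upwards [ae_le_eLpNormEssSup (f := f) (μ := P)] with v hv
      exact hv.trans hfb
    filter_upwards [h1, hf.ae_eq_mk] with v hv hv'
    rw [← hv']
    rw [← ofReal_norm, Real.norm_eq_abs, ENNReal.ofReal_le_ofReal_iff hb, abs_le] at hv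
    rw [min_eq_left hv.2, max_eq_right hv.1]

theorem dotProduct_mulVec_le_of_hasEigenvalue_le {S : Type*} [Fintype S] [DecidableEq S]
    {M : Matrix S S ℝ} (hM : M.IsHermitian) {c : ℝ}
    (hc : ∀ t : ℝ, Module.End.HasEigenvalue (Matrix.toLin' M) t → t ≤ c) (u : S → ℝ) :
    u ⬝ᵥ M *ᵥ u ≤ c * (u ⬝ᵥ u) := by
  have hN : (c • (1 : Matrix S S ℝ) - M).IsHermitian :=
    (isHermitian_one.smul (IsSelfAdjoint.all c)).sub hM
  have hpos : (c • (1 : Matrix S S ℝ) - M).PosSemidef := by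
    refine hN.posSemidef_iff_eigenvalues_nonneg.2 fun i => ?_
    have h1 := hN.mulVec_eigenvectorBasis i
    set v : S → ℝ := ⇑(hN.eigenvectorBasis i) with hv
    have hv0 : v ≠ 0 := fun h0 => by
      have h2 := hN.eigenvectorBasis.orthonormal.ne_zero i
      exact h2 (by ext s; exact congrFun h0 s)
    rw [sub_mulVec, smul_mulVec, one_mulVec] at h1
    have h3 : M *ᵥ v = (c - hN.eigenvalues i) • v := by
      rw [sub_smul, ← h1]; abel
    have h4 := hc _ (Module.End.hasEigenvalue_of_hasEigenvector
      ⟨Module.End.mem_eigenspace_iff.2 (by rw [toLin'_apply]; exact h3), hv0⟩)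
    simp only [Pi.zero_apply]
    linarith
  have h1 := hpos.dotProduct_mulVec_nonneg u
  rw [star_trivial, sub_mulVec, smul_mulVec, one_mulVec, dotProduct_sub, dotProduct_smul,
    smul_eq_mul] at h1
  linarith

/-- Bessel's inequality for the coefficients of an absolutely convergent expansion, which are the
inner products of the function with the orthonormal system. -/
theorem sum_sq_le_integral_sq {𝒱 : Type*} [MeasurableSpace 𝒱] {P : Measure 𝒱}
    [IsProbabilityMeasure P] {p : ℕ → 𝒱 → ℝ} {b : ℝ} (hp : ∀ j, MemLp (p j) 2 P)
    (hb : ∀ j, ∀ᵐ v ∂P, |p j v| ≤ b)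
    (horth : ∀ i j, ∫ v, p i v * p j v ∂P = if i = j then 1 else 0) {β : ℕ → ℝ}
    (hβ : Summable fun j => |β j|) {f : 𝒱 → ℝ} (hf : MemLp f 2 P)
    (hsum : ∀ᵐ v ∂P, HasSum (fun j => p j v * β j) (f v)) (m : ℕ) :
    ∑ j ∈ Finset.range m, β j ^ 2 ≤ ∫ v, f v ^ 2 ∂P := by
  have hb' : ∀ᵐ v ∂P, ∀ j, |p j v| ≤ b := ae_all_iff.2 hb
  have hb0 : 0 ≤ b := by
    obtain ⟨v, hv⟩ := hb'.exists
    exact (abs_nonneg _).trans (hv 0)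
  have hpp : ∀ i j, Integrable (fun v => p i v * p j v) P := fun i j =>
    (hp i).integrable_mul (hp j)
  have hfp : ∀ i, Integrable (fun v => f v * p i v) P := fun i => hf.integrable_mul (hp i)
  have hcoef : ∀ i, ∫ v, f v * p i v ∂P = β i := fun i => by
    have h1 : ∀ j, Integrable (fun v => β j * (p j v * p i v)) P := fun j => (hpp j i).const_mul _
    have h2 : Summable fun j => ∫ v, ‖β j * (p j v * p i v)‖ ∂P := by
      refine Summable.of_nonneg_of_le (fun j => integral_nonneg fun v => norm_nonneg _)
        (fun j => ?_) (hβ.mul_right (b * b))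
      calc _ ≤ ∫ v, |β j| * (b * b) ∂P := by
            refine integral_mono_ae (h1 j).norm (integrable_const _) ?_
            filter_upwards [hb'] with v hv
            simp only [norm_mul, Real.norm_eq_abs]
            have := hv j
            have := hv i
            gcongr
        _ = _ := by simp
    have h3 := hasSum_integral_of_summable_integral_norm h1 h2
    have h4 : ∫ v, f v * p i v ∂P = ∫ v, ∑' j, β j * (p j v * p i v) ∂P := by
      refine integral_congr_ae ?_
      filter_upwards [hsum] with v hv
      rw [← (hv.mul_right (p i v)).tsum_eq]
      exact tsum_congr fun j => by ring
    rw [h4, ← h3.tsum_eq]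
    simp_rw [integral_const_mul, horth]
    simp
  set s : 𝒱 → ℝ := fun v => ∑ j ∈ Finset.range m, β j * p j v with hs
  have hsm : MemLp s 2 P := memLp_finsetSum _ fun j _ => (hp j).const_mul _
  have hfs : ∫ v, f v * s v ∂P = ∑ j ∈ Finset.range m, β j ^ 2 := by
    have : ∀ v, f v * s v = ∑ j ∈ Finset.range m, β j * (f v * p j v) := fun v => by
      rw [hs, Finset.mul_sum]
      exact Finset.sum_congr rfl fun j _ => by ring
    simp_rw [this]
    rw [integral_finsetSum _ fun j _ => (hfp j).const_mul _]
    simp_rw [integral_const_mul, hcoef, pow_two]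
  have hss : ∫ v, s v * s v ∂P = ∑ j ∈ Finset.range m, β j ^ 2 := by
    have : ∀ v, s v * s v = ∑ i ∈ Finset.range m, ∑ j ∈ Finset.range m,
        β i * β j * (p i v * p j v) := fun v => by
      rw [hs, Finset.sum_mul_sum]
      exact Finset.sum_congr rfl fun i _ => Finset.sum_congr rfl fun j _ => by ring
    simp_rw [this]
    rw [integral_finsetSum _ fun i _ => integrable_finsetSum _ fun j _ => (hpp i j).const_mul _]
    simp_rw [integral_finsetSum _ fun j _ => (hpp _ j).const_mul _, integral_const_mul, horth]
    refine Finset.sum_congr rfl fun i hi => ?_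
    simp [hi, pow_two]
  have h0 : 0 ≤ ∫ v, (f v - s v) ^ 2 ∂P := integral_nonneg fun v => sq_nonneg _
  have h1 : ∀ v, (f v - s v) ^ 2 = f v ^ 2 - 2 * (f v * s v) + s v * s v := fun v => by ring
  have hi1 : Integrable (fun v => f v * s v) P := hf.integrable_mul hsm
  have hi2 : Integrable (fun v => s v * s v) P := hsm.integrable_mul hsm
  have hi3 : Integrable (fun v => f v ^ 2 - 2 * (f v * s v)) P :=
    hf.integrable_sq.sub (hi1.const_mul 2)
  simp_rw [h1] at h0
  rw [integral_add hi3 hi2, integral_sub hf.integrable_sq (hi1.const_mul 2), integral_const_mul,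
    hfs, hss] at h0
  linarith

/-- The comparison of the `ℓ^r` norm with the maximum norm. -/
theorem rNorm_le_of_abs_le {ι : Type*} [Fintype ι] {r : ℝ≥0∞} (hr : 2 ≤ r) {a : ι → ℝ} {X : ℝ}
    (hX : 0 ≤ X) (ha : ∀ i, |a i| ≤ X) :
    rNorm r a ≤ (Fintype.card ι : ℝ) ^ (1 / r).toReal * X := by
  have : Fact (1 ≤ r) := ⟨one_le_two.trans hr⟩
  have h1 := (PiLp.antilipschitzWith_ofLp r fun _ : ι => ℝ).le_mul_dist (WithLp.toLp r a) 0
  rw [dist_zero_right] at h1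
  have h2 : dist (WithLp.ofLp (WithLp.toLp r a)) (WithLp.ofLp (0 : PiLp r fun _ : ι => ℝ)) ≤ X := by
    rw [WithLp.ofLp_zero, dist_zero_right]
    exact (pi_norm_le_iff_of_nonneg hX).2 ha
  refine h1.trans ?_
  push_cast
  exact mul_le_mul_of_nonneg_left h2 (by positivity)

/-- The sum of `M (j + 1) ^ (-γ)` over `j ≥ m` is at most of the order `M m ^ (-(γ - 3 / 2))`: the
factor `(j + 1) ^ (-3 / 2)` is summable, and the other one is at most `m ^ (-(γ - 3 / 2))`. -/
theorem tsum_rpow_tail_le {M γ : ℝ} (hM : 0 ≤ M) (hγ : 3 / 2 < γ) {m : ℕ} (hm : 0 < m) :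
    ∑' j : ℕ, M / (((j + m : ℕ) : ℝ) + 1) ^ γ ≤
      (∑' j : ℕ, 1 / ((j : ℝ) + 1) ^ (3 / 2 : ℝ)) * (M / (m : ℝ) ^ (γ - 3 / 2)) := by
  have hs : Summable fun j : ℕ => 1 / ((j : ℝ) + 1) ^ (3 / 2 : ℝ) := by
    have h1 := (Real.summable_one_div_nat_rpow (p := 3 / 2)).2 (by norm_num)
    have h2 := (summable_nat_add_iff 1).2 h1
    simpa using h2
  have hmR : (0 : ℝ) < m := by exact_mod_cast hm
  rw [← tsum_mul_right]
  have hle : ∀ j : ℕ, M / (((j + m : ℕ) : ℝ) + 1) ^ γ ≤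
      1 / ((j : ℝ) + 1) ^ (3 / 2 : ℝ) * (M / (m : ℝ) ^ (γ - 3 / 2)) := fun j => by
    have hj : (0 : ℝ) < ((j + m : ℕ) : ℝ) + 1 := by positivity
    rw [div_mul_div_comm, one_mul]
    refine div_le_div_of_nonneg_left hM (by positivity) ?_
    have h1 : (((j + m : ℕ) : ℝ) + 1) ^ γ =
        (((j + m : ℕ) : ℝ) + 1) ^ (3 / 2 : ℝ) * (((j + m : ℕ) : ℝ) + 1) ^ (γ - 3 / 2) := by
      rw [← Real.rpow_add hj]
      congr 1
      ring
    rw [h1]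
    push_cast
    gcongr
    · linarith
    · linarith
  have hs2 := hs.mul_right (M / (m : ℝ) ^ (γ - 3 / 2))
  exact Summable.tsum_le_tsum hle
    (Summable.of_nonneg_of_le (fun j => by positivity) hle hs2) hs2

end Assumptions

/-! ### The rate -/

section Rate

theorem logPlus_pos (k : ℕ) : 0 < logPlus k := lt_of_lt_of_le one_pos (le_max_right _ _)

/-- For `m ≥ 3` one has `log m ≥ 1`, and `log (k m) + 1` is at most three times the product of
`log_+ k` and `log m`. -/
theorem sqrt_covRate_le {k m n : ℕ} (hk : 0 < k) (hm : 3 ≤ m) {C B : ℝ} (hC : 1 ≤ C) (hB : 1 ≤ B) :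
    √(covRate (C * B) (k * m) n) ≤ 2 * C * (B ^ (1 / 2 : ℝ) * ((k : ℝ) ^ (1 / 4 : ℝ) *
      ((m : ℝ) * logPlus k) ^ (1 / 4 : ℝ) * Real.log m ^ (1 / 4 : ℝ) / (n : ℝ) ^ (1 / 4 : ℝ))) := by
  have hL := logPlus_pos k
  have hL1 : 1 ≤ logPlus k := le_max_right _ _
  have hLk : Real.log k ≤ logPlus k := le_max_left _ _
  have hkR : (0 : ℝ) < k := by exact_mod_cast hk
  have hm3 : (3 : ℝ) ≤ m := by exact_mod_cast hm
  have hmR : (0 : ℝ) < m := by linarith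
  have hlogm : 1 ≤ Real.log m := by
    rw [Real.le_log_iff_exp_le hmR]
    linarith [Real.exp_one_lt_d9]
  have hd : (((k * m : ℕ) : ℝ) * (Real.log (k * m : ℕ) + 1) / n) ≤
      3 * (k * (m * logPlus k) * Real.log m / n) := by
    push_cast
    rw [Real.log_mul hkR.ne' hmR.ne', ← mul_div_assoc]
    refine div_le_div_of_nonneg_right ?_ (Nat.cast_nonneg n)
    have h1 : Real.log k + Real.log m + 1 ≤ 3 * (logPlus k * Real.log m) := by nlinarith
    calc (k : ℝ) * m * (Real.log k + Real.log m + 1)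
        ≤ k * m * (3 * (logPlus k * Real.log m)) := by gcongr
      _ = _ := by ring
  have hw0 : (0 : ℝ) ≤ k * (m * logPlus k) * Real.log m / n := by positivity
  have h4 : ∀ y : ℝ, 0 ≤ y → √(√y) = y ^ (1 / 4 : ℝ) := fun y hy => by
    rw [Real.sqrt_eq_rpow, Real.sqrt_eq_rpow, ← Real.rpow_mul hy]
    norm_num
  have h3 : (3 : ℝ) ^ (1 / 4 : ℝ) ≤ 2 := by
    calc (3 : ℝ) ^ (1 / 4 : ℝ) ≤ 16 ^ (1 / 4 : ℝ) := by gcongr; norm_num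
      _ = (2 ^ (4 : ℝ)) ^ (1 / 4 : ℝ) := by norm_num
      _ = 2 := by rw [← Real.rpow_mul (by norm_num)]; norm_num
  have hCs : √C ≤ C := Real.sqrt_le_iff.2 ⟨by linarith, by nlinarith⟩
  have hB0 : 0 ≤ B := by linarith
  calc √(covRate (C * B) (k * m) n)
      = √C * B ^ (1 / 2 : ℝ) *
          √(√(((k * m : ℕ) : ℝ) * (Real.log (k * m : ℕ) + 1) / n)) := by
        rw [covRate, Real.sqrt_mul (by positivity), Real.sqrt_mul (by positivity),
          ← Real.sqrt_eq_rpow]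
    _ ≤ C * B ^ (1 / 2 : ℝ) * √(√(3 * (k * (m * logPlus k) * Real.log m / n))) := by
        gcongr
    _ = C * B ^ (1 / 2 : ℝ) * (3 ^ (1 / 4 : ℝ) * ((k : ℝ) ^ (1 / 4 : ℝ) *
          ((m : ℝ) * logPlus k) ^ (1 / 4 : ℝ) * Real.log m ^ (1 / 4 : ℝ) /
            (n : ℝ) ^ (1 / 4 : ℝ))) := by
        rw [h4 _ (by positivity), Real.mul_rpow (by norm_num) hw0,
          Real.div_rpow (by positivity) (Nat.cast_nonneg n), Real.mul_rpow (by positivity)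
          (by positivity), Real.mul_rpow hkR.le (by positivity)]
    _ ≤ C * B ^ (1 / 2 : ℝ) * (2 * ((k : ℝ) ^ (1 / 4 : ℝ) *
          ((m : ℝ) * logPlus k) ^ (1 / 4 : ℝ) * Real.log m ^ (1 / 4 : ℝ) /
            (n : ℝ) ^ (1 / 4 : ℝ))) := by
        gcongr
    _ = _ := by ring

/-- The error of `exists_isIsonormal_coupling` in terms of `couplingRate`. -/
theorem coupling_error_le {r : ℝ≥0∞} {γ : ℝ} {k m n : ℕ} (hk : 0 < k) (hm : 3 ≤ m)
    {C B c D M K ζ τ : ℝ} (hC : 1 ≤ C) (hB : 1 ≤ B) (hc : 1 ≤ c) (hD : 0 ≤ D) (hM : 0 ≤ M)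
    (hK : 1 ≤ K) (hζ : 0 ≤ ζ) (hτ : τ ≤ ζ * (M / (m : ℝ) ^ (γ - 3 / 2))) :
    (k : ℝ) ^ (1 / r).toReal * (D * (28 * K ^ 3 * c * √(covRate (C * B) (k * m) n) *
        √(m * logPlus k)) + K ^ 2 * (8 * (C * B) * √(logPlus k) * τ)) ≤
      (K ^ 3 * c * C * (56 + 8 * ζ)) * couplingRate r γ n m k D B M := by
  have hL := logPlus_pos k
  have hkR : (0 : ℝ) < k := by exact_mod_cast hk
  have hmR : (0 : ℝ) < m := by exact_mod_cast (by omega : 0 < m)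
  have hlog : 0 ≤ Real.log m := Real.log_natCast_nonneg m
  set ρ := (1 / r).toReal with hρ
  set R₁ := D * B ^ (1 / 2 : ℝ) * (k : ℝ) ^ (1 / 4 + ρ) * ((m : ℝ) * logPlus k) ^ (3 / 4 : ℝ) *
      Real.log m ^ (1 / 4 : ℝ) / (n : ℝ) ^ (1 / 4 : ℝ) with hR₁
  set R₂ := (k : ℝ) ^ ρ * B * M * √(logPlus k) / (m : ℝ) ^ (γ - 3 / 2) with hR₂
  have hB0 : 0 ≤ B := by linarith
  have hR₁0 : 0 ≤ R₁ := by positivity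
  have hR₂0 : 0 ≤ R₂ := by positivity
  have h1 : (k : ℝ) ^ ρ * (D * (28 * K ^ 3 * c * √(covRate (C * B) (k * m) n) *
      √(m * logPlus k))) ≤ 56 * (K ^ 3 * c * C) * R₁ := by
    have e1 := sqrt_covRate_le (n := n) hk hm hC hB
    have e2 : √((m : ℝ) * logPlus k) = ((m : ℝ) * logPlus k) ^ (1 / 2 : ℝ) := Real.sqrt_eq_rpow _
    have e3 : ((m : ℝ) * logPlus k) ^ (3 / 4 : ℝ) =
        ((m : ℝ) * logPlus k) ^ (1 / 4 : ℝ) * ((m : ℝ) * logPlus k) ^ (1 / 2 : ℝ) := by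
      rw [← Real.rpow_add (by positivity)]
      norm_num
    have e4 : (k : ℝ) ^ (1 / 4 + ρ) = (k : ℝ) ^ (1 / 4 : ℝ) * (k : ℝ) ^ ρ := Real.rpow_add hkR _ _
    calc _ ≤ (k : ℝ) ^ ρ * (D * (28 * K ^ 3 * c * (2 * C * (B ^ (1 / 2 : ℝ) *
          ((k : ℝ) ^ (1 / 4 : ℝ) * ((m : ℝ) * logPlus k) ^ (1 / 4 : ℝ) *
            Real.log m ^ (1 / 4 : ℝ) / (n : ℝ) ^ (1 / 4 : ℝ)))) * √(m * logPlus k))) := by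
          gcongr
      _ = _ := by
          rw [hR₁, e2, e3, e4]
          ring
  have h2 : (k : ℝ) ^ ρ * (K ^ 2 * (8 * (C * B) * √(logPlus k) * τ)) ≤
      8 * ζ * (K ^ 3 * c * C) * R₂ := by
    calc _ ≤ (k : ℝ) ^ ρ * (K ^ 2 * (8 * (C * B) * √(logPlus k) *
          (ζ * (M / (m : ℝ) ^ (γ - 3 / 2))))) := by gcongr
      _ = 8 * ζ * (K ^ 2 * 1 * C) * R₂ := by rw [hR₂]; ring
      _ ≤ 8 * ζ * (K ^ 3 * c * C) * R₂ := by
          gcongr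
          norm_num
  have hrate : couplingRate r γ n m k D B M = R₁ + R₂ := rfl
  rw [hrate, mul_add]
  have hQ : 0 ≤ K ^ 3 * c * C := by positivity
  nlinarith [mul_nonneg (mul_nonneg hζ hQ) hR₁0, mul_nonneg hQ hR₂0]

end Rate

/-! ### The bootstrap coupling -/

section Bootstrap

open Matrix

theorem card_instrIdx {J : ℕ} (k : Fin J → ℕ) : Fintype.card (InstrIdx k) = totalInstr k := by
  simp [InstrIdx, totalInstr]

theorem integral_sq_le_of_eLpNorm_le {𝒱 : Type*} [MeasurableSpace 𝒱] {P : Measure 𝒱} {f F : 𝒱 → ℝ}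
    (hf : Measurable f) (hfF : ∀ v, |f v| ≤ F v) {D : ℝ} (hD : 0 ≤ D)
    (hF : eLpNorm F 2 P ≤ ENNReal.ofReal D) : MemLp f 2 P ∧ ∫ v, f v ^ 2 ∂P ≤ D ^ 2 := by
  have h1 : eLpNorm f 2 P ≤ ENNReal.ofReal D := (eLpNorm_mono_real hfF).trans hF
  have hmem : MemLp f 2 P := ⟨hf.aestronglyMeasurable, h1.trans_lt ENNReal.ofReal_lt_top⟩
  refine ⟨hmem, ?_⟩
  rw [hmem.eLpNorm_eq_integral_rpow_norm two_ne_zero ENNReal.ofNat_ne_top,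
    ENNReal.ofReal_le_ofReal_iff hD] at h1
  simp only [ENNReal.toReal_ofNat, Real.norm_eq_abs, Real.rpow_two, sq_abs] at h1
  rw [← one_div, ← Real.sqrt_eq_rpow] at h1
  exact (Real.sqrt_le_left hD).1 h1

theorem gram_isHermitian {dx J : ℕ} {dz : Fin J → ℕ} {k : Fin J → ℕ} (P : Measure (Obs dx dz))
    (q : (j : Fin J) → Fin (k j) → (Fin (dz j) → ℝ) → ℝ) (p : ℕ → Obs dx dz → ℝ) (m : ℕ) :
    (gram P q p m).IsHermitian := by
  ext s t
  simp only [gram, conjTranspose_apply, of_apply, star_trivial]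
  exact integral_congr_ae (ae_of_all _ fun v => mul_comm _ _)

theorem summable_div_rpow {M γ : ℝ} (hγ : 3 / 2 < γ) :
    Summable fun j : ℕ => M / ((j : ℝ) + 1) ^ γ := by
  have h1 := (Real.summable_one_div_nat_rpow (p := γ)).2 (by linarith)
  have h2 := ((summable_nat_add_iff 1).2 h1).mul_left M
  simpa [mul_one_div, div_eq_mul_inv] using h2

/-- The coupling for one distribution and one sample size, with constants that depend only on the
bounds in the assumptions. -/
theorem exists_bootstrap_coupling {dx J : ℕ} {dz : Fin J → ℕ} {Ω : Type*} [MeasurableSpace Ω]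
    {μ : Measure Ω} [IsProbabilityMeasure μ] {P : Measure (Obs dx dz)} [IsProbabilityMeasure P]
    {n : ℕ} (hn : 0 < n) {V : Fin n → Ω → Obs dx dz} {w : Fin n → Ω → ℝ}
    (hVm : ∀ i, Measurable (V i)) (hV : iIndepFun V μ) (hVP : ∀ i, μ.map (V i) = P)
    (hwm : ∀ i, Measurable (w i)) (hw : iIndepFun w μ) (hwl : ∀ i, μ.map (w i) = gaussianReal 0 1)
    (hVw : IndepFun (fun x i => V i x) (fun x i => w i x) μ)
    {r : ℝ≥0∞} (hr : 2 ≤ r) {k : Fin J → ℕ}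
    {q : (j : Fin J) → Fin (k j) → (Fin (dz j) → ℝ) → ℝ} {B : ℝ} (hB : 1 ≤ B)
    (hqm : ∀ j l, Measurable (q j l))
    (hqB : ∀ a : InstrIdx k, eLpNorm (instr (dx := dx) q a) ∞ P ≤ ENNReal.ofReal B)
    {ℱ : Set (Obs dx dz → ℝ)} {F : Obs dx dz → ℝ}
    (hF : ∀ f ∈ ℱ, Measurable f ∧ ∀ v, |f v| ≤ F v) {D : ℝ} (hD : 0 ≤ D)
    (hFD : eLpNorm F 2 P ≤ ENNReal.ofReal D)
    {p : ℕ → Obs dx dz → ℝ} (hp : ∀ j, MemLp (p j) 2 P)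
    (horth : ∀ i j, ∫ v, p i v * p j v ∂P = if i = j then 1 else 0) {C : ℝ} (hC : 1 ≤ C)
    (hpC : ∀ j, eLpNorm (p j) ∞ P ≤ ENNReal.ofReal C) {m : ℕ} (hm : 3 ≤ m) {c : ℝ} (hc : 1 ≤ c)
    (heig : ∀ t : ℝ, Module.End.HasEigenvalue (Matrix.toLin' (gram P q p m)) t → t ≤ c)
    {M γ : ℝ} (hM : 0 < M) (hγ : 3 / 2 < γ) {N : Set (Obs dx dz)} (hN : P N = 0)
    (hexp : ∀ f ∈ ℱ, ∃ β : ℕ → ℝ, (∀ j : ℕ, |β j| ≤ M / ((j : ℝ) + 1) ^ γ) ∧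
      ∀ v, v ∉ N → HasSum (fun j => p j v * β j) (f v)) :
    ∃ W : (Obs dx dz → ℝ) → Ω × AuxSpace (Obs dx dz) → ℝ,
      IsIsonormal P W (μ.prod (auxMeasure _)) ∧
      IndepFun (fun x (f : {f : Obs dx dz → ℝ // MemLp f 2 P}) => W f x) (fun x i => V i x.1)
        (μ.prod (auxMeasure _)) ∧
      ∀ K : ℝ, 1 ≤ K → (μ.prod (auxMeasure _)) {x |
        ENNReal.ofReal ((K ^ 3 * c * C * (56 + 8 * ∑' j : ℕ, 1 / ((j : ℝ) + 1) ^ (3 / 2 : ℝ))) *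
            couplingRate r γ n m (totalInstr k) D B M) <
          ⨆ f ∈ ℱ, ENNReal.ofReal (rNorm r fun a : InstrIdx k =>
            multiplier (fun i => w i x.1) (fun i => V i x.1) (fun v => f v * instr q a v) -
              W (fun v => f v * instr q a v) x)} ≤ ENNReal.ofReal (4 / K ^ 2) := by
  -- Without instruments the supremum is zero.
  rcases isEmpty_or_nonempty (InstrIdx k) with hA | hA
  · obtain ⟨W, hW, hind⟩ := exists_isIsonormal_indepFun P μ hVm
    refine ⟨W, hW, hind, fun K hK => ?_⟩
    have h1 : ∀ a : InstrIdx k → ℝ, rNorm r a ≤ 0 := fun a =>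
      (rNorm_le_of_abs_le hr le_rfl fun i => isEmptyElim i).trans (by simp)
    simp only [ENNReal.ofReal_of_nonpos (h1 _)]
    simp
  have hCn : 0 ≤ C := by linarith
  have hBn : 0 ≤ B := by linarith
  have hqm' : ∀ a : InstrIdx k, Measurable (instr (dx := dx) (dz := dz) q a) := fun a =>
    (hqm a.1 a.2).comp ((measurable_pi_apply a.1).comp measurable_snd)
  -- Bounded measurable versions of the approximating functions and of the instruments.
  choose p' hp'm hp'b hp'e using fun j => exists_measurable_bounded_ae_eq (hp j).1 hCn (hpC j)
  choose q' hq'm hq'b hq'e using fun a : InstrIdx k =>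
    exists_measurable_bounded_ae_eq (hqm' a).aestronglyMeasurable hBn (hqB a)
  set h : InstrIdx k → ℕ → Obs dx dz → ℝ := fun a j v => q' a v * p' j v with hh
  have hhm : ∀ a j, Measurable (h a j) := fun a j => (hq'm a).mul (hp'm j)
  have hhb : ∀ a j v, |h a j v| ≤ C * B := fun a j v => by
    rw [hh, abs_mul, mul_comm C]
    exact mul_le_mul (hq'b a v) (hp'b j v) (abs_nonneg _) hBn
  have hae : ∀ᵐ v ∂P, v ∉ N ∧ ∀ a j, h a j v = instr q a v * p j v := by
    have h1 : ∀ᵐ v ∂P, ∀ a, q' a v = instr q a v := ae_all_iff.2 hq'e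
    have h2 : ∀ᵐ v ∂P, ∀ j, p' j v = p j v := ae_all_iff.2 hp'e
    filter_upwards [h1, h2, measure_eq_zero_iff_ae_notMem.1 hN] with v hv1 hv2 hv3
    refine ⟨hv3, fun a j => ?_⟩
    simp only [hh, hv1, hv2]
  -- A null set that serves all the functions of the class, as the expansions do.
  set N' : Set (Obs dx dz) := {v | ¬ (v ∉ N ∧ ∀ a j, h a j v = instr q a v * p j v)} with hN'
  have hN'0 : P N' = 0 := hae
  have hhmem : ∀ s : InstrIdx k × Fin m, MemLp (fun v => h s.1 s.2 v) 2 P := fun s =>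
    MemLp.of_bound (hhm _ _).aestronglyMeasurable (C * B) (ae_of_all _ fun v => hhb _ _ v)
  have hquad : ∀ u : InstrIdx k × Fin m → ℝ,
      ∫ v, (∑ s, u s * h s.1 s.2 v) ^ 2 ∂P ≤ c * ∑ s, u s * u s := fun u => by
    have h0 := integral_sq_sum_eq_dotProduct (P := P)
      (x := fun (s : InstrIdx k × Fin m) v => h s.1 s.2 v) hhmem u
    refine (le_of_eq h0).trans ?_
    have h1 : (of fun s t => ∫ v, h s.1 s.2 v * h t.1 t.2 v ∂P :
        Matrix (InstrIdx k × Fin m) (InstrIdx k × Fin m) ℝ) = gram P q p m := by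
      ext s t
      simp only [gram, of_apply]
      refine integral_congr_ae ?_
      filter_upwards [hae] with v hv
      rw [hv.2, hv.2]
    rw [h1]
    exact dotProduct_mulVec_le_of_hasEigenvalue_le (gram_isHermitian P q p m) heig u
  have hβ0 : ∀ j : ℕ, 0 < M / ((j : ℝ) + 1) ^ γ := fun j => by positivity
  have hβs := summable_div_rpow (M := M) hγ
  obtain ⟨W, hW, hind, hbd⟩ := exists_isIsonormal_coupling_prod hVm hV hVP hwm hw hwl hVw
    (by omega : 0 < m) hn hhm hhb (one_le_mul_of_one_le_of_one_le hC hB) hc hquad hβ0 hβs hN'0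
  refine ⟨W, hW, hind, fun K hK => ?_⟩
  obtain ⟨bad, hbad, hgood⟩ := hbd K hK
  refine (measure_mono fun x hx => ?_).trans hbad
  by_contra hxb
  refine absurd (show _ from hx) (not_lt (α := ℝ≥0∞).2 ?_)
  set ζ := ∑' j : ℕ, 1 / ((j : ℝ) + 1) ^ (3 / 2 : ℝ) with hζ
  have hζ0 : 0 ≤ ζ := tsum_nonneg fun j => by positivity
  have htail0 : 0 ≤ ∑' j : ℕ, M / (((j + m : ℕ) : ℝ) + 1) ^ γ :=
    tsum_nonneg fun j => (hβ0 _).le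
  refine iSup₂_le fun f hf => ENNReal.ofReal_le_ofReal ?_
  obtain ⟨β, hβ, hβf⟩ := hexp f hf
  obtain ⟨hfm, hfF⟩ := hF f hf
  obtain ⟨hfmem, hfD⟩ := integral_sq_le_of_eLpNorm_le hfm hfF hD hFD
  have hbessel : ∑ j ∈ Finset.range m, β j ^ 2 ≤ D ^ 2 := by
    refine le_trans (sum_sq_le_integral_sq (b := C) hp (fun j => ?_) horth ?_ hfmem ?_ m) hfD
    · filter_upwards [hp'e j] with v hv
      rw [← hv]
      exact hp'b j v
    · exact Summable.of_nonneg_of_le (fun j => abs_nonneg _) hβ hβs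
    · filter_upwards [hae] with v hv
      exact hβf v hv.1
  have hLn : 0 ≤ logPlus (totalInstr k) := (logPlus_pos _).le
  have herr : ∀ a : InstrIdx k,
      |multiplier (fun i => w i x.1) (fun i => V i x.1) (fun v => f v * instr q a v) -
        W (fun v => f v * instr q a v) x| ≤
      D * (28 * K ^ 3 * c * √(covRate (C * B) (totalInstr k * m) n) *
          √(m * logPlus (totalInstr k))) +
        K ^ 2 * (8 * (C * B) * √(logPlus (totalInstr k)) *
          ∑' j : ℕ, M / (((j + m : ℕ) : ℝ) + 1) ^ γ) := fun a => by
    have h1 := hgood x hxb D β (fun v => f v * instr q a v) a hD hβ hbessel (hfm.mul (hqm' a))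
      fun v hv => by
        have hv' := not_not.1 hv
        have h2 := (hβf v hv'.1).mul_right (instr q a v)
        have h3 : (fun j => h a j v * β j) = fun j => p j v * β j * instr q a v := by
          funext j
          rw [hv'.2 a j]
          ring
        rw [h3]
        exact h2
    rw [Fintype.card_prod, Fintype.card_fin, card_instrIdx] at h1
    exact h1
  refine (rNorm_le_of_abs_le hr ?_ herr).trans ?_
  · positivity
  · rw [card_instrIdx]
    exact coupling_error_le (by rw [← card_instrIdx]; exact Fintype.card_pos) hm hC hB hc hD hM.le hK
      hζ0 (tsum_rpow_tail_le hM.le hγ (by omega))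

end Bootstrap

theorem envSup_lt_top {𝒱 : Type*} [MeasurableSpace 𝒱] {Ps : Set (Measure 𝒱)} {F : 𝒱 → ℝ}
    (hF : (⨆ P ∈ Ps, ∫⁻ v, ENNReal.ofReal (F v ^ 2) ∂P) < ∞) : envSup Ps F < ∞ := by
  set S := ⨆ P ∈ Ps, ∫⁻ v, ENNReal.ofReal (F v ^ 2) ∂P with hS
  refine lt_of_le_of_lt (b := S ^ (1 / 2 : ℝ)) (iSup₂_le fun P hP => ?_)
    (ENNReal.rpow_lt_top_of_nonneg (by norm_num) hF.ne)
  rw [eLpNorm_eq_lintegral_rpow_enorm_toReal two_ne_zero ENNReal.ofNat_ne_top,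
    ENNReal.toReal_ofNat]
  refine ENNReal.rpow_le_rpow ?_ (by norm_num)
  refine le_trans (le_of_eq (lintegral_congr fun v => ?_))
    (le_iSup₂ (f := fun P (_ : P ∈ Ps) => ∫⁻ v, ENNReal.ofReal (F v ^ 2) ∂P) P hP)
  rw [← ofReal_norm, Real.norm_eq_abs, ENNReal.ofReal_rpow_of_nonneg (abs_nonneg _) (by norm_num),
    Real.rpow_two, sq_abs]

end MultiplierBootstrap

open MultiplierBootstrap in
theorem mainTheorem7 {dx J : ℕ} {dz : Fin J → ℕ}
    {Ω : Type*} [MeasurableSpace Ω]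
    (Ps : Set (Measure (Obs dx dz))) (μ : Measure (Obs dx dz) → Measure Ω)
    (hμ : ∀ P ∈ Ps, IsProbabilityMeasure (μ P))
    (V : ℕ → Ω → Obs dx dz) (hV : IsIIDSample Ps μ V)
    (w : (n : ℕ) → Fin n → Ω → ℝ) (hw : IsGaussianMultiplier Ps μ V w)
    (r : ℝ≥0∞) (hr : 2 ≤ r)
    (k : ℕ → Fin J → ℕ)
    (q : (n : ℕ) → (j : Fin J) → Fin (k n j) → (Fin (dz j) → ℝ) → ℝ)
    (B : ℕ → ℝ) (hq : InstrBounded Ps k q B)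
    (ℱ : ℕ → Set (Obs dx dz → ℝ)) (F : ℕ → Obs dx dz → ℝ) (hF : HasEnvelope Ps ℱ F)
    (p : Measure (Obs dx dz) → ℕ → ℕ → Obs dx dz → ℝ) (M : ℕ → ℝ) (γ : ℝ)
    (hp : SmoothClass Ps k q ℱ p M γ)
    (m : ℕ → ℕ) (hm_mono : Monotone m) (hm : Tendsto m atTop atTop)
    (hrate : (fun n => (m n : ℝ) * totalInstr (k n) * Real.log (m n * totalInstr (k n)) * B n)
      =o[Filter.atTop] (fun n => (n : ℝ))) :
    ∃ (E : Type) (_ : MeasurableSpace E) (ν : Measure E) (_ : IsProbabilityMeasure ν)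
      (W : Measure (Obs dx dz) → ℕ → (Obs dx dz → ℝ) → Ω × E → ℝ),
      (∀ P ∈ Ps, ∀ n, IsIsonormal P (W P n) ((μ P).prod ν) ∧
        IndepFun (fun x (f : {f : Obs dx dz → ℝ // MemLp f 2 P}) => W P n f x)
          (fun x (i : Fin n) => V i x.1) ((μ P).prod ν)) ∧
      UniformBigOp Ps (fun P => (μ P).prod ν)
        (fun P n x => ⨆ f ∈ ℱ n, ENNReal.ofReal (rNorm r fun a : InstrIdx (k n) =>
          multiplier (fun i => w n i x.1) (fun i => V i x.1) (fun v => f v * instr (q n) a v) -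
            W P n (fun v => f v * instr (q n) a v) x))
        (fun n => couplingRate r γ n (m n) (totalInstr (k n)) (envSup Ps (F n)).toReal (B n) (M n))
      := by
  classical
  obtain ⟨C₀, hC₀⟩ := hp.bounded
  obtain ⟨c₀, hc₀⟩ := hp.eigenvalues m hm_mono hm
  set C := max C₀ 1 with hC
  set c := max c₀ 1 with hc
  have hC1 : 1 ≤ C := le_max_right _ _
  have hc1 : 1 ≤ c := le_max_right _ _
  set ζ := ∑' j : ℕ, 1 / ((j : ℝ) + 1) ^ (3 / 2 : ℝ) with hζ
  have hζ0 : 0 ≤ ζ := tsum_nonneg fun j => by positivity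
  have hW : ∀ P n, ∃ W : (Obs dx dz → ℝ) → Ω × AuxSpace (Obs dx dz) → ℝ, P ∈ Ps →
      IsIsonormal P W ((μ P).prod (auxMeasure _)) ∧
      IndepFun (fun x (f : {f : Obs dx dz → ℝ // MemLp f 2 P}) => W f x)
        (fun x (i : Fin n) => V i x.1) ((μ P).prod (auxMeasure _)) ∧
      (0 < n → 3 ≤ m n → 0 < M n → ∀ K : ℝ, 1 ≤ K → ((μ P).prod (auxMeasure _)) {x |
        ENNReal.ofReal ((K ^ 3 * c * C * (56 + 8 * ζ)) *
            couplingRate r γ n (m n) (totalInstr (k n)) (envSup Ps (F n)).toReal (B n) (M n)) <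
          ⨆ f ∈ ℱ n, ENNReal.ofReal (rNorm r fun a : InstrIdx (k n) =>
            multiplier (fun i => w n i x.1) (fun i => V i x.1)
              (fun v => f v * instr (q n) a v) -
                W (fun v => f v * instr (q n) a v) x)} ≤ ENNReal.ofReal (4 / K ^ 2)) := by
    intro P n
    by_cases hP : P ∈ Ps
    swap
    · exact ⟨0, fun h => absurd h hP⟩
    have := hμ P hP
    have hlaw : ∀ i, (μ P).map (V i) = P := fun i => ((hV.2 P hP).2 i).map_eq
    have hPprob : IsProbabilityMeasure P := by
      rw [← hlaw 0]
      exact Measure.isProbabilityMeasure_map (hV.1 0).aemeasurable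
    have hVm : ∀ i : Fin n, Measurable (V i) := fun i => hV.1 i
    by_cases hcond : 0 < n ∧ 3 ≤ m n ∧ 0 < M n
    swap
    -- For the finitely many other sample sizes any isonormal process will do.
    · obtain ⟨W, hW, hind⟩ := exists_isIsonormal_indepFun P (μ P) hVm
      exact ⟨W, fun _ => ⟨hW, hind, fun h1 h2 h3 => absurd ⟨h1, h2, h3⟩ hcond⟩⟩
    obtain ⟨N, hN, hexp⟩ := hp.expansion P hP n
    obtain ⟨hwi, hwl, hwV⟩ := hw.2 P hP n
    have hmap : ∀ i, (μ P).map (w n i) = gaussianReal 0 1 := fun i => (hwl i).map_eq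
    have hFD : eLpNorm (F n) 2 P ≤ ENNReal.ofReal (envSup Ps (F n)).toReal := by
      rw [ENNReal.ofReal_toReal (envSup_lt_top (hF.2.2 n)).ne]
      exact le_iSup₂ (f := fun P (_ : P ∈ Ps) => eLpNorm (F n) 2 P) P hP
    obtain ⟨W, hW, hind, hbd⟩ := exists_bootstrap_coupling hcond.1 hVm
      ((hV.2 P hP).1.precomp Fin.val_injective) (fun i => hlaw i) (hw.1 n) hwi hmap hwV.symm hr
      (hq.1 n) (hq.2.1 n) (fun a => hq.2.2 n a P hP) (hF.2.1 n) ENNReal.toReal_nonneg hFD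
      (hp.memLp P hP n) (hp.orthonormal P hP n) hC1
      (fun j => (hC₀ P hP n j).trans (ENNReal.ofReal_le_ofReal (le_max_left _ _))) hcond.2.1 hc1
      (fun t ht => (hc₀ n P hP t ht).trans (le_max_left _ _)) hcond.2.2 hp.gamma_gt hN hexp
    exact ⟨W, fun _ => ⟨hW, hind, fun _ _ _ => hbd⟩⟩
  choose W hW using hW
  refine ⟨AuxSpace (Obs dx dz), inferInstance, auxMeasure _, inferInstance, W,
    fun P hP n => ⟨(hW P n hP).1, (hW P n hP).2.1⟩, fun ε hε => ?_⟩
  -- The failure probability `4 / K ^ 2` is at most `ε` for `K = 1 + 2 / √ε`.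
  have hK : 1 ≤ 1 + 2 / √ε := le_add_of_nonneg_right (by positivity)
  refine ⟨(1 + 2 / √ε) ^ 3 * c * C * (56 + 8 * ζ), by positivity, ?_⟩
  filter_upwards [eventually_gt_atTop 0, hm.eventually_ge_atTop 3,
    hp.M_tendsto.eventually_gt_atTop 0] with n hn hmn hMn P hP
  refine ((hW P n hP).2.2 hn hmn hMn _ hK).trans (ENNReal.ofReal_le_ofReal ?_)
  have h1 : 4 / ε ≤ (1 + 2 / √ε) ^ 2 := by
    have h2 : 4 / ε = (2 / √ε) ^ 2 := by
      rw [div_pow, Real.sq_sqrt hε.le]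
      norm_num
    rw [h2]
    exact pow_le_pow_left₀ (by positivity) (by linarith) 2
  rw [div_le_iff₀ hε] at h1
  rw [div_le_iff₀ (by positivity)]
  linarith
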